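/- **Setting.** Let $G$ be an inverse semigroup (every $g$ has a unique $g^{-1}$ with $gg^{-1}g=g$, $g^{-1}gg^{-1}=g^{-1}$), $\mathrm{Idem}(G)$ its commutative semilattice of idempotents, and $g\le h$ iff $g=eh$ for some $e\in \mathrm{Idem}(G)$. Let $X$ be the locally compact Hausdorff space of all nonzero multiplicative maps $\chi:\mathrm{Idem}(G)\to\{0,1\}$ with the topology of pointwise convergence; it is the Gelfand spectrum of the universal $C^*$-algebra generated by commuting projections $1_e$ ($e\in \mathrm{Idem}(G)$) with $1_e1_f=1_{ef}$. Thus $1_e(\chi)=\chi(e)$. The semigroup $G$ acts on $C_0(X)$ by $g(1_e)=1_{geg^{-1}}$. Assume that $G$ is *$E$-continuous*: for every $g\in G$ the pointwise supremum $\bigvee\{1_e : e\in \mathrm{Idem}(G),\ e\le g\}$ lies in $C_0(X)$. A *$G$-algebra* is a $C^*$-algebra $A$ with a semigroup homomorphism $\alpha:G\to\mathrm{End}(A)$ into the $*$-endomorphisms of $A$ such that $\alpha_{gg^{-1}}(a)b=a\,\alpha_{gg^{-1}}(b)$ for all $a,b\in A$, $g\in G$. A *$G$-Hilbert $A$-module*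 is a (right) Hilbert $A$-module $\mathcal E$ with a semigroup homomorphism $U$ from $G$ to the linear maps on $\mathcal E$ such that $\langle U_g\xi,U_g\eta\rangle=\alpha_g(\langle\xi,\eta\rangle)$, $U_g(\xi a)=U_g(\xi)\alpha_g(a)$ and $U_{gg^{-1}}(\xi)a=\xi\,\alpha_{gg^{-1}}(a)$. In particular $A$ is a $G$-Hilbert $A$-module with $\langle a,b\rangle=a^*b$ and $U=\alpha$. Every $G$-Hilbert $A$-module $\mathcal E$ carries the representation $\pi:C_0(X)\to\mathcal L(\mathcal E)$ determined by $\pi(1_e)=U_e$. Let $\widehat{\ell^2}(G)$ be the $G$-Hilbert $C_0(X)$-module generated, as the completion of a linear span, by vectors $\varphi_g$ ($g\in G$) with $g(\varphi_h)=\varphi_{gh}$, $\varphi_g1_e=\varphi_{eg}$ and $$\langle\varphi_g,\varphi_h\rangle=\bigvee\{1_e : e\in \mathrm{Idem}(G),\ eg=eh,\ e\le gg^{-1}hh^{-1}\}\in C_0(X).$$ For a $G$-Hilbert $A$-module $\mathcal E$ let $L^2(G,\mathcal E)=\widehat{\ell^2}(G)\otimes_{C_0(X)}\mathcal E$ be the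 internal tensor product with respect to $\pi$, that is, the Hausdorff completion of the algebraic tensor product for $\langle x\otimes\xi,y\otimes\eta\rangle=\langle\xi,\pi(\langle x,y\rangle)\eta\rangle$, with the diagonal $G$-action. For a $G$-Hilbert $A$-module $\mathcal F$ let $\mathcal F^\infty=\mathcal F\oplus\mathcal F\oplus\cdots$ be the Hilbert module direct sum of countably infinitely many copies of $\mathcal F$, with the componentwise $G$-action. **Theorem.** Let $G$ be an $E$-continuous inverse semigroup, let $A$ be a $G$-algebra with a strictly positive element (some $h\ge 0$ in $A$ with $hA$ dense in $A$), and let $\mathcal E$ be a $G$-Hilbert $A$-module that is countably generated and full as a Hilbert $A$-module (for some countable $S\subseteq\mathcal E$ the span of $SA$ is dense in $\mathcal E$, and the span of $\{\langle\xi,\eta\rangle : \xi,\eta\in\mathcal E\}$ is dense in $A$). Then there is a $G$-equivariant isomorphism of Hilbert $A$-modules $$L^2(G,\mathcal E)^\infty\;\cong\;L^2(G,A)^\infty ,$$ that is, a linear bijection that preserves the right $A$-action and the $A$-valued inner product and commutes with the action of $G$. -/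

import Mathlib

noncomputable section

/-! ### Inverse semigroups -/

/-- An inverse semigroup: every `g` has a unique generalised inverse `g⁻¹`. -/
class InverseSemigroup (G : Type*) extends Semigroup G, Inv G where
  mul_inv_mul : ∀ g : G, g * g⁻¹ * g = g
  inv_mul_inv : ∀ g : G, g⁻¹ * g * g⁻¹ = g⁻¹
  inv_unique : ∀ g h : G, g * h * g = g → h * g * h = h → h = g⁻¹

namespace InverseSemigroup

variable {G : Type*} [InverseSemigroup G]

theorem inv_of_idem {e : G} (he : e * e = e) : e⁻¹ = e :=
  (inv_unique e e (by rw [he, he]) (by rw [he, he])).symm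

theorem inv_inv' (g : G) : g⁻¹⁻¹ = g :=
  (inv_unique g⁻¹ g (inv_mul_inv g) (mul_inv_mul g)).symm

theorem idem_mul_idem {e f : G} (he : e * e = e) (hf : f * f = f) :
    (e * f) * (e * f) = e * f := by
  have h1 := mul_inv_mul (e * f)
  have h2 := inv_mul_inv (e * f)
  generalize hx : (e * f)⁻¹ = x at h1 h2
  have h3 : f * x * e = x := by
    rw [← hx]
    apply inv_unique
    · rw [hx]
      calc e * f * (f * x * e) * (e * f) = e * (f * f) * x * (e * e) * f := by simp only [mul_assoc]
        _ = e * f * x * (e * f) := by rw [he, hf]; simp only [mul_assoc]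
        _ = e * f := h1
    · rw [hx]
      calc f * x * e * (e * f) * (f * x * e) = f * (x * ((e * e) * (f * f)) * x) * e := by
            simp only [mul_assoc]
        _ = f * (x * (e * f) * x) * e := by rw [he, hf]
        _ = f * x * e := by rw [h2]
  have h4 : x * x = x := by
    calc x * x = (f * x * e) * (f * x * e) := by rw [h3]
      _ = f * (x * (e * f) * x) * e := by simp only [mul_assoc]
      _ = x := by rw [h2, h3]
  have h5 : x⁻¹ = x := inv_of_idem h4
  have h6 : e * f = x := by rw [← h5, ← hx, inv_inv']
  rw [h6, h4]

theorem idem_comm {e f : G} (he : e * e = e) (hf : f * f = f) : e * f = f * e := by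
  have h1 := idem_mul_idem he hf
  have h2 := idem_mul_idem hf he
  have h3 : f * e = (e * f)⁻¹ := by
    apply inv_unique
    · calc e * f * (f * e) * (e * f) = e * (f * f) * (e * e) * f := by simp only [mul_assoc]
        _ = (e * f) * (e * f) := by rw [he, hf]; simp only [mul_assoc]
        _ = e * f := h1
    · calc f * e * (e * f) * (f * e) = f * (e * e) * (f * f) * e := by simp only [mul_assoc]
        _ = (f * e) * (f * e) := by rw [he, hf]; simp only [mul_assoc]
        _ = f * e := h2
  rw [h3, inv_of_idem h1]

theorem mul_inv_idem (g : G) : (g * g⁻¹) * (g * g⁻¹) = g * g⁻¹ := by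
  rw [← mul_assoc, mul_inv_mul]

theorem inv_mul_idem (g : G) : (g⁻¹ * g) * (g⁻¹ * g) = g⁻¹ * g := by
  rw [← mul_assoc, inv_mul_inv]

theorem mul_inv_rev' (g h : G) : (g * h)⁻¹ = h⁻¹ * g⁻¹ := by
  symm
  have hc := idem_comm (mul_inv_idem h) (inv_mul_idem g)
  apply inv_unique
  · calc g * h * (h⁻¹ * g⁻¹) * (g * h) = g * ((h * h⁻¹) * (g⁻¹ * g)) * h := by
          simp only [mul_assoc]
      _ = (g * g⁻¹ * g) * (h * h⁻¹ * h) := by rw [hc]; simp only [mul_assoc]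
      _ = g * h := by rw [mul_inv_mul, mul_inv_mul]
  · calc h⁻¹ * g⁻¹ * (g * h) * (h⁻¹ * g⁻¹) = h⁻¹ * ((g⁻¹ * g) * (h * h⁻¹)) * g⁻¹ := by
          simp only [mul_assoc]
      _ = (h⁻¹ * h * h⁻¹) * (g⁻¹ * g * g⁻¹) := by rw [← hc]; simp only [mul_assoc]
      _ = h⁻¹ * g⁻¹ := by rw [inv_mul_inv, inv_mul_inv]

theorem conj_idem (g : G) {e : G} (he : e * e = e) :
    (g * e * g⁻¹) * (g * e * g⁻¹) = g * e * g⁻¹ := by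
  have hc := idem_comm (inv_mul_idem g) he
  calc (g * e * g⁻¹) * (g * e * g⁻¹) = g * e * ((g⁻¹ * g) * e) * g⁻¹ := by simp only [mul_assoc]
    _ = g * (e * e) * (g⁻¹ * g * g⁻¹) := by rw [hc]; simp only [mul_assoc]
    _ = g * e * g⁻¹ := by rw [he, inv_mul_inv]

/-- `g e = (g e g⁻¹) g` for an idempotent `e`. -/
theorem mul_idem_eq (g : G) {e : G} (he : e * e = e) : g * e = g * e * g⁻¹ * g := by
  have hc := idem_comm (inv_mul_idem g) he
  calc g * e = (g * g⁻¹ * g) * e := by rw [mul_inv_mul]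
    _ = g * ((g⁻¹ * g) * e) := by simp only [mul_assoc]
    _ = g * e * g⁻¹ * g := by rw [hc]; simp only [mul_assoc]

end InverseSemigroup

/-! ### Hilbert modules -/

/-- A (right) Hilbert `A`-module: the Banach space `E` carries a right action `x ◃ a` of `A` and an
`A`-valued inner product, conjugate linear in the first and `A`-linear in the second variable, that
induces the norm.  The axioms of a right module follow from these (see below). -/
class HilbertModule (A : Type*) (E : Type*) [NonUnitalCStarAlgebra A] [PartialOrder A]
    [StarOrderedRing A] [NormedAddCommGroup E] [NormedSpace ℂ E] [CompleteSpace E] where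
  inner : E → E → A
  rsmul : E → A → E
  inner_add_right : ∀ x y z, inner x (y + z) = inner x y + inner x z
  inner_smul_right : ∀ (c : ℂ) x y, inner x (c • y) = c • inner x y
  inner_rsmul_right : ∀ x y (a : A), inner x (rsmul y a) = inner x y * a
  star_inner : ∀ x y, star (inner x y) = inner y x
  inner_self_nonneg : ∀ x, 0 ≤ inner x x
  norm_sq_eq : ∀ x, ‖x‖ ^ 2 = ‖inner x x‖

namespace HilbertModule

variable {A E : Type*} [NonUnitalCStarAlgebra A] [PartialOrder A]
    [StarOrderedRing A] [NormedAddCommGroup E] [NormedSpace ℂ E] [CompleteSpace E]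
    [HilbertModule A E]

theorem inner_add_left (x y z : E) : inner (A := A) (x + y) z = inner x z + inner y z := by
  rw [← star_inner z (x + y), inner_add_right, star_add, star_inner, star_inner]

theorem inner_smul_left (c : ℂ) (x y : E) : inner (A := A) (c • x) y = star c • inner x y := by
  rw [← star_inner y (c • x), inner_smul_right, star_smul, star_inner]

theorem inner_rsmul_left (x y : E) (a : A) : inner (rsmul x a) y = star a * inner x y := by
  rw [← star_inner y (rsmul x a), inner_rsmul_right, star_mul, star_inner]

variable (A) in
/-- The inner product as a sesquilinear map. -/
def innerₛₗ : E →ₗ⋆[ℂ] E →ₗ[ℂ] A :=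
  LinearMap.mk₂'ₛₗ _ _ (fun x y => inner x y) inner_add_left inner_smul_left inner_add_right
    inner_smul_right

@[simp] theorem innerₛₗ_apply (x y : E) : innerₛₗ A x y = inner x y := rfl

theorem inner_sub_right (x y z : E) : inner (A := A) x (y - z) = inner x y - inner x z :=
  map_sub (innerₛₗ A x) y z

theorem inner_sub_left (x y z : E) : inner (A := A) (x - y) z = inner x z - inner y z := by
  rw [← star_inner z (x - y), inner_sub_right, star_sub, star_inner, star_inner]

variable (A) in
theorem inner_zero_right (x : E) : inner (A := A) x 0 = 0 := map_zero (innerₛₗ A x)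

variable (A) in
theorem inner_zero_left (x : E) : inner (A := A) 0 x = 0 := by
  rw [← star_inner x 0, inner_zero_right, star_zero]

variable (A) in
theorem eq_zero_of_inner_self {x : E} (h : inner (A := A) x x = 0) : x = 0 := by
  have := norm_sq_eq (A := A) x
  rw [h, norm_zero] at this
  simpa using this

variable (A) in
theorem ext_inner {x y : E} (h : ∀ z, inner (A := A) z x = inner z y) : x = y := by
  rw [← sub_eq_zero]
  apply eq_zero_of_inner_self A
  rw [inner_sub_right, h, sub_self]

theorem add_rsmul (x y : E) (a : A) : rsmul (x + y) a = rsmul x a + rsmul y a :=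
  ext_inner A fun z => by simp [inner_rsmul_right, inner_add_right, add_mul]

theorem rsmul_add (x : E) (a b : A) : rsmul x (a + b) = rsmul x a + rsmul x b :=
  ext_inner A fun z => by simp [inner_rsmul_right, inner_add_right, mul_add]

theorem rsmul_mul (x : E) (a b : A) : rsmul x (a * b) = rsmul (rsmul x a) b :=
  ext_inner A fun z => by simp [inner_rsmul_right, mul_assoc]

theorem smul_rsmul (c : ℂ) (x : E) (a : A) : rsmul (c • x) a = c • rsmul x a :=
  ext_inner A fun z => by simp only [inner_rsmul_right, inner_smul_right, smul_mul_assoc]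

theorem rsmul_smul (c : ℂ) (x : E) (a : A) : rsmul x (c • a) = c • rsmul x a :=
  ext_inner A fun z => by simp only [inner_rsmul_right, inner_smul_right, mul_smul_comm]

end HilbertModule

open HilbertModule in
/-- A C⋆-algebra as a Hilbert module over itself: `⟨a, b⟩ = a⋆ b`. -/
instance HilbertModule.self {A : Type*} [NonUnitalCStarAlgebra A] [PartialOrder A]
    [StarOrderedRing A] : HilbertModule A A where
  inner a b := star a * b
  rsmul a b := a * b
  inner_add_right x y z := mul_add _ _ _
  inner_smul_right c x y := mul_smul_comm _ _ _
  inner_rsmul_right x y a := (mul_assoc _ _ _).symm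
  star_inner x y := by simp
  inner_self_nonneg x := star_mul_self_nonneg x
  norm_sq_eq x := by rw [CStarRing.norm_star_mul_self, sq]

/-- `E` is countably generated: for some countable `S`, the products `x a` (`x ∈ S`, `a ∈ A`)
span a dense subspace of `E`. -/
def HilbertModule.IsCountablyGenerated (A E : Type*) [NonUnitalCStarAlgebra A] [PartialOrder A]
    [StarOrderedRing A] [NormedAddCommGroup E] [NormedSpace ℂ E] [CompleteSpace E]
    [HilbertModule A E] : Prop :=
  ∃ S : Set E, S.Countable ∧
    Dense (Submodule.span ℂ {y : E | ∃ x ∈ S, ∃ a : A, y = rsmul x a} : Set E)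

/-- `E` is full: the inner products span a dense subspace of `A`. -/
def HilbertModule.IsFull (A E : Type*) [NonUnitalCStarAlgebra A] [PartialOrder A]
    [StarOrderedRing A] [NormedAddCommGroup E] [NormedSpace ℂ E] [CompleteSpace E]
    [HilbertModule A E] : Prop :=
  Dense (Submodule.span ℂ {a : A | ∃ x y : E, a = inner x y} : Set A)

/-- `A` has a strictly positive element, i.e. some `h ≥ 0` such that `h A` is dense in `A`. -/
def HasStrictlyPositiveElement (A : Type*) [NonUnitalCStarAlgebra A] [PartialOrder A]
    [StarOrderedRing A] : Prop :=
  ∃ h : A, 0 ≤ h ∧ Dense (Set.range fun a : A => h * a)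

/-! ### Completion of pre-Hilbert modules -/

/-- A semi-inner-product right `A`-module structure on a complex vector space `V`. -/
structure PreHilbert (A V : Type*) [NonUnitalCStarAlgebra A] [PartialOrder A]
    [StarOrderedRing A] [AddCommGroup V] [Module ℂ V] where
  form : V →ₗ⋆[ℂ] V →ₗ[ℂ] A
  act : A → V →ₗ[ℂ] V
  star_form : ∀ x y, star (form x y) = form y x
  form_act : ∀ x y a, form x (act a y) = form x y * a
  form_nonneg : ∀ x, 0 ≤ form x x

namespace PreHilbert

variable {A V : Type*} [NonUnitalCStarAlgebra A] [PartialOrder A]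
    [StarOrderedRing A] [AddCommGroup V] [Module ℂ V] (P : PreHilbert A V)

theorem form_act_left (x y : V) (a : A) : P.form (P.act a x) y = star a * P.form x y := by
  rw [← P.star_form, P.form_act, star_mul, P.star_form]

theorem form_le (x y : V) {c : ℝ} (hc : 0 < c) (hx : ‖P.form x x‖ ≤ c) :
    P.form y x * P.form x y ≤ c • P.form y y := by
  have key : (0 : A) ≤ c • (c • P.form y y - P.form y x * P.form x y) := by
    have h0 := P.form_nonneg (P.act (P.form x y) x - (c : ℂ) • y)
    have hl : ∀ z, P.form (c • y) z = c • P.form y z := fun z => by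
      rw [← Complex.coe_smul, LinearMap.map_smulₛₗ, LinearMap.smul_apply, Complex.conj_ofReal,
        Complex.coe_smul]
    have hr : ∀ z, P.form z (c • y) = c • P.form z y := fun z => by
      rw [← Complex.coe_smul, map_smul, Complex.coe_smul]
    have h1 : P.form (P.act (P.form x y) x - (c : ℂ) • y) (P.act (P.form x y) x - (c : ℂ) • y)
        = P.form y x * P.form x x * P.form x y - c • (P.form y x * P.form x y)
          - c • (P.form y x * P.form x y) + c • c • P.form y y := by
      simp only [map_sub, LinearMap.sub_apply, P.form_act, P.form_act_left, P.star_form,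
        Complex.coe_smul, hl, hr, smul_mul_assoc, mul_smul_comm]
      abel
    have h2 : P.form y x * P.form x x * P.form x y ≤ c • (P.form y x * P.form x y) := by
      have h3 : star (P.form x y) * P.form x x * P.form x y
          ≤ ‖P.form x x‖ • (star (P.form x y) * P.form x y) :=
        CStarAlgebra.star_left_conjugate_le_norm_smul
          (hb := (P.form_nonneg x).isSelfAdjoint)
      rw [P.star_form] at h3
      refine h3.trans ?_
      refine smul_le_smul_of_nonneg_right hx ?_
      rw [← P.star_form x y]
      exact star_mul_self_nonneg _
    rw [h1] at h0
    refine h0.trans ?_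
    rw [smul_sub]
    calc _ ≤ c • (P.form y x * P.form x y) - c • (P.form y x * P.form x y)
          - c • (P.form y x * P.form x y) + c • c • P.form y y := by gcongr
      _ = _ := by abel
  have h := smul_nonneg (inv_nonneg.2 hc.le) key
  rw [inv_smul_smul₀ hc.ne'] at h
  exact sub_nonneg.1 h

/-- The Cauchy–Schwarz inequality. -/
theorem norm_form_sq_le (x y : V) : ‖P.form x y‖ ^ 2 ≤ ‖P.form x x‖ * ‖P.form y y‖ := by
  have h : ∀ c : ℝ, ‖P.form x x‖ < c → ‖P.form x y‖ ^ 2 ≤ c * ‖P.form y y‖ := by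
    intro c hc
    have hc0 : 0 < c := (norm_nonneg _).trans_lt hc
    calc ‖P.form x y‖ ^ 2 = ‖star (P.form x y) * P.form x y‖ := by
          rw [CStarRing.norm_star_mul_self, sq]
      _ ≤ ‖c • P.form y y‖ := by
          apply CStarAlgebra.norm_le_norm_of_nonneg_of_le (star_mul_self_nonneg _)
          rw [P.star_form]
          exact P.form_le x y hc0 hc.le
      _ = c * ‖P.form y y‖ := by rw [norm_smul, Real.norm_of_nonneg hc0.le]
  have ht : Filter.Tendsto (fun c : ℝ => c * ‖P.form y y‖) 
      (nhdsWithin ‖P.form x x‖ (Set.Ioi ‖P.form x x‖)) (nhds (‖P.form x x‖ * ‖P.form y y‖)) :=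
    (Continuous.tendsto (by fun_prop) _).mono_left nhdsWithin_le_nhds
  exact ge_of_tendsto ht (Filter.eventually_of_mem self_mem_nhdsWithin fun c hc => h c hc)

/-- The seminorm `x ↦ ‖⟨x, x⟩‖^(1/2)`. -/
def seminorm : Seminorm ℂ V :=
  Seminorm.of (fun x => √‖P.form x x‖)
    (fun x y => by
      have hxy : ‖P.form x y‖ ≤ √‖P.form x x‖ * √‖P.form y y‖ := by
        rw [← Real.sqrt_mul (norm_nonneg _)]
        exact Real.le_sqrt_of_sq_le (P.norm_form_sq_le x y)
      have hyx : ‖P.form y x‖ ≤ √‖P.form x x‖ * √‖P.form y y‖ := by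
        rw [← P.star_form, norm_star]
        exact hxy
      refine Real.sqrt_le_iff.2 ⟨by positivity, ?_⟩
      calc ‖P.form (x + y) (x + y)‖
          = ‖P.form x x + P.form x y + (P.form y x + P.form y y)‖ := by
            simp only [map_add, LinearMap.add_apply]; congr 1; abel
        _ ≤ ‖P.form x x‖ + ‖P.form x y‖ + (‖P.form y x‖ + ‖P.form y y‖) :=
            (norm_add_le _ _).trans (add_le_add (norm_add_le _ _) (norm_add_le _ _))
        _ ≤ (√‖P.form x x‖) ^ 2 + √‖P.form x x‖ * √‖P.form y y‖
            + (√‖P.form x x‖ * √‖P.form y y‖ + (√‖P.form y y‖) ^ 2) := by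
            rw [Real.sq_sqrt (norm_nonneg _), Real.sq_sqrt (norm_nonneg _)]
            gcongr
        _ = _ := by ring)
    (fun c x => by
      simp only [LinearMap.map_smulₛₗ, LinearMap.smul_apply, map_smul, norm_smul,
        RCLike.norm_conj]
      rw [← mul_assoc, Real.sqrt_mul (by positivity), Real.sqrt_mul_self (norm_nonneg _)])

/-- `V` with the topology of the seminorm of `P`. -/
@[nolint unusedArguments]
def Space (_ : PreHilbert A V) : Type _ := V

instance : SeminormedAddCommGroup P.Space :=
  AddGroupSeminorm.toSeminormedAddCommGroup (E := V) P.seminorm.toAddGroupSeminorm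

/-- The vector space structure of `V`. -/
@[reducible]
def moduleAux : Module ℂ P.Space := inferInstanceAs (Module ℂ V)

instance : NormedSpace ℂ P.Space where
  toModule := moduleAux P
  norm_smul_le c x := (map_smul_eq_mul P.seminorm c x).le

/-- The Hausdorff completion of `V` with respect to the seminorm of `P`. -/
abbrev Completed : Type _ := UniformSpace.Completion P.Space

/-- The canonical map of `V` to its completion. -/
def ι : V →ₗ[ℂ] P.Completed :=
  (UniformSpace.Completion.toComplL (𝕜 := ℂ) (E := P.Space)).toLinearMap

theorem norm_sq_ι (x : V) : ‖P.ι x‖ ^ 2 = ‖P.form x x‖ := by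
  have h : ‖P.ι x‖ = √‖P.form x x‖ := UniformSpace.Completion.norm_coe (E := P.Space) x
  rw [h, Real.sq_sqrt (norm_nonneg _)]

theorem denseRange_ι : DenseRange P.ι := UniformSpace.Completion.denseRange_coe (α := P.Space)

theorem norm_form_le (x y : V) : ‖P.form x y‖ ≤ ‖P.ι x‖ * ‖P.ι y‖ := by
  refine (sq_le_sq₀ (norm_nonneg _) (by positivity)).1 ?_
  rw [mul_pow, P.norm_sq_ι, P.norm_sq_ι]
  exact P.norm_form_sq_le x y

theorem norm_act_le (a : A) (x : V) : ‖P.ι (P.act a x)‖ ≤ ‖a‖ * ‖P.ι x‖ := by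
  refine (sq_le_sq₀ (norm_nonneg _) (by positivity)).1 ?_
  rw [mul_pow, P.norm_sq_ι, P.norm_sq_ι, P.form_act, P.form_act_left]
  calc ‖star a * P.form x x * a‖ ≤ ‖star a‖ * ‖P.form x x‖ * ‖a‖ :=
        (norm_mul_le _ _).trans (by gcongr; exact norm_mul_le _ _)
    _ = _ := by rw [norm_star]; ring

theorem ext_clm {F : Type*} [NormedAddCommGroup F] [NormedSpace ℂ F]
    {f g : P.Completed →L[ℂ] F} (h : ∀ x, f (P.ι x) = g (P.ι x)) : f = g :=
  ContinuousLinearMap.ext fun x => congrFun (P.denseRange_ι.equalizer f.continuous g.continuous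
    (funext h)) x

theorem form_bound (x : V) : ∃ C, ∀ y, ‖P.form x y‖ ≤ C * ‖P.ι y‖ :=
  ⟨_, fun y => P.norm_form_le x y⟩

/-- The form, extended by continuity in the second variable. -/
def halfInner : V →ₗ⋆[ℂ] P.Completed →L[ℂ] A where
  toFun x := (P.form x).extendOfNorm P.ι
  map_add' x y := P.ext_clm fun z => by
    simp only [add_apply]
    rw [LinearMap.extendOfNorm_eq P.denseRange_ι (P.form_bound _),
      LinearMap.extendOfNorm_eq P.denseRange_ι (P.form_bound _),
      LinearMap.extendOfNorm_eq P.denseRange_ι (P.form_bound _), map_add, LinearMap.add_apply]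
  map_smul' c x := P.ext_clm fun z => by
    simp only [smul_apply]
    rw [LinearMap.extendOfNorm_eq P.denseRange_ι (P.form_bound _),
      LinearMap.extendOfNorm_eq P.denseRange_ι (P.form_bound _), LinearMap.map_smulₛₗ,
      LinearMap.smul_apply]

theorem halfInner_ι (x y : V) : P.halfInner x (P.ι y) = P.form x y :=
  LinearMap.extendOfNorm_eq P.denseRange_ι (P.form_bound _) y

theorem norm_halfInner_le (x : V) : ‖P.halfInner x‖ ≤ 1 * ‖P.ι x‖ := by
  rw [one_mul]
  exact LinearMap.opNorm_extendOfNorm_le P.denseRange_ι (norm_nonneg _) (P.norm_form_le x)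

/-- The `A`-valued inner product on the completion, extending the form by continuity. -/
def completedInner : P.Completed →L⋆[ℂ] P.Completed →L[ℂ] A := P.halfInner.extendOfNorm P.ι

theorem completedInner_ι (x y : V) : P.completedInner (P.ι x) (P.ι y) = P.form x y := by
  rw [completedInner, LinearMap.extendOfNorm_eq P.denseRange_ι ⟨_, P.norm_halfInner_le⟩,
    halfInner_ι]

/-- A linear map on `V` that is bounded for the seminorm, extended to the completion. -/
def extend (T : V →ₗ[ℂ] V) : P.Completed →L[ℂ] P.Completed := (P.ι ∘ₗ T).extendOfNorm P.ι

theorem extend_ι {T : V →ₗ[ℂ] V} {C : ℝ} (hT : ∀ x, ‖P.ι (T x)‖ ≤ C * ‖P.ι x‖) (x : V) :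
    P.extend T (P.ι x) = P.ι (T x) :=
  LinearMap.extendOfNorm_eq P.denseRange_ι ⟨C, hT⟩ x

theorem extend_act_ι (a : A) (x : V) : P.extend (P.act a) (P.ι x) = P.ι (P.act a x) :=
  P.extend_ι (P.norm_act_le a) x

@[elab_as_elim]
theorem induction {p : P.Completed → Prop} (x : P.Completed) (hp : IsClosed {x | p x})
    (h : ∀ x, p (P.ι x)) : p x :=
  P.denseRange_ι.induction_on x hp h

/-- The completion of a pre-Hilbert module is a Hilbert module. -/
instance : HilbertModule A P.Completed where
  inner x y := P.completedInner x y
  rsmul x a := P.extend (P.act a) x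
  inner_add_right x y z := map_add _ _ _
  inner_smul_right c x y := map_smul _ _ _
  inner_rsmul_right x y a := by
    refine P.induction x (isClosed_eq (by fun_prop) (by fun_prop)) fun x => ?_
    refine P.induction y (isClosed_eq (by fun_prop) (by fun_prop)) fun y => ?_
    rw [extend_act_ι, completedInner_ι, completedInner_ι, form_act]
  star_inner x y := by
    refine P.induction x (isClosed_eq (by fun_prop) (by fun_prop)) fun x => ?_
    refine P.induction y (isClosed_eq (by fun_prop) (by fun_prop)) fun y => ?_
    rw [completedInner_ι, completedInner_ι, star_form]
  inner_self_nonneg x := by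
    refine P.induction x ?_ fun x => ?_
    · exact CStarAlgebra.isClosed_nonneg.preimage (f := fun x => P.completedInner x x) (by fun_prop)
    · rw [completedInner_ι]
      exact P.form_nonneg x
  norm_sq_eq x := by
    refine P.induction x (isClosed_eq (by fun_prop) (by fun_prop)) fun x => ?_
    rw [completedInner_ι, norm_sq_ι]

theorem inner_ι (x y : V) : HilbertModule.inner (A := A) (P.ι x) (P.ι y) = P.form x y :=
  P.completedInner_ι x y

theorem rsmul_ι (x : V) (a : A) : HilbertModule.rsmul (P.ι x) a = P.ι (P.act a x) :=
  P.extend_act_ι a x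

end PreHilbert

/-! ### `G`-algebras and `G`-Hilbert modules -/

/-- A `G`-algebra: `G` acts on `A` by `*`-endomorphisms such that `α_{gg⁻¹}(a) b = a α_{gg⁻¹}(b)`. -/
class GAlgebra (G A : Type*) [InverseSemigroup G] [NonUnitalCStarAlgebra A] where
  act : G → A →⋆ₙₐ[ℂ] A
  act_mul : ∀ g h a, act (g * h) a = act g (act h a)
  act_central : ∀ (g : G) (a b : A), act (g * g⁻¹) a * b = a * act (g * g⁻¹) b

/-- A `G`-Hilbert module over the `G`-algebra `A`. -/
class GHilbertModule (G A E : Type*) [InverseSemigroup G] [NonUnitalCStarAlgebra A]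
    [PartialOrder A] [StarOrderedRing A] [GAlgebra G A] [NormedAddCommGroup E] [NormedSpace ℂ E]
    [CompleteSpace E] [HilbertModule A E] where
  U : G → E →ₗ[ℂ] E
  U_mul : ∀ g h x, U (g * h) x = U g (U h x)
  inner_U : ∀ g x y, HilbertModule.inner (A := A) (U g x) (U g y)
    = GAlgebra.act g (HilbertModule.inner (A := A) x y)
  U_rsmul : ∀ g x (a : A), U g (HilbertModule.rsmul x a)
    = HilbertModule.rsmul (U g x) (GAlgebra.act g a)
  U_central : ∀ g x (a : A), HilbertModule.rsmul (U (g * g⁻¹) x) a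
    = HilbertModule.rsmul x (GAlgebra.act (g * g⁻¹) a)

/-- A `G`-algebra as a `G`-Hilbert module over itself. -/
instance GHilbertModule.self {G A : Type*} [InverseSemigroup G] [NonUnitalCStarAlgebra A]
    [PartialOrder A] [StarOrderedRing A] [GAlgebra G A] : GHilbertModule G A A where
  U g := { toFun := GAlgebra.act g, map_add' := map_add _, map_smul' := map_smul _ }
  U_mul g h x := GAlgebra.act_mul g h x
  inner_U g x y := by
    change star (GAlgebra.act g x) * GAlgebra.act g y = GAlgebra.act g (star x * y)
    rw [map_mul, map_star]
  U_rsmul g x a := map_mul (GAlgebra.act g) x a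
  U_central g x a := GAlgebra.act_central g x a

/-- A `G`-equivariant isomorphism of Hilbert `A`-modules: a linear bijection that preserves the
right action of `A` and the inner product and commutes with the action of `G`. -/
structure GHilbertIso (G A E F : Type*) [InverseSemigroup G] [NonUnitalCStarAlgebra A]
    [PartialOrder A] [StarOrderedRing A] [GAlgebra G A]
    [NormedAddCommGroup E] [NormedSpace ℂ E] [CompleteSpace E] [HilbertModule A E]
    [GHilbertModule G A E]
    [NormedAddCommGroup F] [NormedSpace ℂ F] [CompleteSpace F] [HilbertModule A F]
    [GHilbertModule G A F] extends E ≃ₗ[ℂ] F where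
  map_rsmul : ∀ (x : E) (a : A), toFun (HilbertModule.rsmul x a) = HilbertModule.rsmul (toFun x) a
  inner_map : ∀ x y : E,
    HilbertModule.inner (A := A) (toFun x) (toFun y) = HilbertModule.inner (A := A) x y
  map_U : ∀ (g : G) (x : E),
    toFun (GHilbertModule.U (A := A) g x) = GHilbertModule.U (A := A) g (toFun x)

namespace GAlgebra

theorem eq_zero_of_mul {A : Type*} [NonUnitalCStarAlgebra A] {a : A} (h : ∀ b, a * b = 0) : a = 0 :=
  CStarRing.mul_star_self_eq_zero_iff a |>.1 (h _)

variable {G A : Type*} [InverseSemigroup G] [NonUnitalCStarAlgebra A] [GAlgebra G A]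

theorem norm_act_le (g : G) (a : A) : ‖act g a‖ ≤ ‖a‖ := NonUnitalStarAlgHom.norm_apply_le _ _

theorem continuous_act (g : G) : Continuous (act (A := A) g) :=
  AddMonoidHomClass.continuous_of_bound (act (A := A) g) 1 fun a => by
    rw [one_mul]; exact norm_act_le g a

end GAlgebra

namespace GHilbertModule

open HilbertModule InverseSemigroup

variable {G A E : Type*} [InverseSemigroup G] [NonUnitalCStarAlgebra A] [PartialOrder A]
  [StarOrderedRing A] [GAlgebra G A] [NormedAddCommGroup E] [NormedSpace ℂ E] [CompleteSpace E]
  [HilbertModule A E] [GHilbertModule G A E]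

theorem norm_U_le (g : G) (x : E) : ‖U (A := A) g x‖ ≤ 1 * ‖x‖ := by
  rw [one_mul]
  refine (sq_le_sq₀ (norm_nonneg _) (norm_nonneg _)).1 ?_
  rw [norm_sq_eq (A := A), norm_sq_eq (A := A), inner_U]
  exact GAlgebra.norm_act_le _ _

variable (A E) in
/-- `U_g` as a bounded operator. -/
def UL (g : G) : E →L[ℂ] E := (U (A := A) (E := E) g).mkContinuous 1 (norm_U_le g)

@[simp] theorem UL_apply (g : G) (x : E) : UL A E g x = U (A := A) g x := rfl

theorem inner_U_mul_inv (g : G) (x y : E) :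
    HilbertModule.inner (A := A) x (U (A := A) (g * g⁻¹) y)
      = GAlgebra.act (g * g⁻¹) (HilbertModule.inner (A := A) x y) := by
  rw [← sub_eq_zero]
  apply GAlgebra.eq_zero_of_mul
  intro b
  rw [sub_mul, ← inner_rsmul_right, U_central, inner_rsmul_right, GAlgebra.act_central, sub_self]

theorem inner_U_idem {e : G} (he : e * e = e) (x y : E) :
    HilbertModule.inner (A := A) x (U (A := A) e y)
      = GAlgebra.act e (HilbertModule.inner (A := A) x y) := by
  have := inner_U_mul_inv (A := A) e x y
  rwa [inv_of_idem he, he] at this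

theorem inner_U_idem_left {e : G} (he : e * e = e) (x y : E) :
    HilbertModule.inner (A := A) (U (A := A) e x) y
      = HilbertModule.inner (A := A) x (U (A := A) e y) := by
  rw [← star_inner, inner_U_idem he, inner_U_idem he, ← map_star, star_inner]

end GHilbertModule

namespace PreHilbert

open HilbertModule InverseSemigroup

variable {A V : Type*} [NonUnitalCStarAlgebra A] [PartialOrder A]
    [StarOrderedRing A] [AddCommGroup V] [Module ℂ V] (P : PreHilbert A V)
    (G : Type*) [InverseSemigroup G] [GAlgebra G A]

/-- An action of `G` on a pre-Hilbert module over a `G`-algebra. -/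
structure Action where
  T : G → V →ₗ[ℂ] V
  T_mul : ∀ g h x, T (g * h) x = T g (T h x)
  form_T : ∀ g x y, P.form (T g x) (T g y) = GAlgebra.act g (P.form x y)
  form_T_idem : ∀ g x y, P.form x (T (g * g⁻¹) y) = GAlgebra.act (g * g⁻¹) (P.form x y)

variable {P G}

theorem Action.norm_T_le (S : P.Action G) (g : G) (x : V) : ‖P.ι (S.T g x)‖ ≤ 1 * ‖P.ι x‖ := by
  rw [one_mul]
  refine (sq_le_sq₀ (norm_nonneg _) (norm_nonneg _)).1 ?_
  rw [norm_sq_ι, norm_sq_ι, S.form_T]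
  exact GAlgebra.norm_act_le _ _

theorem Action.extend_T (S : P.Action G) (g : G) (x : V) :
    P.extend (S.T g) (P.ι x) = P.ι (S.T g x) := P.extend_ι (S.norm_T_le g) x

theorem continuous_inner {Y : Type*} [TopologicalSpace Y] {f g : Y → P.Completed}
    (hf : Continuous f) (hg : Continuous g) :
    Continuous fun y => HilbertModule.inner (A := A) (f y) (g y) :=
  (P.completedInner.continuous.comp hf).clm_apply hg

theorem continuous_rsmul (a : A) :
    Continuous fun x : P.Completed => HilbertModule.rsmul x a := (P.extend (P.act a)).continuous

/-- An action of `G` on a pre-Hilbert module extends by continuity to its completion. -/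
@[reducible]
def Action.gHilbertModule (S : P.Action G) : GHilbertModule G A P.Completed where
  U g := (P.extend (S.T g)).toLinearMap
  U_mul g h x := by
    refine P.induction x (isClosed_eq (ContinuousLinearMap.continuous _)
      ((ContinuousLinearMap.continuous _).comp (ContinuousLinearMap.continuous _))) fun x => ?_
    simp only [ContinuousLinearMap.coe_coe, S.extend_T, S.T_mul]
  inner_U g x y := by
    simp only [ContinuousLinearMap.coe_coe]
    refine P.induction x (isClosed_eq (continuous_inner (by fun_prop) (by fun_prop))
      ((GAlgebra.continuous_act g).comp
        (continuous_inner (by fun_prop) (by fun_prop)))) fun x => ?_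
    refine P.induction y (isClosed_eq (continuous_inner (by fun_prop) (by fun_prop))
      ((GAlgebra.continuous_act g).comp
        (continuous_inner (by fun_prop) (by fun_prop)))) fun y => ?_
    rw [S.extend_T, S.extend_T, inner_ι, inner_ι, S.form_T]
  U_rsmul g x a := by
    simp only [ContinuousLinearMap.coe_coe]
    refine P.induction x (isClosed_eq ((ContinuousLinearMap.continuous _).comp
      (continuous_rsmul a)) ((continuous_rsmul _).comp (by fun_prop))) fun x => ?_
    rw [S.extend_T, rsmul_ι, S.extend_T, rsmul_ι]
    rw [← sub_eq_zero, ← map_sub]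
    apply eq_zero_of_inner_self A
    rw [inner_ι]
    simp only [map_sub, LinearMap.sub_apply, form_act, form_act_left, S.form_T, map_mul,
      map_star]
    noncomm_ring
  U_central g x a := by
    simp only [ContinuousLinearMap.coe_coe]
    refine P.induction x (isClosed_eq ((continuous_rsmul a).comp (by fun_prop))
      (continuous_rsmul _)) fun x => ?_
    rw [S.extend_T, rsmul_ι, rsmul_ι]
    apply ext_inner A
    intro z
    refine P.induction z (isClosed_eq (continuous_inner (by fun_prop) (by fun_prop))
      (continuous_inner (by fun_prop) (by fun_prop))) fun z => ?_
    rw [inner_ι, inner_ι, form_act, form_act, S.form_T_idem, GAlgebra.act_central]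

end PreHilbert

/-! ### Countable direct sums -/

section HilbertSum

open HilbertModule

variable (A E : Type*) [NonUnitalCStarAlgebra A] [PartialOrder A]
    [StarOrderedRing A] [NormedAddCommGroup E] [NormedSpace ℂ E] [CompleteSpace E]
    [HilbertModule A E]

/-- Finitely supported sequences in `E` with `⟨x, y⟩ = ∑ i, ⟨x i, y i⟩` and `(x a) i = (x i) a`. -/
def sumPre : PreHilbert A (ℕ →₀ E) where
  form := LinearMap.mk₂'ₛₗ _ _ (fun x y => x.sum fun i v => inner v (y i))
    (fun x x' y => Finsupp.sum_add_index' (fun i => inner_zero_left A _)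
      fun i v w => HilbertModule.inner_add_left _ _ _)
    (fun c x y => by
      rw [Finsupp.sum_smul_index' (h := fun i v => HilbertModule.inner (A := A) v (y i))
        (fun i => inner_zero_left A _), Finsupp.smul_sum]
      simp only [HilbertModule.inner_smul_left]; rfl)
    (fun x y y' => by
      simp only [Finsupp.add_apply, HilbertModule.inner_add_right, Finsupp.sum,
        Finset.sum_add_distrib])
    (fun c x y => by
      simp only [Finsupp.smul_apply, HilbertModule.inner_smul_right, Finsupp.sum,
        Finset.smul_sum, RingHom.id_apply])
  act a := Finsupp.mapRange.linearMap
    { toFun := fun v => rsmul v a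
      map_add' := fun v w => add_rsmul v w a
      map_smul' := fun c v => smul_rsmul c v a }
  star_form x y := by
    classical
    change star (x.sum fun i v => inner v (y i)) = y.sum fun i v => inner v (x i)
    rw [Finsupp.sum_of_support_subset x (s := x.support ∪ y.support) Finset.subset_union_left
        (fun i v => HilbertModule.inner (A := A) v (y i)) (fun i _ => inner_zero_left A _),
      Finsupp.sum_of_support_subset y (s := x.support ∪ y.support) Finset.subset_union_right
        (fun i v => HilbertModule.inner (A := A) v (x i)) (fun i _ => inner_zero_left A _),
      star_sum]
    simp only [star_inner]
  form_act x y a := by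
    change (x.sum fun i v => inner v (rsmul (y i) a)) = (x.sum fun i v => inner v (y i)) * a
    simp only [inner_rsmul_right, Finsupp.sum, Finset.sum_mul]
  form_nonneg x := Finset.sum_nonneg fun i _ => inner_self_nonneg _

/-- The Hilbert module `E^∞ = E ⊕ E ⊕ ⋯`. -/
abbrev HilbertSum : Type _ := (sumPre A E).Completed

variable (G : Type*) [InverseSemigroup G] [GAlgebra G A] [GHilbertModule G A E]

/-- The diagonal action `(g x) i = g (x i)`. -/
def sumAction : (sumPre A E).Action G where
  T g := Finsupp.mapRange.linearMap (GHilbertModule.U (A := A) g)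
  T_mul g h x := by ext i; simp [GHilbertModule.U_mul]
  form_T g x y := by
    change ((x.mapRange (GHilbertModule.U (A := A) g) (map_zero _)).sum fun i v =>
      inner v (GHilbertModule.U (A := A) g (y i)))
        = GAlgebra.act g (x.sum fun i v => inner v (y i))
    rw [Finsupp.sum_mapRange_index
        (h := fun i v => HilbertModule.inner (A := A) v (GHilbertModule.U (A := A) g (y i)))
        (fun i => inner_zero_left A _), Finsupp.sum, Finsupp.sum,
      map_sum]
    simp only [GHilbertModule.inner_U]
  form_T_idem g x y := by
    change (x.sum fun i v => inner v (GHilbertModule.U (A := A) (g * g⁻¹) (y i)))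
        = GAlgebra.act (g * g⁻¹) (x.sum fun i v => inner v (y i))
    rw [Finsupp.sum, Finsupp.sum, map_sum]
    simp only [GHilbertModule.inner_U_mul_inv]

instance : GHilbertModule G A (HilbertSum A E) := (sumAction A E G).gHilbertModule

end HilbertSum

/-! ### The spectrum of the idempotents -/

section Spectrum

open InverseSemigroup
open scoped ZeroAtInfty

variable (G : Type*) [InverseSemigroup G]

/-- The semilattice `E` of idempotents of `G`. -/
@[ext]
structure Idem where
  val : G
  idem : val * val = val

instance : CommSemigroup (Idem G) where
  mul e f := ⟨e.1 * f.1, idem_mul_idem e.2 f.2⟩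
  mul_assoc e f k := Idem.ext (mul_assoc e.1 f.1 k.1)
  mul_comm e f := Idem.ext (idem_comm e.2 f.2)

/-- The Gelfand spectrum `X` of the universal C⋆-algebra generated by commuting projections
`1_e`, `e ∈ E`, with `1_e 1_f = 1_{ef}`: the nonzero multiplicative maps `E → {0, 1}` with the
topology of pointwise convergence. -/
@[ext]
structure SpecE where
  toFun : Idem G → Bool
  map_mul : ∀ e f, toFun (e * f) = (toFun e && toFun f)
  nonzero : ∃ e, toFun e = true

instance : TopologicalSpace (SpecE G) := TopologicalSpace.induced SpecE.toFun inferInstance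

variable {G}

/-- `g e g⁻¹` -/
def Idem.conj (g : G) (e : Idem G) : Idem G := ⟨g * e.1 * g⁻¹, conj_idem g e.2⟩

/-- `g g⁻¹` -/
def Idem.ran (g : G) : Idem G := ⟨g * g⁻¹, mul_inv_idem g⟩

theorem Idem.val_mul (e f : Idem G) : (e * f).1 = e.1 * f.1 := rfl

theorem Idem.mul_self (e : Idem G) : e * e = e := Idem.ext e.2

theorem Idem.conj_mul (g : G) (e f : Idem G) : conj g (e * f) = conj g e * conj g f := by
  apply Idem.ext
  change g * (e.1 * f.1) * g⁻¹ = (g * e.1 * g⁻¹) * (g * f.1 * g⁻¹)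
  have h := mul_idem_eq g e.2
  calc g * (e.1 * f.1) * g⁻¹ = (g * e.1) * f.1 * g⁻¹ := by simp only [mul_assoc]
    _ = (g * e.1 * g⁻¹ * g) * f.1 * g⁻¹ := by rw [← h]
    _ = (g * e.1 * g⁻¹) * (g * f.1 * g⁻¹) := by simp only [mul_assoc]

theorem Idem.conj_conj (g h : G) (e : Idem G) : conj (g * h) e = conj g (conj h e) :=
  Idem.ext (by simp only [conj, mul_inv_rev', mul_assoc])

theorem Idem.conj_le (g : G) (e : Idem G) : conj g e = ran g * conj g e := by
  apply Idem.ext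
  change g * e.1 * g⁻¹ = (g * g⁻¹) * (g * e.1 * g⁻¹)
  calc g * e.1 * g⁻¹ = (g * g⁻¹ * g) * e.1 * g⁻¹ := by rw [mul_inv_mul]
    _ = _ := by simp only [mul_assoc]

theorem Idem.conj_ran (g h : G) : conj g (ran h) = ran (g * h) :=
  Idem.ext (by simp only [conj, ran, mul_inv_rev', mul_assoc])

theorem Idem.conj_idem (e f : Idem G) : conj e.1 f = e * f := by
  apply Idem.ext
  change e.1 * f.1 * e.1⁻¹ = e.1 * f.1
  rw [inv_of_idem e.2, idem_comm e.2 f.2, mul_assoc, e.2]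

theorem Idem.ran_idem (e : Idem G) : ran e.1 = e := by
  apply Idem.ext
  change e.1 * e.1⁻¹ = e.1
  rw [inv_of_idem e.2, e.2]

theorem Idem.ran_mul_self (g : G) : (ran g).1 * g = g := mul_inv_mul g

namespace SpecE

theorem isInducing : Topology.IsInducing (SpecE.toFun : SpecE G → Idem G → Bool) := ⟨rfl⟩

theorem continuous_toFun : Continuous (SpecE.toFun : SpecE G → Idem G → Bool) :=
  isInducing.continuous

theorem continuous_eval (e : Idem G) : Continuous fun χ : SpecE G => χ.toFun e :=
  (continuous_apply e).comp continuous_toFun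

theorem isClopen_carrier (e : Idem G) : IsClopen {χ : SpecE G | χ.toFun e = true} :=
  (isClopen_discrete {true}).preimage (continuous_eval e)

theorem isCompact_carrier (e : Idem G) : IsCompact {χ : SpecE G | χ.toFun e = true} := by
  rw [isInducing.isCompact_iff]
  apply IsClosed.isCompact
  have : (SpecE.toFun '' {χ : SpecE G | χ.toFun e = true} : Set (Idem G → Bool)) =
      (⋂ e, ⋂ f, {χ | χ (e * f) = (χ e && χ f)}) ∩ {χ | χ e = true} := by
    ext χ
    simp only [Set.mem_image, Set.mem_ofPred_eq, Set.mem_inter_iff, Set.mem_iInter]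
    constructor
    · rintro ⟨χ, h, rfl⟩
      exact ⟨fun e f => χ.map_mul e f, h⟩
    · rintro ⟨h1, h2⟩
      exact ⟨⟨χ, h1, e, h2⟩, h2, rfl⟩
  rw [this]
  refine IsClosed.inter (isClosed_iInter fun e => isClosed_iInter fun f => ?_) ?_
  · refine isClosed_eq (continuous_apply _) ?_
    have h : Continuous fun χ : Idem G → Bool => (χ e, χ f) :=
      (continuous_apply e).prodMk (continuous_apply f)
    exact (continuous_of_discreteTopology (f := fun p : Bool × Bool => p.1 && p.2)).comp h
  · exact isClosed_eq (continuous_apply _) continuous_const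

/-- A continuous function that vanishes off the carrier of some `e` is in `C₀(X)`. -/
theorem tendsto_cocompact {f : SpecE G → ℂ} (e : Idem G)
    (h : ∀ χ : SpecE G, χ.toFun e = false → f χ = 0) :
    Filter.Tendsto f (Filter.cocompact (SpecE G)) (nhds 0) := by
  refine tendsto_const_nhds.congr' ?_
  filter_upwards [(isCompact_carrier e).compl_mem_cocompact] with χ hχ
  exact (h χ (by simpa using hχ)).symm

/-- The characteristic function `1_e` of (the carrier of) `e`. -/
def ind (e : Idem G) : C₀(SpecE G, ℂ) where
  toFun χ := if χ.toFun e = true then 1 else 0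
  continuous_toFun :=
    (continuous_of_discreteTopology (f := fun b : Bool => if b = true then (1 : ℂ) else 0)).comp
      (continuous_eval e)
  zero_at_infty' := tendsto_cocompact e fun χ h => by simp [h]

theorem ind_apply (e : Idem G) (χ : SpecE G) : ind e χ = if χ.toFun e = true then 1 else 0 := rfl

theorem ind_mul (e f : Idem G) : ind (e * f) = ind e * ind f := by
  ext χ
  simp only [ZeroAtInftyContinuousMap.mul_apply, ind_apply, map_mul]
  cases χ.toFun e <;> cases χ.toFun f <;> simp

/-- For `χ(gg⁻¹) = 1`, the character `e ↦ χ(g e g⁻¹)`. -/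
def pull (g : G) (χ : SpecE G) (h : χ.toFun (Idem.ran g) = true) : SpecE G :=
  ⟨fun e => χ.toFun (Idem.conj g e), fun e f => by rw [Idem.conj_mul, χ.map_mul],
    Idem.ran g⁻¹, by
      have : Idem.ran (g * g⁻¹) = Idem.ran g := Idem.ran_idem (Idem.ran g)
      rw [Idem.conj_ran, this, h]⟩

/-- The action of `g` on functions: `(g f)(χ) = f(χ(g · g⁻¹))` if `χ(gg⁻¹) = 1`, and `0` else. -/
def actFun (g : G) (f : C₀(SpecE G, ℂ)) (χ : SpecE G) : ℂ :=
  if h : χ.toFun (Idem.ran g) = true then f (pull g χ h) else 0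

theorem continuous_actFun (g : G) (f : C₀(SpecE G, ℂ)) : Continuous (actFun g f) := by
  have hcl := isClopen_carrier (Idem.ran g)
  rw [← continuousOn_univ, ← Set.union_compl_self {χ : SpecE G | χ.toFun (Idem.ran g) = true}]
  refine ContinuousOn.union_of_isOpen ?_ ?_ hcl.isOpen hcl.compl.isOpen
  · rw [continuousOn_iff_continuous_domRestrict]
    have : Set.domRestrict {χ : SpecE G | χ.toFun (Idem.ran g) = true} (actFun g f)
        = fun χ => f (pull g χ.1 χ.2) := by
      funext χ
      exact dif_pos χ.2
    rw [this]
    refine f.continuous.comp ?_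
    refine isInducing.continuous_iff.2 ?_
    exact continuous_pi fun e => (continuous_eval (Idem.conj g e)).comp continuous_subtype_val
  · refine (continuousOn_const (c := (0 : ℂ))).congr fun χ hχ => ?_
    exact dif_neg hχ

/-- `actFun` as a map of `C₀(X)`. -/
def actC0 (g : G) (f : C₀(SpecE G, ℂ)) : C₀(SpecE G, ℂ) where
  toFun := actFun g f
  continuous_toFun := continuous_actFun g f
  zero_at_infty' := tendsto_cocompact (Idem.ran g) fun χ h => dif_neg (by simp [h])

theorem actC0_pos (g : G) (f : C₀(SpecE G, ℂ)) (χ : SpecE G) (h : χ.toFun (Idem.ran g) = true) :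
    actC0 g f χ = f (pull g χ h) := dif_pos h

theorem actC0_neg (g : G) (f : C₀(SpecE G, ℂ)) (χ : SpecE G) (h : ¬ χ.toFun (Idem.ran g) = true) :
    actC0 g f χ = 0 := dif_neg h

theorem actC0_ran (g : G) (f : C₀(SpecE G, ℂ)) : actC0 (g * g⁻¹) f = ind (Idem.ran g) * f := by
  ext χ
  have hr : Idem.ran (g * g⁻¹) = Idem.ran g := Idem.ran_idem (Idem.ran g)
  rw [ZeroAtInftyContinuousMap.mul_apply, ind_apply]
  by_cases h : χ.toFun (Idem.ran g) = true
  · rw [actC0_pos _ _ _ (by rw [hr, h]), if_pos h, one_mul]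
    congr 1
    apply SpecE.ext
    funext e
    change χ.toFun (Idem.conj (g * g⁻¹) e) = χ.toFun e
    have := Idem.conj_idem (Idem.ran g) e
    rw [show Idem.conj (g * g⁻¹) e = Idem.ran g * e from this, map_mul, h, Bool.true_and]
  · rw [actC0_neg _ _ _ (by rw [hr]; exact h), if_neg h, zero_mul]

/-- `C₀(X)` as a `G`-algebra. -/
instance : GAlgebra G C₀(SpecE G, ℂ) where
  act g :=
    { toFun := actC0 g
      map_smul' := fun c f => by
        ext χ
        by_cases h : χ.toFun (Idem.ran g) = true
        · simp [actC0_pos _ _ _ h]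
        · simp [actC0_neg _ _ _ h]
      map_zero' := by
        ext χ
        by_cases h : χ.toFun (Idem.ran g) = true
        · simp [actC0_pos _ _ _ h]
        · simp [actC0_neg _ _ _ h]
      map_add' := fun f f' => by
        ext χ
        by_cases h : χ.toFun (Idem.ran g) = true
        · simp [actC0_pos _ _ _ h]
        · simp [actC0_neg _ _ _ h]
      map_mul' := fun f f' => by
        ext χ
        by_cases h : χ.toFun (Idem.ran g) = true
        · simp [actC0_pos _ _ _ h]
        · simp [actC0_neg _ _ _ h]
      map_star' := fun f => by
        ext χ
        by_cases h : χ.toFun (Idem.ran g) = true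
        · simp [actC0_pos _ _ _ h]
        · simp [actC0_neg _ _ _ h] }
  act_mul g h f := by
    change actC0 (g * h) f = actC0 g (actC0 h f)
    ext χ
    by_cases h1 : χ.toFun (Idem.ran g) = true
    · rw [actC0_pos _ _ _ h1]
      have h3 : (pull g χ h1).toFun (Idem.ran h) = χ.toFun (Idem.ran (g * h)) := by
        rw [← Idem.conj_ran]; rfl
      by_cases h2 : χ.toFun (Idem.ran (g * h)) = true
      · rw [actC0_pos _ _ _ h2, actC0_pos _ _ _ (h3.trans h2)]
        congr 1
        apply SpecE.ext
        funext e
        change χ.toFun _ = χ.toFun _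
        rw [Idem.conj_conj]
      · rw [actC0_neg _ _ _ h2, actC0_neg _ _ _ (by rwa [h3])]
    · rw [actC0_neg _ _ _ h1, actC0_neg]
      rw [← Idem.conj_ran, Idem.conj_le, map_mul]
      simp [h1]
  act_central g f f' := by
    change actC0 (g * g⁻¹) f * f' = f * actC0 (g * g⁻¹) f'
    rw [actC0_ran, actC0_ran, mul_assoc, mul_left_comm]

theorem act_def (g : G) (f : C₀(SpecE G, ℂ)) : GAlgebra.act g f = actC0 g f := rfl

/-- `g(1_e) = 1_{g e g⁻¹}`. -/
theorem act_ind (g : G) (e : Idem G) :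
    GAlgebra.act g (ind e) = ind (Idem.conj g e) := by
  rw [act_def]
  ext χ
  rw [ind_apply]
  by_cases h : χ.toFun (Idem.ran g) = true
  · rw [actC0_pos _ _ _ h]; rfl
  · rw [actC0_neg _ _ _ h, Idem.conj_le, map_mul]
    simp [h]

instance : PartialOrder C₀(SpecE G, ℂ) := CStarAlgebra.spectralOrder _
instance : StarOrderedRing C₀(SpecE G, ℂ) := CStarAlgebra.spectralOrderedRing _

theorem nonneg_of_forall {f : C₀(SpecE G, ℂ)} (h : ∀ χ, ∃ r : ℝ, 0 ≤ r ∧ f χ = r) : 0 ≤ f := by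
  let k : C₀(SpecE G, ℂ) :=
    { toFun := fun χ => ((Real.sqrt (f χ).re : ℝ) : ℂ)
      continuous_toFun := by fun_prop
      zero_at_infty' := by
        have h1 : Continuous fun z : ℂ => ((Real.sqrt z.re : ℝ) : ℂ) := by fun_prop
        have h2 := h1.tendsto 0
        simp only [Complex.zero_re, Real.sqrt_zero, Complex.ofReal_zero] at h2
        exact h2.comp f.zero_at_infty' }
  have : f = star k * k := by
    ext χ
    obtain ⟨r, hr, hf⟩ := h χ
    have : k χ = ((Real.sqrt r : ℝ) : ℂ) := by
      change ((Real.sqrt (f χ).re : ℝ) : ℂ) = _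
      rw [hf, Complex.ofReal_re]
    rw [ZeroAtInftyContinuousMap.mul_apply, ZeroAtInftyContinuousMap.star_apply, this, hf]
    rw [RCLike.star_def, Complex.conj_ofReal, ← Complex.ofReal_mul, Real.mul_self_sqrt hr]
  rw [this]
  exact star_mul_self_nonneg k

end SpecE

end Spectrum

/-! ### The representation of `C₀(X)` on a `G`-Hilbert module -/

section Density

open InverseSemigroup
open scoped ZeroAtInfty

variable {G : Type*} [InverseSemigroup G]

namespace SpecE

variable (G) in
/-- The linear map `∑ λ_e e ↦ ∑ λ_e 1_e`. -/
def indLin : (Idem G →₀ ℂ) →ₗ[ℂ] C₀(SpecE G, ℂ) := Finsupp.linearCombination ℂ ind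

theorem indLin_single (e : Idem G) : indLin G (Finsupp.single e 1) = ind e := by
  simp [indLin]

theorem mem_range_indLin_ind (e : Idem G) : ind e ∈ LinearMap.range (indLin G) :=
  ⟨_, indLin_single e⟩

theorem ind_mul_mem {a : C₀(SpecE G, ℂ)} (ha : a ∈ LinearMap.range (indLin G)) (e : Idem G) :
    ind e * a ∈ LinearMap.range (indLin G) := by
  rw [indLin, Finsupp.range_linearCombination] at *
  induction ha using Submodule.span_induction with
  | mem x hx =>
    obtain ⟨f, rfl⟩ := hx
    rw [← ind_mul]
    exact Submodule.subset_span ⟨_, rfl⟩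
  | zero => rw [mul_zero]; exact Submodule.zero_mem _
  | add x y _ _ hx hy => rw [mul_add]; exact Submodule.add_mem _ hx hy
  | smul c x _ hx => rw [mul_smul_comm]; exact Submodule.smul_mem _ c hx

/-- The real valued function `1_e`. -/
def indReal (e : Idem G) : C(SpecE G, ℝ) where
  toFun χ := if χ.toFun e = true then 1 else 0
  continuous_toFun :=
    (continuous_of_discreteTopology (f := fun b : Bool => if b = true then (1 : ℝ) else 0)).comp
      (continuous_eval e)

theorem adjoin_mul {g : C(SpecE G, ℝ)} (hg : g ∈ Algebra.adjoin ℝ (Set.range (indReal (G := G)))) :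
    ∀ a ∈ LinearMap.range (indLin G), ∃ b ∈ LinearMap.range (indLin G),
      ∀ χ, b χ = (g χ : ℂ) * a χ := by
  induction hg using Algebra.adjoin_induction with
  | mem x hx =>
    obtain ⟨e, rfl⟩ := hx
    intro a ha
    refine ⟨_, ind_mul_mem ha e, fun χ => ?_⟩
    rw [ZeroAtInftyContinuousMap.mul_apply, ind_apply]
    change _ = ((if χ.toFun e = true then (1 : ℝ) else 0 : ℝ) : ℂ) * _
    split_ifs <;> simp
  | algebraMap r =>
    intro a ha
    refine ⟨_, Submodule.smul_mem _ (r : ℂ) ha, fun χ => ?_⟩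
    simp
  | add x y _ _ hx hy =>
    intro a ha
    obtain ⟨b, hb, h⟩ := hx a ha
    obtain ⟨b', hb', h'⟩ := hy a ha
    refine ⟨_, Submodule.add_mem _ hb hb', fun χ => ?_⟩
    simp [h, h', add_mul]
  | mul x y _ _ hx hy =>
    intro a ha
    obtain ⟨b, hb, h⟩ := hy a ha
    obtain ⟨b', hb', h'⟩ := hx b hb
    refine ⟨b', hb', fun χ => ?_⟩
    simp [h, h', mul_assoc]

theorem separates : (Algebra.adjoin ℝ (Set.range (indReal (G := G)))).SeparatesPoints := by
  intro χ ψ h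
  obtain ⟨e, he⟩ : ∃ e, χ.toFun e ≠ ψ.toFun e := by
    by_contra! hc
    exact h (SpecE.ext (funext hc))
  refine ⟨_, ⟨indReal e, Algebra.subset_adjoin ⟨e, rfl⟩, rfl⟩, ?_⟩
  change (if χ.toFun e = true then (1 : ℝ) else 0) ≠ (if ψ.toFun e = true then (1 : ℝ) else 0)
  revert he
  cases χ.toFun e <;> cases ψ.toFun e <;> simp

theorem exists_join (F : Finset (Idem G)) : ∃ j ∈ LinearMap.range (indLin G),
    ∀ χ : SpecE G, ((∃ e ∈ F, χ.toFun e = true) → j χ = 1) ∧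
      ((¬ ∃ e ∈ F, χ.toFun e = true) → j χ = 0) := by
  classical
  induction F using Finset.induction_on with
  | empty => exact ⟨0, Submodule.zero_mem _, fun χ => by simp⟩
  | insert e F _ ih =>
    obtain ⟨j, hj, h⟩ := ih
    refine ⟨j + (ind e - ind e * j), Submodule.add_mem _ hj (Submodule.sub_mem _
      (mem_range_indLin_ind e) (ind_mul_mem hj e)), fun χ => ?_⟩
    obtain ⟨h1, h2⟩ := h χ
    have hval : (j + (ind e - ind e * j)) χ
        = j χ + ((if χ.toFun e = true then 1 else 0)
          - (if χ.toFun e = true then 1 else 0) * j χ) := rfl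
    rw [hval]
    by_cases he : χ.toFun e = true
    · constructor
      · intro _; simp [he]
      · intro hn; exact absurd ⟨e, Finset.mem_insert_self _ _, he⟩ hn
    · by_cases hF : ∃ f ∈ F, χ.toFun f = true
      · constructor
        · intro _; rw [h1 hF]; simp [he]
        · rintro hn
          obtain ⟨f, hf, hf'⟩ := hF
          exact absurd ⟨f, Finset.mem_insert_of_mem hf, hf'⟩ hn
      · constructor
        · rintro ⟨f, hf, hf'⟩
          rcases Finset.mem_insert.1 hf with rfl | hf
          · exact absurd hf' he
          · exact absurd ⟨f, hf, hf'⟩ hF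
        · intro _; rw [h2 hF]; simp [he]

/-- The functions `1_e` span a dense subspace of `C₀(X)`. -/
theorem denseRange_indLin : DenseRange (indLin G) := by
  intro f
  rw [Metric.mem_closure_iff]
  intro ε hε
  obtain ⟨K, hK, hfK⟩ : ∃ K : Set (SpecE G), IsCompact K ∧ ∀ χ, χ ∉ K → ‖f χ‖ < ε / 2 := by
    have h := f.zero_at_infty'.eventually (Metric.ball_mem_nhds 0 (half_pos hε))
    obtain ⟨K, hK, hs⟩ := Filter.mem_cocompact.1 h
    exact ⟨K, hK, fun χ hχ => by simpa using hs hχ⟩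
  obtain ⟨F, hF⟩ : ∃ F : Finset (Idem G), K ⊆ ⋃ e ∈ F, {χ : SpecE G | χ.toFun e = true} := by
    refine hK.elim_finite_subcover _ (fun e => (isClopen_carrier e).isOpen) fun χ _ => ?_
    obtain ⟨e, he⟩ := χ.nonzero
    exact Set.mem_iUnion.2 ⟨e, he⟩
  obtain ⟨j, hj, hjv⟩ := exists_join F
  have hY : IsCompact (⋃ e ∈ F, {χ : SpecE G | χ.toFun e = true}) :=
    F.isCompact_biUnion fun e _ => isCompact_carrier e
  obtain ⟨g₁, hg₁, h₁⟩ :=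
    ContinuousMap.exists_mem_subalgebra_near_continuous_of_isCompact_of_separatesPoints
      (separates (G := G)) ⟨fun χ => (f χ).re, by fun_prop⟩ hY (ε := ε / 4) (by positivity)
  obtain ⟨g₂, hg₂, h₂⟩ :=
    ContinuousMap.exists_mem_subalgebra_near_continuous_of_isCompact_of_separatesPoints
      (separates (G := G)) ⟨fun χ => (f χ).im, by fun_prop⟩ hY (ε := ε / 4) (by positivity)
  obtain ⟨b₁, hb₁, hv₁⟩ := adjoin_mul hg₁ j hj
  obtain ⟨b₂, hb₂, hv₂⟩ := adjoin_mul hg₂ j hj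
  refine ⟨b₁ + Complex.I • b₂, Submodule.add_mem _ hb₁ (Submodule.smul_mem _ _ hb₂), ?_⟩
  refine lt_of_le_of_lt (b := ε / 2) ?_ (half_lt_self hε)
  rw [dist_comm, dist_eq_norm, ← ZeroAtInftyContinuousMap.norm_toBCF_eq_norm]
  refine (BoundedContinuousFunction.norm_le (by positivity)).2 fun χ => ?_
  change ‖b₁ χ + Complex.I • b₂ χ - f χ‖ ≤ ε / 2
  rw [hv₁, hv₂]
  by_cases hχ : ∃ e ∈ F, χ.toFun e = true
  · have hmem : χ ∈ ⋃ e ∈ F, {χ : SpecE G | χ.toFun e = true} := by simpa using hχ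
    rw [(hjv χ).1 hχ, mul_one, mul_one]
    have e1 : (g₁ χ : ℂ) + Complex.I • (g₂ χ : ℂ) - f χ
        = ((g₁ χ - (f χ).re : ℝ) : ℂ) + Complex.I * ((g₂ χ - (f χ).im : ℝ) : ℂ) := by
      conv_lhs => rw [← Complex.re_add_im (f χ)]
      push_cast
      rw [smul_eq_mul]
      ring
    rw [e1]
    refine (norm_add_le _ _).trans ?_
    rw [norm_mul, Complex.norm_I, one_mul, Complex.norm_real, Complex.norm_real]
    have := (h₁ χ hmem).le
    have := (h₂ χ hmem).le
    simp only [ContinuousMap.coe_mk] at *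
    linarith
  · rw [(hjv χ).2 hχ, mul_zero, mul_zero, smul_zero, zero_add, zero_sub, norm_neg]
    refine (hfK χ fun hK' => hχ ?_).le
    simpa using hF hK'

theorem norm_indLin_ge (l : Idem G →₀ ℂ) (χ : SpecE G) :
    ‖l.sum fun e c => c * (if χ.toFun e = true then 1 else 0)‖ ≤ ‖indLin G l‖ := by
  have h : indLin G l χ = l.sum fun e c => c * (if χ.toFun e = true then 1 else 0) := by
    rw [indLin, Finsupp.linearCombination_apply]
    have : ∀ (s : Finset (Idem G)) (F : Idem G → C₀(SpecE G, ℂ)),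
        (∑ e ∈ s, F e) χ = ∑ e ∈ s, F e χ := fun s F =>
      map_sum (⟨⟨fun f => f χ, rfl⟩, fun _ _ => rfl⟩ : C₀(SpecE G, ℂ) →+ ℂ) F s
    rw [Finsupp.sum, this]
    rfl
  rw [← h, ← ZeroAtInftyContinuousMap.norm_toBCF_eq_norm]
  exact (indLin G l).toBCF.norm_coe_le_norm χ

end SpecE

namespace GHilbertModule

open HilbertModule SpecE

variable (A E : Type*) [NonUnitalCStarAlgebra A] [PartialOrder A]
  [StarOrderedRing A] [GAlgebra G A] [NormedAddCommGroup E] [NormedSpace ℂ E] [CompleteSpace E]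
  [HilbertModule A E] [GHilbertModule G A E]

variable (G) in
/-- The linear map `∑ λ_e e ↦ ∑ λ_e U_e`. -/
def opLin : (Idem G →₀ ℂ) →ₗ[ℂ] E →L[ℂ] E :=
  Finsupp.linearCombination ℂ fun e : Idem G => UL A E e.val

variable {E}

theorem opLin_apply (l : Idem G →₀ ℂ) (x : E) :
    opLin G A E l x = l.sum fun e c => c • U (A := A) e.val x := by
  rw [opLin, Finsupp.linearCombination_apply, Finsupp.sum, Finsupp.sum, sum_apply]
  rfl

theorem U_idem (e : Idem G) (x : E) : U (A := A) e.val (U (A := A) e.val x) = U (A := A) e.val x := by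
  rw [← U_mul, e.idem]

theorem U_comm (e f : Idem G) (x : E) :
    U (A := A) e.val (U (A := A) f.val x) = U (A := A) f.val (U (A := A) e.val x) := by
  rw [← U_mul, ← U_mul, idem_comm e.idem f.idem]

theorem opLin_U (l : Idem G →₀ ℂ) (f : Idem G) (x : E) :
    opLin G A E l (U (A := A) f.val x) = U (A := A) f.val (opLin G A E l x) := by
  rw [opLin_apply, opLin_apply, Finsupp.sum, Finsupp.sum, map_sum]
  refine Finset.sum_congr rfl fun e _ => ?_
  rw [U_comm, map_smul]

theorem inner_eq_zero_of_U (f : Idem G) (x y : E) :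
    inner (A := A) (U (A := A) f.val x) (y - U (A := A) f.val y) = 0 := by
  rw [HilbertModule.inner_sub_right, inner_U_idem_left f.idem, inner_U_idem_left f.idem, U_idem, sub_self]

/-- Spectral decomposition along finitely many idempotents. -/
theorem inner_opLin_le (l : Idem G →₀ ℂ) (s : Finset (Idem G)) :
    ∀ x : E, (∀ e ∈ l.support, e ∉ s → U (A := A) e.val x = x ∨ U (A := A) e.val x = 0) →
      inner (A := A) (opLin G A E l x) (opLin G A E l x) ≤ ‖indLin G l‖ ^ 2 • inner (A := A) x x := by
  classical
  induction s using Finset.induction_on with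
  | empty =>
    intro x hx
    obtain ⟨c, hc, h⟩ : ∃ c : ℂ, ‖c‖ ≤ ‖indLin G l‖ ∧ opLin G A E l x = c • x := by
      by_cases hx0 : x = 0
      · exact ⟨0, by simp, by simp [hx0]⟩
      by_cases hne : ∃ e : Idem G, U (A := A) e.val x = x
      · obtain ⟨e₀, he₀⟩ := hne
        let χ : SpecE G :=
          { toFun := fun e => decide (U (A := A) e.val x = x)
            map_mul := fun e f => by
              rw [← Bool.decide_and, decide_eq_decide]
              change U (A := A) (e.val * f.val) x = x ↔ _
              rw [U_mul]
              constructor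
              · intro h
                have h1 : U (A := A) e.val x = x := by
                  conv_lhs => rw [← h]
                  rw [U_idem, h]
                refine ⟨h1, ?_⟩
                rw [U_comm, h1] at h
                exact h
              · rintro ⟨h1, h2⟩
                rw [h2, h1]
            nonzero := ⟨e₀, by simpa using he₀⟩ }
        refine ⟨_, norm_indLin_ge l χ, ?_⟩
        rw [opLin_apply, Finsupp.sum, Finsupp.sum, Finset.sum_smul]
        refine Finset.sum_congr rfl fun e he => ?_
        change _ = (l e * (if decide (U (A := A) e.val x = x) = true then 1 else 0)) • x
        rcases hx e he (Finset.notMem_empty _) with h | h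
        · simp [h]
        · have : U (A := A) e.val x ≠ x := by rw [h]; exact Ne.symm hx0
          simp [h, Ne.symm hx0]
      · refine ⟨0, by simp, ?_⟩
        rw [opLin_apply, zero_smul]
        refine Finset.sum_eq_zero fun e he => ?_
        rcases hx e he (Finset.notMem_empty _) with h | h
        · exact absurd ⟨e, h⟩ hne
        · simp [h]
    rw [h, HilbertModule.inner_smul_left, HilbertModule.inner_smul_right, smul_smul,
      RCLike.star_def, Complex.conj_mul', ← Complex.ofReal_pow, Complex.coe_smul]
    exact smul_le_smul_of_nonneg_right (by gcongr) (inner_self_nonneg x)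
  | insert f s _ ih =>
    intro x hx
    have key : ∀ e : Idem G, U (A := A) e.val x = x ∨ U (A := A) e.val x = 0 →
        (U (A := A) e.val (U (A := A) f.val x) = U (A := A) f.val x ∨
          U (A := A) e.val (U (A := A) f.val x) = 0) ∧
        (U (A := A) e.val (x - U (A := A) f.val x) = x - U (A := A) f.val x ∨
          U (A := A) e.val (x - U (A := A) f.val x) = 0) := by
      rintro e (h | h)
      · exact ⟨Or.inl (by rw [U_comm, h]), Or.inl (by rw [map_sub, U_comm, h])⟩
      · exact ⟨Or.inr (by rw [U_comm, h, map_zero]),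
          Or.inr (by rw [map_sub, U_comm, h, map_zero, sub_zero])⟩
    have h1 := ih (U (A := A) f.val x) fun e he hes => by
      by_cases hef : e = f
      · subst hef; exact Or.inl (U_idem A e x)
      · exact (key e (hx e he (by simp [hef, hes]))).1
    have h2 := ih (x - U (A := A) f.val x) fun e he hes => by
      by_cases hef : e = f
      · subst hef; exact Or.inr (by rw [map_sub, U_idem, sub_self])
      · exact (key e (hx e he (by simp [hef, hes]))).2
    have hsplit : ∀ y : E, inner (A := A) y y
        = inner (A := A) (U (A := A) f.val y) (U (A := A) f.val y)
          + inner (A := A) (y - U (A := A) f.val y) (y - U (A := A) f.val y) := by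
      intro y
      have h3 := inner_eq_zero_of_U A f y y
      have h4 : inner (A := A) (y - U (A := A) f.val y) (U (A := A) f.val y) = 0 := by
        rw [← star_inner, h3, star_zero]
      conv_lhs => rw [← add_sub_cancel (U (A := A) f.val y) y]
      rw [HilbertModule.inner_add_left, HilbertModule.inner_add_right,
        HilbertModule.inner_add_right, h3, h4]
      abel
    rw [hsplit x, hsplit (opLin G A E l x), smul_add, ← opLin_U, ← map_sub]
    exact add_le_add h1 h2

theorem norm_opLin_le (l : Idem G →₀ ℂ) : ‖opLin G A E l‖ ≤ 1 * ‖indLin G l‖ := by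
  rw [one_mul]
  refine ContinuousLinearMap.opNorm_le_bound _ (norm_nonneg _) fun x => ?_
  refine (sq_le_sq₀ (norm_nonneg _) (by positivity)).1 ?_
  have h := inner_opLin_le A l l.support x fun e he hn => absurd he hn
  have h2 := CStarAlgebra.norm_le_norm_of_nonneg_of_le (inner_self_nonneg _) h
  rw [norm_smul, ← norm_sq_eq, ← norm_sq_eq] at h2
  rwa [mul_pow, ← Real.norm_of_nonneg (sq_nonneg ‖indLin G l‖)]

variable (E)

variable (G) in
/-- The canonical representation `π` of `C₀(X) ≅ C⋆(E)` on a `G`-Hilbert module: the continuous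
linear map determined by `π(1_e) = U_e`. -/
def specRep : C₀(SpecE G, ℂ) →L[ℂ] E →L[ℂ] E := (opLin G A E).extendOfNorm (indLin G)

variable {E}

theorem specRep_indLin (l : Idem G →₀ ℂ) : specRep G A E (indLin G l) = opLin G A E l :=
  LinearMap.extendOfNorm_eq denseRange_indLin ⟨1, norm_opLin_le A⟩ l

theorem specRep_ind (e : Idem G) (x : E) : specRep G A E (ind e) x = U (A := A) e.val x := by
  rw [← indLin_single, specRep_indLin, opLin_apply]
  simp

theorem specRep_induction {p : C₀(SpecE G, ℂ) → Prop} (f : C₀(SpecE G, ℂ))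
    (hp : IsClosed {f | p f}) (h0 : p 0) (hadd : ∀ f g, p f → p g → p (f + g))
    (hsmul : ∀ (c : ℂ) f, p f → p (c • f)) (hind : ∀ e, p (ind e)) : p f := by
  refine denseRange_indLin.induction_on f hp fun l => ?_
  induction l using Finsupp.induction_linear with
  | zero => rw [map_zero]; exact h0
  | add l l' h h' => rw [map_add]; exact hadd _ _ h h'
  | single e c =>
    have : indLin G (Finsupp.single e c) = c • ind e := by simp [indLin]
    rw [this]; exact hsmul _ _ (hind e)

end GHilbertModule

end Density

/-! ### Interior tensor products -/

section Interior

open HilbertModule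
open scoped TensorProduct CStarAlgebra

/-- A `*`-representation of `B` by adjointable operators on the Hilbert `A`-module `E`. -/
structure HilbertRep (B A E : Type*) [NonUnitalCStarAlgebra B] [NonUnitalCStarAlgebra A]
    [PartialOrder A] [StarOrderedRing A] [NormedAddCommGroup E] [NormedSpace ℂ E]
    [CompleteSpace E] [HilbertModule A E] where
  op : B →ₗ[ℂ] E →L[ℂ] E
  op_mul : ∀ b c x, op (b * c) x = op b (op c x)
  op_star : ∀ b x y, HilbertModule.inner (A := A) (op (star b) x) y
    = HilbertModule.inner (A := A) x (op b y)

theorem CStarAlgebra.exists_neg_conj {C : Type*} [NonUnitalCStarAlgebra C] [PartialOrder C]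
    [StarOrderedRing C] {M : C} (hM : IsSelfAdjoint M) :
    ∃ N R : C, IsSelfAdjoint N ∧ N * M * N = -(star (R * N) * (R * N)) ∧
      (R * N = 0 → ∃ T, M = star T * T) := by
  obtain ⟨R, hR⟩ := CStarAlgebra.nonneg_iff_eq_star_mul_self.1 (CFC.negPart_nonneg M)
  have hN : IsSelfAdjoint M⁻ := (CFC.negPart_nonneg M).isSelfAdjoint
  have hcube : M⁻ * M⁻ * M⁻ = star (R * M⁻) * (R * M⁻) := by
    rw [star_mul, hN.star_eq]
    calc M⁻ * M⁻ * M⁻ = M⁻ * (star R * R) * M⁻ := by rw [← hR]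
      _ = _ := by simp only [mul_assoc]
  refine ⟨M⁻, R, hN, ?_, fun hzero => ?_⟩
  · rw [← hcube]
    calc M⁻ * M * M⁻ = M⁻ * (M⁺ - M⁻) * M⁻ := by rw [CFC.posPart_sub_negPart M hM]
      _ = -(M⁻ * M⁻ * M⁻) := by
        rw [mul_sub, CFC.negPart_mul_posPart, zero_sub, neg_mul]
  · have h1 : M⁻ * M⁻ * M⁻ = 0 := by rw [hcube, hzero, mul_zero]
    have h2 : M⁻ * M⁻ = 0 := by
      rw [← CStarRing.star_mul_self_eq_zero_iff, star_mul, hN.star_eq, ← mul_assoc, h1, zero_mul]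
    have hN0 : M⁻ = 0 := by
      rw [← CStarRing.star_mul_self_eq_zero_iff, hN.star_eq, h2]
    have := CFC.posPart_sub_negPart M hM
    rw [hN0, sub_zero] at this
    rw [← this]
    exact CStarAlgebra.nonneg_iff_eq_star_mul_self.1 (CFC.posPart_nonneg M)

theorem HilbertModule.inner_sum_sum {B F n : Type*} [NonUnitalCStarAlgebra B] [PartialOrder B]
    [StarOrderedRing B] [NormedAddCommGroup F] [NormedSpace ℂ F] [CompleteSpace F]
    [HilbertModule B F] [Fintype n] (x y : n → F) :
    HilbertModule.inner (A := B) (∑ i, x i) (∑ j, y j)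
      = ∑ i, ∑ j, HilbertModule.inner (x i) (y j) := by
  have h : ∀ v : F, HilbertModule.inner (A := B) v (∑ j, y j)
      = ∑ j, HilbertModule.inner v (y j) := fun v => map_sum (innerₛₗ B v) y _
  rw [h, Finset.sum_comm]
  refine Finset.sum_congr rfl fun j _ => ?_
  have h2 : HilbertModule.inner (A := B) (y j) (∑ i, x i)
      = ∑ i, HilbertModule.inner (y j) (x i) := map_sum (innerₛₗ B (y j)) x _
  rw [← star_inner, h2, star_sum]
  simp only [star_inner]

/-- The Gram matrix of finitely many vectors of a Hilbert module is positive. -/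
theorem HilbertModule.exists_gram {B F n : Type*} [NonUnitalCStarAlgebra B] [PartialOrder B]
    [StarOrderedRing B] [NormedAddCommGroup F] [NormedSpace ℂ F] [CompleteSpace F]
    [HilbertModule B F] [Fintype n] (x : n → F) :
    ∃ T : n → n → B, ∀ i j, HilbertModule.inner (A := B) (x i) (x j)
      = ∑ k, star (T k i) * T k j := by
  classical
  let M : CStarMatrix n n B := CStarMatrix.ofMatrix fun i j => HilbertModule.inner (x i) (x j)
  have hMe : ∀ i j, M i j = HilbertModule.inner (x i) (x j) := fun i j => rfl
  have hM : IsSelfAdjoint M := by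
    ext i j
    rw [CStarMatrix.star_apply, hMe, hMe, star_inner]
  obtain ⟨N, R, hN, hdec, hpos⟩ := CStarAlgebra.exists_neg_conj hM
  have hNe : ∀ i j, star (N j i) = N i j := fun i j => by
    rw [← CStarMatrix.star_apply, hN.star_eq]
  have hdiag : ∀ k, 0 ≤ (N * M * N) k k := by
    intro k
    have h : (N * M * N) k k = HilbertModule.inner (A := B) (∑ i, rsmul (x i) (N i k))
        (∑ i, rsmul (x i) (N i k)) := by
      rw [inner_sum_sum, CStarMatrix.mul_apply]
      simp only [inner_rsmul_right, inner_rsmul_left, hNe, ← hMe,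
        CStarMatrix.mul_apply, Finset.sum_mul]
      exact Finset.sum_comm
    rw [h]
    exact inner_self_nonneg _
  have hzero : R * N = 0 := by
    ext j k
    have h1 : (star (R * N) * (R * N)) k k = ∑ i, star ((R * N) i k) * (R * N) i k := by
      rw [CStarMatrix.mul_apply]
      simp only [CStarMatrix.star_apply]
    have h2 := hdiag k
    rw [hdec, CStarMatrix.neg_apply, h1] at h2
    have h3 : ∑ i, star ((R * N) i k) * (R * N) i k = 0 :=
      le_antisymm (by simpa using h2) (Finset.sum_nonneg fun i _ => star_mul_self_nonneg _)
    have h4 := (Finset.sum_eq_zero_iff_of_nonneg fun i _ => star_mul_self_nonneg _).1 h3 j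
      (Finset.mem_univ _)
    exact (CStarRing.star_mul_self_eq_zero_iff _).1 h4
  obtain ⟨T, hT⟩ := hpos hzero
  refine ⟨fun k i => T k i, fun i j => ?_⟩
  rw [← hMe, hT, CStarMatrix.mul_apply]
  simp only [CStarMatrix.star_apply]

variable {B A : Type*} (F : Type*) {E : Type*} [NonUnitalCStarAlgebra B] [PartialOrder B]
  [StarOrderedRing B] [NormedAddCommGroup F] [NormedSpace ℂ F] [CompleteSpace F]
  [HilbertModule B F]
  [NonUnitalCStarAlgebra A] [PartialOrder A]
  [StarOrderedRing A] [NormedAddCommGroup E] [NormedSpace ℂ E] [CompleteSpace E]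
  [HilbertModule A E]

/-- Right multiplication by `a` as a linear map. -/
def HilbertModule.rsmulₗ (a : A) : E →ₗ[ℂ] E where
  toFun v := rsmul v a
  map_add' v w := add_rsmul v w a
  map_smul' c v := smul_rsmul c v a

/-- The form `⟨x ⊗ ξ, y ⊗ η⟩ = ⟨ξ, π(⟨x, y⟩) η⟩` on the algebraic tensor product. -/
def interiorForm (π : HilbertRep B A E) : F ⊗[ℂ] E →ₗ⋆[ℂ] F ⊗[ℂ] E →ₗ[ℂ] A :=
  TensorProduct.lift (LinearMap.mk₂'ₛₗ (starRingEnd ℂ) (starRingEnd ℂ)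
    (fun (x : F) (ξ : E) => TensorProduct.lift (LinearMap.mk₂ ℂ
      (fun (y : F) (η : E) => HilbertModule.inner (A := A) ξ
        (π.op (HilbertModule.inner (A := B) x y) η))
      (fun y y' η => by simp only [HilbertModule.inner_add_right, map_add, add_apply])
      (fun c y η => by simp only [HilbertModule.inner_smul_right, map_smul, smul_apply])
      (fun y η η' => by simp only [HilbertModule.inner_add_right, map_add])
      (fun c y η => by simp only [HilbertModule.inner_smul_right, map_smul])))
    (fun x x' ξ => TensorProduct.ext' fun y η => by
      simp [HilbertModule.inner_add_left, HilbertModule.inner_add_right])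
    (fun c x ξ => TensorProduct.ext' fun y η => by
      simp [HilbertModule.inner_smul_left, HilbertModule.inner_smul_right])
    (fun x ξ ξ' => TensorProduct.ext' fun y η => by
      simp [HilbertModule.inner_add_left])
    (fun c x ξ => TensorProduct.ext' fun y η => by
      simp [HilbertModule.inner_smul_left]))

theorem interiorForm_tmul (π : HilbertRep B A E) (x y : F) (ξ η : E) :
    interiorForm F π (x ⊗ₜ ξ) (y ⊗ₜ η) = HilbertModule.inner (A := A) ξ
      (π.op (HilbertModule.inner (A := B) x y) η) := rfl

/-- The algebraic tensor product `F ⊗ E` with the semi-inner product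
`⟨x ⊗ ξ, y ⊗ η⟩ = ⟨ξ, π(⟨x, y⟩) η⟩`.  Its Hausdorff completion is the interior tensor product
`F ⊗_π E`. -/
def interiorPre (π : HilbertRep B A E) : PreHilbert A (F ⊗[ℂ] E) where
  form := interiorForm F π
  act a := (rsmulₗ a).lTensor F
  star_form v w := by
    induction v with
    | zero => simp
    | add v v' hv hv' => simp only [map_add, LinearMap.add_apply, star_add, hv, hv']
    | tmul x ξ =>
      induction w with
      | zero => simp
      | add w w' hw hw' => simp only [map_add, LinearMap.add_apply, star_add, hw, hw']
      | tmul y η =>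
        rw [interiorForm_tmul, interiorForm_tmul, star_inner, ← star_inner y x, ← π.op_star]
  form_act v w a := by
    induction v with
    | zero => simp
    | add v v' hv hv' => simp only [map_add, LinearMap.add_apply, add_mul, hv, hv']
    | tmul x ξ =>
      induction w with
      | zero => simp
      | add w w' hw hw' => simp only [map_add, add_mul, hw, hw']
      | tmul y η =>
        rw [LinearMap.lTensor_tmul, interiorForm_tmul, interiorForm_tmul]
        change HilbertModule.inner ξ (π.op _ (rsmul η a)) = _
        rw [← π.op_star, inner_rsmul_right, π.op_star]
  form_nonneg v := by
    obtain ⟨S, rfl⟩ := TensorProduct.exists_finset v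
    rw [← Finset.sum_coe_sort]
    obtain ⟨T, hT⟩ := exists_gram (B := B) (fun i : S => i.1.1)
    have h : interiorForm F π (∑ i : S, i.1.1 ⊗ₜ i.1.2) (∑ i : S, i.1.1 ⊗ₜ i.1.2)
        = ∑ k : S, HilbertModule.inner (A := A) (∑ i : S, π.op (T k i) i.1.2)
            (∑ i : S, π.op (T k i) i.1.2) := by
      simp only [← innerₛₗ_apply, map_sum, LinearMap.sum_apply]
      simp only [innerₛₗ_apply, interiorForm_tmul, hT]
      simp only [← innerₛₗ_apply (A := A), map_sum, sum_apply, π.op_mul]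
      simp only [innerₛₗ_apply, ← π.op_star, star_star]
      rw [Finset.sum_comm]
      refine (Finset.sum_congr rfl fun i _ => Finset.sum_comm).trans ?_
      exact Finset.sum_comm.trans (Finset.sum_congr rfl fun k _ => Finset.sum_comm)
    rw [h]
    exact Finset.sum_nonneg fun k _ => inner_self_nonneg _

end Interior

/-! ### The compatible `ℓ²(G)`-space -/

section EllHat

open InverseSemigroup HilbertModule
open scoped ZeroAtInfty

variable {G : Type*} [InverseSemigroup G]

/-- The natural partial order: `g ≤ h` iff `g = e h` for some idempotent `e`. -/
def InverseSemigroup.NatLE (g h : G) : Prop := ∃ e : Idem G, g = e.val * h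

/-- The pointwise supremum of the characteristic functions `1_e`, `e ∈ S`. -/
def SpecE.joinFun (S : Set (Idem G)) (χ : SpecE G) : ℝ :=
  ⨆ e : S, if χ.toFun e.1 = true then (1 : ℝ) else 0

/-- `G` is `E`-continuous: for every `g`, the pointwise supremum of the functions `1_e` with
`e ∈ E`, `e ≤ g`, is an element of `C₀(X)`. -/
class EContinuous (G : Type*) [InverseSemigroup G] : Prop where
  exists_eq : ∀ g : G, ∃ f : C₀(SpecE G, ℂ), ∀ χ,
    f χ = (SpecE.joinFun {e : Idem G | NatLE e.val g} χ : ℝ)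

namespace SpecE

theorem joinFun_pos {S : Set (Idem G)} {χ : SpecE G} (h : ∃ e ∈ S, χ.toFun e = true) :
    joinFun S χ = 1 := by
  obtain ⟨e, he, hχ⟩ := h
  have : Nonempty S := ⟨⟨e, he⟩⟩
  apply le_antisymm
  · exact ciSup_le fun e => by split_ifs <;> norm_num
  · have hb : BddAbove (Set.range fun e : S => if χ.toFun e.1 = true then (1 : ℝ) else 0) :=
      ⟨1, by rintro _ ⟨e, rfl⟩; dsimp only; split_ifs <;> norm_num⟩
    have := le_ciSup hb ⟨e, he⟩
    simpa [joinFun, hχ] using this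

theorem joinFun_neg {S : Set (Idem G)} {χ : SpecE G} (h : ¬ ∃ e ∈ S, χ.toFun e = true) :
    joinFun S χ = 0 := by
  have : ∀ e : S, (if χ.toFun e.1 = true then (1 : ℝ) else 0) = 0 := fun e =>
    if_neg fun he => h ⟨e.1, e.2, he⟩
  simp only [joinFun, this]
  exact Real.iSup_const_zero

end SpecE

/-- `{e ∈ E | e g = e h, e ≤ g g⁻¹ h h⁻¹}` -/
def kerSet (g h : G) : Set (Idem G) :=
  {e | e.val * g = e.val * h ∧ NatLE e.val (g * g⁻¹ * h * h⁻¹)}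

theorem mem_kerSet {g h : G} {e : Idem G} : e ∈ kerSet g h ↔
    e.val * g = e.val * h ∧ e * Idem.ran g = e ∧ e * Idem.ran h = e := by
  have hr : g * g⁻¹ * h * h⁻¹ = (Idem.ran g * Idem.ran h).val := mul_assoc _ _ _
  constructor
  · rintro ⟨h1, f, hf⟩
    have he : e = f * (Idem.ran g * Idem.ran h) := Idem.ext (by rw [hf, hr]; rfl)
    refine ⟨h1, ?_, ?_⟩
    · rw [he, mul_assoc, mul_assoc, mul_comm (Idem.ran h), ← mul_assoc (Idem.ran g), Idem.mul_self]
    · rw [he, mul_assoc, mul_assoc, Idem.mul_self]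
  · rintro ⟨h1, h2, h3⟩
    refine ⟨h1, e, ?_⟩
    rw [hr, ← Idem.val_mul, ← mul_assoc, h2, h3]

theorem kerSet_symm {g h : G} {e : Idem G} (he : e ∈ kerSet g h) : e ∈ kerSet h g := by
  rw [mem_kerSet] at *
  exact ⟨he.1.symm, he.2.2, he.2.1⟩

theorem kerSet_trans {g h k : G} {e f : Idem G} (he : e ∈ kerSet g h) (hf : f ∈ kerSet h k) :
    e * f ∈ kerSet g k := by
  rw [mem_kerSet] at *
  refine ⟨?_, ?_, ?_⟩
  · calc (e * f).val * g = (f * e).val * g := by rw [mul_comm]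
      _ = f.val * (e.val * g) := mul_assoc _ _ _
      _ = (f * e).val * h := by rw [he.1]; exact (mul_assoc _ _ _).symm
      _ = (e * f).val * h := by rw [mul_comm]
      _ = e.val * (f.val * h) := mul_assoc _ _ _
      _ = (e * f).val * k := by rw [hf.1]; exact (mul_assoc _ _ _).symm
  · rw [mul_assoc, mul_comm f, ← mul_assoc, he.2.1]
  · rw [mul_assoc, hf.2.2]

theorem kerSet_eq (g h : G) : kerSet g h = {e : Idem G | NatLE e.val (h * g⁻¹)} := by
  ext e
  rw [mem_kerSet]
  constructor
  · rintro ⟨h1, h2, -⟩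
    refine ⟨e, ?_⟩
    rw [← mul_assoc, ← h1, mul_assoc]
    exact (congrArg Idem.val h2).symm
  · rintro ⟨f, hf⟩
    have h1 : e.val = e.val * (h * g⁻¹) := by
      have : e.val * e.val = e.val * (f.val * (h * g⁻¹)) := by rw [← hf]
      rw [e.idem] at this
      calc e.val = e.val * f.val * (h * g⁻¹) := by rw [mul_assoc]; exact this
        _ = f.val * e.val * (h * g⁻¹) := by rw [idem_comm e.idem f.idem]
        _ = f.val * (f.val * (h * g⁻¹)) * (h * g⁻¹) := by rw [← hf]
        _ = e.val * (h * g⁻¹) := by rw [← mul_assoc f.val f.val, f.idem, ← hf]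
    have hk : h * g⁻¹ * (h * g⁻¹)⁻¹ * (h * g⁻¹) = h * g⁻¹ := mul_inv_mul _
    generalize hkd : h * g⁻¹ = k at h1 hk
    have hki : k⁻¹ = g * h⁻¹ := by rw [← hkd, mul_inv_rev', inv_inv']
    have h2 : e.val = k⁻¹ * e.val := by
      have := congrArg (fun x => x⁻¹) h1
      simpa only [mul_inv_rev', inv_of_idem e.idem] using this
    have h3 : e.val = k * e.val := by
      calc e.val = e.val * (k * k⁻¹ * k) := by rw [hk]; exact h1
        _ = (e.val * (k * k⁻¹)) * k := by simp only [mul_assoc]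
        _ = ((k * k⁻¹) * e.val) * k := by rw [idem_comm e.idem (mul_inv_idem k)]
        _ = k * (k⁻¹ * e.val) * k := by simp only [mul_assoc]
        _ = k * (e.val * k) := by rw [← h2, mul_assoc]
        _ = k * e.val := by rw [← h1]
    have h4 : e.val = e.val * k⁻¹ := by
      have := congrArg (fun x => x⁻¹) h3
      simpa only [mul_inv_rev', inv_of_idem e.idem] using this
    have hg : (g * g⁻¹) * e.val = e.val := by
      conv_lhs => rw [h2, hki]
      rw [← mul_assoc, ← mul_assoc, mul_inv_mul, ← hki, ← h2]
    have hh : (h * h⁻¹) * e.val = e.val := by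
      conv_lhs => rw [h3, ← hkd]
      rw [← mul_assoc, ← mul_assoc, mul_inv_mul, hkd, ← h3]
    have h5 : e.val * g = e.val * h * (g⁻¹ * g) := by
      conv_lhs => rw [h1, ← hkd]
      simp only [mul_assoc]
    have h6 : e.val * h = e.val * g * (h⁻¹ * h) := by
      conv_lhs => rw [h4, hki]
      simp only [mul_assoc]
    refine ⟨?_, ?_, ?_⟩
    · calc e.val * g = e.val * h * (g⁻¹ * g) := h5
        _ = e.val * g * ((h⁻¹ * h) * (g⁻¹ * g)) := by
          conv_lhs => rw [h6]
          simp only [mul_assoc]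
        _ = e.val * (g * g⁻¹ * g) * (h⁻¹ * h) := by
          rw [idem_comm (inv_mul_idem h) (inv_mul_idem g)]
          simp only [mul_assoc]
        _ = e.val * h := by rw [mul_inv_mul, ← h6]
    · apply Idem.ext
      change e.val * (g * g⁻¹) = e.val
      rw [idem_comm e.idem (mul_inv_idem g), hg]
    · apply Idem.ext
      change e.val * (h * h⁻¹) = e.val
      rw [idem_comm e.idem (mul_inv_idem h), hh]

/-- `⟨φ_g, φ_h⟩ = ⋁ {1_e | e ∈ E, e g = e h, e ≤ g g⁻¹ h h⁻¹}`, an element of `C₀(X)` because `G` is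
`E`-continuous. -/
def ellKer [EContinuous G] (g h : G) : C₀(SpecE G, ℂ) where
  toFun χ := (SpecE.joinFun (kerSet g h) χ : ℝ)
  continuous_toFun := by
    obtain ⟨f, hf⟩ := EContinuous.exists_eq (h * g⁻¹)
    rw [kerSet_eq]
    exact f.continuous.congr hf
  zero_at_infty' := by
    obtain ⟨f, hf⟩ := EContinuous.exists_eq (h * g⁻¹)
    rw [kerSet_eq]
    exact f.zero_at_infty'.congr hf

variable [EContinuous G]

theorem ellKer_pos {g h : G} {χ : SpecE G} (H : ∃ e ∈ kerSet g h, χ.toFun e = true) :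
    ellKer g h χ = 1 := by
  change ((SpecE.joinFun (kerSet g h) χ : ℝ) : ℂ) = 1
  rw [SpecE.joinFun_pos H, Complex.ofReal_one]

theorem ellKer_neg {g h : G} {χ : SpecE G} (H : ¬ ∃ e ∈ kerSet g h, χ.toFun e = true) :
    ellKer g h χ = 0 := by
  change ((SpecE.joinFun (kerSet g h) χ : ℝ) : ℂ) = 0
  rw [SpecE.joinFun_neg H, Complex.ofReal_zero]

theorem ellKer_star (g h : G) : star (ellKer g h) = ellKer h g := by
  ext χ
  rw [ZeroAtInftyContinuousMap.star_apply]
  by_cases H : ∃ e ∈ kerSet g h, χ.toFun e = true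
  · have H' : ∃ e ∈ kerSet h g, χ.toFun e = true := H.imp fun e he => ⟨kerSet_symm he.1, he.2⟩
    rw [ellKer_pos H, ellKer_pos H', star_one]
  · have H' : ¬ ∃ e ∈ kerSet h g, χ.toFun e = true := fun H' =>
      H (H'.imp fun e he => ⟨kerSet_symm he.1, he.2⟩)
    rw [ellKer_neg H, ellKer_neg H', star_zero]

/-- The `0/1`-matrix of a partial equivalence relation is positive. -/
theorem sum_per_nonneg {ι : Type*} (r : ι → ι → Prop) (hs : ∀ i j, r i j → r j i)
    (ht : ∀ i j k, r i j → r j k → r i k) (K : ι → ι → ℂ) (h1 : ∀ i j, r i j → K i j = 1)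
    (h0 : ∀ i j, ¬ r i j → K i j = 0) (s : Finset ι) (c : ι → ℂ) :
    ∃ t : ℝ, 0 ≤ t ∧ ∑ i ∈ s, ∑ j ∈ s, star (c i) * K i j * c j = t := by
  classical
  let q : ι → Set ι := fun i => {j | r i j}
  have hq : ∀ i, r i i → ∀ j, r i j ↔ (r j j ∧ q i = q j) := by
    intro i hi j
    constructor
    · intro hij
      exact ⟨ht _ _ _ (hs _ _ hij) hij, Set.ext fun k =>
        ⟨fun h => ht _ _ _ (hs _ _ hij) h, fun h => ht _ _ _ hij h⟩⟩
    · rintro ⟨hj, h⟩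
      have : j ∈ q j := hj
      rwa [← h] at this
  obtain ⟨s', hs'⟩ : ∃ s', s' = s.filter fun i => r i i := ⟨_, rfl⟩
  let S := s'.image q
  refine ⟨∑ v ∈ S, ‖∑ i ∈ s'.filter (fun i => q i = v), c i‖ ^ 2,
    Finset.sum_nonneg fun _ _ => by positivity, ?_⟩
  have hA : ∑ i ∈ s, ∑ j ∈ s, star (c i) * K i j * c j
      = ∑ i ∈ s', ∑ j ∈ s', if q i = q j then star (c i) * c j else 0 := by
    rw [hs', Finset.sum_filter]
    refine Finset.sum_congr rfl fun i _ => ?_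
    split_ifs with hi
    · rw [Finset.sum_filter]
      refine Finset.sum_congr rfl fun j _ => ?_
      by_cases hij : r i j
      · obtain ⟨hj, he⟩ := (hq i hi j).1 hij
        rw [if_pos hj, if_pos he, h1 i j hij, mul_one]
      · rw [h0 i j hij, mul_zero, zero_mul]
        split_ifs with hj he
        · exact absurd ((hq i hi j).2 ⟨hj, he⟩) hij
        · rfl
        · rfl
    · refine Finset.sum_eq_zero fun j _ => ?_
      rw [h0 i j fun hij => hi (ht _ _ _ hij (hs _ _ hij)), mul_zero, zero_mul]
  rw [hA, Complex.ofReal_sum,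
    ← Finset.sum_fiberwise_of_maps_to (g := q) (t := S) (fun i hi => Finset.mem_image_of_mem q hi)]
  refine Finset.sum_congr rfl fun v _ => ?_
  rw [Complex.ofReal_pow, ← Complex.conj_mul', map_sum, Finset.sum_mul_sum]
  refine Finset.sum_congr rfl fun i hi => ?_
  rw [(Finset.mem_filter.1 hi).2, Finset.sum_filter]
  refine Finset.sum_congr rfl fun j _ => ?_
  simp only [eq_comm (a := v)]
  rfl

/-- The pairing `∑ a_g⋆ ⟨φ_g, φ_h⟩ b_h`. -/
def ellForm : (G →₀ C₀(SpecE G, ℂ)) →ₗ⋆[ℂ] (G →₀ C₀(SpecE G, ℂ)) →ₗ[ℂ] C₀(SpecE G, ℂ) :=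
  LinearMap.mk₂'ₛₗ _ _ (fun x y => x.sum fun g a => y.sum fun h b => star a * ellKer g h * b)
    (fun x x' y => Finsupp.sum_add_index' (fun g => by simp)
      fun g a a' => by simp [add_mul, Finsupp.sum_add])
    (fun c x y => by
      rw [Finsupp.sum_smul_index' (by simp), Finsupp.smul_sum]
      simp only [Finsupp.smul_sum, star_smul, smul_mul_assoc]
      rfl)
    (fun x y y' => by
      rw [← Finsupp.sum_add]
      refine Finset.sum_congr rfl fun g _ => ?_
      exact Finsupp.sum_add_index' (by simp) fun h b b' => by simp [mul_add])
    (fun c x y => by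
      rw [Finsupp.smul_sum]
      refine Finset.sum_congr rfl fun g _ => ?_
      change ((c • y).sum fun h b => star (x g) * ellKer g h * b)
        = c • y.sum fun h b => star (x g) * ellKer g h * b
      rw [Finsupp.sum_smul_index' (by simp), Finsupp.smul_sum]
      simp only [mul_smul_comm])

theorem ellForm_apply (x y : G →₀ C₀(SpecE G, ℂ)) :
    ellForm x y = x.sum fun g a => y.sum fun h b => star a * ellKer g h * b := rfl

theorem ellForm_single (g h : G) (a b : C₀(SpecE G, ℂ)) :
    ellForm (Finsupp.single g a) (Finsupp.single h b) = star a * ellKer g h * b := by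
  rw [ellForm_apply, Finsupp.sum_single_index (by simp), Finsupp.sum_single_index (by simp)]

variable (G) in
/-- The free right `C₀(X)`-module on symbols `φ_g`, `g ∈ G`, with
`⟨∑ φ_g a_g, ∑ φ_h b_h⟩ = ∑ a_g⋆ ⟨φ_g, φ_h⟩ b_h`. -/
def ellPre : PreHilbert C₀(SpecE G, ℂ) (G →₀ C₀(SpecE G, ℂ)) where
  form := ellForm
  act a := Finsupp.mapRange.linearMap (LinearMap.mulRight ℂ a)
  star_form x y := by
    induction x using Finsupp.induction_linear with
    | zero => simp
    | add x x' hx hx' => simp only [map_add, LinearMap.add_apply, star_add, hx, hx']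
    | single g a =>
      induction y using Finsupp.induction_linear with
      | zero => simp
      | add y y' hy hy' => simp only [map_add, LinearMap.add_apply, star_add, hy, hy']
      | single h b =>
        rw [ellForm_single, ellForm_single, star_mul, star_mul, star_star, ellKer_star, mul_assoc]
  form_act x y a := by
    induction x using Finsupp.induction_linear with
    | zero => simp
    | add x x' hx hx' => simp only [map_add, LinearMap.add_apply, add_mul, hx, hx']
    | single g b =>
      induction y using Finsupp.induction_linear with
      | zero => simp
      | add y y' hy hy' => simp only [map_add, add_mul, hy, hy']
      | single h c =>
        rw [Finsupp.mapRange.linearMap_apply, Finsupp.mapRange_single, ellForm_single,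
          ellForm_single, LinearMap.mulRight_apply, mul_assoc, mul_assoc, mul_assoc]
  form_nonneg x := by
    apply SpecE.nonneg_of_forall
    intro χ
    obtain ⟨t, ht, h⟩ := sum_per_nonneg
      (fun g h : G => ∃ e ∈ kerSet g h, χ.toFun e = true)
      (fun g h H => H.imp fun e he => ⟨kerSet_symm he.1, he.2⟩)
      (fun g h k ⟨e, he, h1⟩ ⟨f, hf, h2⟩ => ⟨e * f, kerSet_trans he hf, by
        rw [χ.map_mul, h1, h2]; rfl⟩)
      (fun g h => ellKer g h χ) (fun g h H => ellKer_pos H) (fun g h H => ellKer_neg H)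
      x.support (fun g => x g χ)
    refine ⟨t, ht, ?_⟩
    rw [← h, ellForm_apply]
    let ev : C₀(SpecE G, ℂ) →+ ℂ := ⟨⟨fun f => f χ, rfl⟩, fun f g => rfl⟩
    change ev _ = _
    rw [Finsupp.sum, map_sum]
    refine Finset.sum_congr rfl fun g _ => ?_
    rw [Finsupp.sum, map_sum]
    rfl

end EllHat

section EllHatAction

open InverseSemigroup HilbertModule
open scoped ZeroAtInfty

variable {G : Type*} [InverseSemigroup G]

theorem SpecE.act_idem (e : Idem G) (f : C₀(SpecE G, ℂ)) : GAlgebra.act e.val f = ind e * f := by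
  have h := actC0_ran e.val f
  rw [inv_of_idem e.idem, e.idem, Idem.ran_idem] at h
  exact h

theorem SpecE.star_ind (e : Idem G) : star (ind e) = ind e := by
  ext χ
  rw [ZeroAtInftyContinuousMap.star_apply, ind_apply]
  split_ifs <;> simp

/-- `j (φ_g a) = φ_{jg} j(a)` -/
def ellT (j : G) : (G →₀ C₀(SpecE G, ℂ)) →ₗ[ℂ] (G →₀ C₀(SpecE G, ℂ)) :=
  Finsupp.lmapDomain _ ℂ (fun g => j * g) ∘ₗ
    Finsupp.mapRange.linearMap
      { toFun := GAlgebra.act j, map_add' := map_add _, map_smul' := map_smul _ }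

theorem ellT_single (j g : G) (a : C₀(SpecE G, ℂ)) :
    ellT j (Finsupp.single g a) = Finsupp.single (j * g) (GAlgebra.act j a) := by
  rw [ellT, LinearMap.comp_apply, Finsupp.mapRange.linearMap_apply, Finsupp.mapRange_single,
    Finsupp.lmapDomain_apply, Finsupp.mapDomain_single]
  rfl

variable [EContinuous G]

theorem ellKer_mul_idem (g h : G) (e : Idem G) :
    ellKer g (e.val * h) = SpecE.ind e * ellKer g h := by
  ext χ
  rw [ZeroAtInftyContinuousMap.mul_apply, SpecE.ind_apply]
  have hr : Idem.ran (e.val * h) = e * Idem.ran h := by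
    rw [← Idem.conj_ran, Idem.conj_idem]
  by_cases H : ∃ f ∈ kerSet g (e.val * h), χ.toFun f = true
  · rw [ellKer_pos H]
    obtain ⟨f, hf, hχ⟩ := H
    rw [mem_kerSet, hr] at hf
    obtain ⟨h1, h2, h3⟩ := hf
    have h4 : f * e = f := by
      conv_lhs => rw [← h3]
      rw [mul_assoc, mul_right_comm, Idem.mul_self, h3]
    have h5 : χ.toFun e = true := by
      rw [← h4, χ.map_mul, Bool.and_eq_true] at hχ
      exact hχ.2
    have h6 : ∃ f ∈ kerSet g h, χ.toFun f = true := by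
      refine ⟨f, mem_kerSet.2 ⟨?_, h2, ?_⟩, hχ⟩
      · rw [h1, ← mul_assoc, ← Idem.val_mul, h4]
      · rw [← mul_assoc, h4] at h3
        exact h3
    rw [if_pos h5, ellKer_pos h6, one_mul]
  · rw [ellKer_neg H]
    by_cases h5 : χ.toFun e = true
    · rw [ellKer_neg, mul_zero]
      rintro ⟨f, hf, hχ⟩
      rw [mem_kerSet] at hf
      obtain ⟨h1, h2, h3⟩ := hf
      refine H ⟨f * e, mem_kerSet.2 ⟨?_, ?_, ?_⟩, ?_⟩
      · rw [← mul_assoc, ← Idem.val_mul, mul_assoc f, Idem.mul_self, mul_comm f, Idem.val_mul,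
          mul_assoc, mul_assoc, h1]
      · rw [mul_right_comm, h2]
      · rw [hr, ← mul_assoc, mul_assoc f, Idem.mul_self, mul_right_comm, h3]
      · rw [χ.map_mul, hχ, h5]; rfl
    · rw [if_neg h5, zero_mul]

theorem ellKer_act (j g h : G) : ellKer (j * g) (j * h) = GAlgebra.act j (ellKer g h) := by
  rw [SpecE.act_def]
  ext χ
  have hle : ∀ f : Idem G, ∀ k : G, f * Idem.ran (j * k) = f → χ.toFun f = true →
      χ.toFun (Idem.ran j) = true := by
    intro f k h1 h2
    rw [← h1, ← Idem.conj_ran, Idem.conj_le, χ.map_mul, χ.map_mul, Bool.and_eq_true,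
      Bool.and_eq_true] at h2
    exact h2.2.1
  by_cases hj : χ.toFun (Idem.ran j) = true
  · rw [SpecE.actC0_pos _ _ _ hj]
    have hiff : (∃ f ∈ kerSet (j * g) (j * h), χ.toFun f = true) ↔
        ∃ e ∈ kerSet g h, (SpecE.pull j χ hj).toFun e = true := by
      constructor
      · rintro ⟨f, hf, hχ⟩
        rw [mem_kerSet] at hf
        obtain ⟨h1, h2, h3⟩ := hf
        have hran : ∀ k : G, f * Idem.ran (j * k) = f →
            Idem.conj j⁻¹ f * Idem.ran k = Idem.conj j⁻¹ f := by
          intro k hk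
          have h4 : Idem.conj j⁻¹ f = Idem.conj j⁻¹ f * (Idem.conj (j⁻¹ * j) (Idem.ran k)) := by
            rw [Idem.conj_conj, Idem.conj_ran, ← Idem.conj_mul, hk]
          have h5 : Idem.conj (j⁻¹ * j) (Idem.ran k) = ⟨j⁻¹ * j, inv_mul_idem j⟩ * Idem.ran k :=
            Idem.conj_idem ⟨j⁻¹ * j, inv_mul_idem j⟩ _
          rw [h4, h5, mul_assoc, mul_assoc, Idem.mul_self]
        refine ⟨Idem.conj j⁻¹ f, mem_kerSet.2 ⟨?_, hran g h2, hran h h3⟩, ?_⟩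
        · change j⁻¹ * f.val * j⁻¹⁻¹ * g = j⁻¹ * f.val * j⁻¹⁻¹ * h
          rw [inv_inv', mul_assoc, mul_assoc, h1, mul_assoc, mul_assoc]
        · change χ.toFun (Idem.conj j (Idem.conj j⁻¹ f)) = true
          have h5 : Idem.conj (j * j⁻¹) f = Idem.ran j * f := Idem.conj_idem (Idem.ran j) f
          rw [← Idem.conj_conj, h5, χ.map_mul, hj, hχ]
          rfl
      · rintro ⟨e, he, hχ⟩
        rw [mem_kerSet] at he
        obtain ⟨h1, h2, h3⟩ := he
        refine ⟨Idem.conj j e, mem_kerSet.2 ⟨?_, ?_, ?_⟩, hχ⟩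
        · change j * e.val * j⁻¹ * (j * g) = j * e.val * j⁻¹ * (j * h)
          rw [← mul_assoc, ← mul_assoc, ← mul_idem_eq j e.idem, mul_assoc, mul_assoc, h1]
        · rw [← Idem.conj_ran, ← Idem.conj_mul, h2]
        · rw [← Idem.conj_ran, ← Idem.conj_mul, h3]
    by_cases H : ∃ f ∈ kerSet (j * g) (j * h), χ.toFun f = true
    · rw [ellKer_pos H, ellKer_pos (hiff.1 H)]
    · rw [ellKer_neg H, ellKer_neg fun H' => H (hiff.2 H')]
  · rw [SpecE.actC0_neg _ _ _ hj, ellKer_neg]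
    rintro ⟨f, hf, hχ⟩
    exact hj (hle f g (mem_kerSet.1 hf).2.1 hχ)

variable (G) in
/-- The action of `G` with `j (φ_g a) = φ_{jg} j(a)`. -/
def ellAction : (ellPre G).Action G where
  T := ellT
  T_mul g h x := by
    induction x using Finsupp.induction_linear with
    | zero => simp
    | add x y hx hy => simp only [map_add, hx, hy]
    | single k a => simp only [ellT_single, mul_assoc, GAlgebra.act_mul]
  form_T j x y := by
    change ellForm _ _ = GAlgebra.act j (ellForm _ _)
    induction x using Finsupp.induction_linear with
    | zero => simp
    | add x x' hx hx' => simp only [map_add, LinearMap.add_apply, hx, hx']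
    | single g a =>
      induction y using Finsupp.induction_linear with
      | zero => simp
      | add y y' hy hy' => simp only [map_add, hy, hy']
      | single h b =>
        simp only [ellT_single, ellForm_single, ellKer_act, map_mul, map_star]
  form_T_idem j x y := by
    change ellForm _ _ = GAlgebra.act (j * j⁻¹) (ellForm _ _)
    induction x using Finsupp.induction_linear with
    | zero => simp
    | add x x' hx hx' => simp only [map_add, LinearMap.add_apply, hx, hx']
    | single g a =>
      induction y using Finsupp.induction_linear with
      | zero => simp
      | add y y' hy hy' => simp only [map_add, hy, hy']
      | single h b =>
        have h1 : ∀ f : C₀(SpecE G, ℂ), GAlgebra.act (j * j⁻¹) f = SpecE.ind (Idem.ran j) * f :=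
          SpecE.act_idem (Idem.ran j)
        have h2 : ellKer g (j * j⁻¹ * h) = SpecE.ind (Idem.ran j) * ellKer g h :=
          ellKer_mul_idem g h (Idem.ran j)
        have h3 : SpecE.ind (Idem.ran j) * SpecE.ind (Idem.ran j) = SpecE.ind (Idem.ran j) := by
          rw [← SpecE.ind_mul, Idem.mul_self]
        simp only [ellT_single, ellForm_single, h1, h2]
        calc star a * (SpecE.ind (Idem.ran j) * ellKer g h) * (SpecE.ind (Idem.ran j) * b)
            = (SpecE.ind (Idem.ran j) * SpecE.ind (Idem.ran j)) * (star a * ellKer g h * b) := by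
              ac_rfl
          _ = _ := by rw [h3]

variable (G) in
/-- The compatible `ℓ²(G)`-space: the Hausdorff completion of the free right `C₀(X)`-module on
symbols `φ_g`.  In it `φ_g 1_e = φ_{eg}`, see below. -/
abbrev EllHat2 : Type _ := (ellPre G).Completed

instance : GHilbertModule G C₀(SpecE G, ℂ) (EllHat2 G) := (ellAction G).gHilbertModule

variable (G) in
/-- The vector `φ_g`, that is `φ_g 1_{gg⁻¹}`. -/
def EllHat2.phi (g : G) : EllHat2 G :=
  (ellPre G).ι (Finsupp.single g (SpecE.ind (Idem.ran g)))

namespace EllHat2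

theorem U_ι_single (j g : G) (a : C₀(SpecE G, ℂ)) :
    GHilbertModule.U (A := C₀(SpecE G, ℂ)) j ((ellPre G).ι (Finsupp.single g a))
      = (ellPre G).ι (Finsupp.single (j * g) (GAlgebra.act j a)) := by
  rw [← ellT_single]
  exact (ellAction G).extend_T j _

theorem ran_ellKer (g h : G) : SpecE.ind (Idem.ran g) * ellKer h g = ellKer h g := by
  rw [← ellKer_mul_idem, Idem.ran_mul_self]

theorem ran_ellKer' (g h : G) : SpecE.ind (Idem.ran g) * ellKer g h = ellKer g h := by
  have h1 := congrArg star (ran_ellKer g h)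
  have h2 : star (SpecE.ind (Idem.ran g) * ellKer h g)
      = star (ellKer h g) * star (SpecE.ind (Idem.ran g)) := by
    ext χ
    simp only [ZeroAtInftyContinuousMap.star_apply, ZeroAtInftyContinuousMap.mul_apply, star_mul]
  rw [h2, SpecE.star_ind, ellKer_star, mul_comm] at h1
  exact h1

theorem inner_phi (g h : G) :
    HilbertModule.inner (phi G g) (phi G h) = ellKer g h := by
  rw [phi, phi, PreHilbert.inner_ι]
  change ellForm _ _ = _
  rw [ellForm_single, SpecE.star_ind, ran_ellKer', mul_comm, ran_ellKer]

theorem ι_ext {v w : G →₀ C₀(SpecE G, ℂ)} (H : ∀ (h : G) (b : C₀(SpecE G, ℂ)),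
    ellForm (Finsupp.single h b) v = ellForm (Finsupp.single h b) w) :
    (ellPre G).ι v = (ellPre G).ι w := by
  have h2 : ∀ x, ellForm x (v - w) = 0 := by
    intro x
    induction x using Finsupp.induction_linear with
    | zero => simp
    | add x y hx hy => simp only [map_add, LinearMap.add_apply, hx, hy, add_zero]
    | single h b => exact ((ellForm (Finsupp.single h b)).map_sub v w).trans (sub_eq_zero.2 (H h b))
  rw [← sub_eq_zero, ← map_sub]
  apply HilbertModule.eq_zero_of_inner_self C₀(SpecE G, ℂ)
  rw [PreHilbert.inner_ι]
  exact h2 _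

theorem rsmul_phi (g : G) (a : C₀(SpecE G, ℂ)) : HilbertModule.rsmul (phi G g) a
    = (ellPre G).ι (Finsupp.single g (SpecE.ind (Idem.ran g) * a)) := by
  rw [phi, PreHilbert.rsmul_ι]
  change (ellPre G).ι (Finsupp.mapRange _ (map_zero (LinearMap.mulRight ℂ a)) _) = _
  rw [Finsupp.mapRange_single, LinearMap.mulRight_apply]

theorem ι_single (g : G) (a : C₀(SpecE G, ℂ)) :
    (ellPre G).ι (Finsupp.single g a) = HilbertModule.rsmul (phi G g) a := by
  rw [rsmul_phi]
  refine ι_ext fun h b => ?_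
  rw [ellForm_single, ellForm_single]
  conv_lhs => rw [← ran_ellKer g h]
  ac_rfl

/-- `φ_g 1_e = φ_{eg}` -/
theorem phi_rsmul_ind (g : G) (e : Idem G) :
    HilbertModule.rsmul (phi G g) (SpecE.ind e) = phi G (e.val * g) := by
  have hr : Idem.ran (e.val * g) = e * Idem.ran g := by
    rw [← Idem.conj_ran, Idem.conj_idem]
  have he : SpecE.ind e * SpecE.ind e = SpecE.ind e := by
    rw [← SpecE.ind_mul, Idem.mul_self]
  rw [rsmul_phi, phi, hr]
  refine ι_ext fun h b => ?_
  rw [ellForm_single, ellForm_single, ellKer_mul_idem, SpecE.ind_mul]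
  conv_lhs => rw [← he]
  ac_rfl

/-- `j φ_g = φ_{jg}` -/
theorem U_phi (j g : G) :
    GHilbertModule.U (A := C₀(SpecE G, ℂ)) j (phi G g) = phi G (j * g) := by
  rw [phi, phi, U_ι_single, SpecE.act_ind, Idem.conj_ran]

/-- The vectors `φ_g` span a dense subspace. -/
theorem dense_span_phi : Dense (Submodule.span ℂ (Set.range (phi G)) : Set (EllHat2 G)) := by
  let S : Submodule ℂ (EllHat2 G) := (Submodule.span ℂ (Set.range (phi G))).topologicalClosure
  suffices h : ∀ x : G →₀ C₀(SpecE G, ℂ), (ellPre G).ι x ∈ S from fun y =>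
    (ellPre G).induction y (p := fun y => y ∈ S) isClosed_closure h
  intro x
  induction x using Finsupp.induction_linear with
  | zero => rw [map_zero]; exact S.zero_mem
  | add x y hx hy => rw [map_add]; exact S.add_mem hx hy
  | single g a =>
    let L : C₀(SpecE G, ℂ) →ₗ[ℂ] EllHat2 G :=
      (ellPre G).ι ∘ₗ Finsupp.lsingle g
    have hL : Continuous L := by
      refine AddMonoidHomClass.continuous_of_bound L (√‖ellKer g g‖) fun a => ?_
      refine (sq_le_sq₀ (norm_nonneg _) (by positivity)).1 ?_
      rw [mul_pow, Real.sq_sqrt (norm_nonneg _)]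
      change ‖(ellPre G).ι (Finsupp.single g a)‖ ^ 2 ≤ _
      rw [PreHilbert.norm_sq_ι]
      change ‖ellForm _ _‖ ≤ _
      rw [ellForm_single]
      calc ‖star a * ellKer g g * a‖ ≤ ‖star a‖ * ‖ellKer g g‖ * ‖a‖ :=
            (norm_mul_le _ _).trans (by gcongr; exact norm_mul_le _ _)
        _ = ‖ellKer g g‖ * ‖a‖ ^ 2 := by
          have h3 : ‖star a‖ = ‖a‖ := norm_star a
          rw [h3]; ring
    change L a ∈ S
    refine SpecE.denseRange_indLin.induction_on (p := fun a => L a ∈ S) a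
      (isClosed_closure.preimage hL) fun l => ?_
    induction l using Finsupp.induction_linear with
    | zero => rw [map_zero, map_zero]; exact S.zero_mem
    | add x y hx hy => rw [map_add, map_add]; exact S.add_mem hx hy
    | single e c =>
      have h1 : SpecE.indLin G (Finsupp.single e c) = c • SpecE.ind e := by simp [SpecE.indLin]
      rw [h1, map_smul]
      refine S.smul_mem c ?_
      have h2 : L (SpecE.ind e) = phi G (e.val * g) :=
        (ι_single g _).trans (phi_rsmul_ind g e)
      rw [h2]
      exact subset_closure (Submodule.subset_span ⟨_, rfl⟩)

end EllHat2

end EllHatAction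

/-! ### The `G`-Hilbert module `L²(G, E)` -/

section L2

open InverseSemigroup HilbertModule
open scoped ZeroAtInfty TensorProduct

variable {G A : Type*} [InverseSemigroup G] [NonUnitalCStarAlgebra A] [PartialOrder A]
  [StarOrderedRing A] [GAlgebra G A]

namespace GHilbertModule

variable (E : Type*) [NormedAddCommGroup E] [NormedSpace ℂ E] [CompleteSpace E]
  [HilbertModule A E] [GHilbertModule G A E]

variable (A) in
/-- The Cauchy–Schwarz inequality in a Hilbert module. -/
theorem norm_inner_le {E : Type*} [NormedAddCommGroup E] [NormedSpace ℂ E] [CompleteSpace E]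
    [HilbertModule A E] (x y : E) : ‖HilbertModule.inner (A := A) x y‖ ≤ ‖x‖ * ‖y‖ := by
  let P : PreHilbert A E :=
    { form := innerₛₗ A
      act := rsmulₗ
      star_form := star_inner
      form_act := inner_rsmul_right
      form_nonneg := inner_self_nonneg }
  refine (sq_le_sq₀ (norm_nonneg _) (by positivity)).1 ?_
  rw [mul_pow, norm_sq_eq (A := A) x, norm_sq_eq (A := A) y]
  exact P.norm_form_sq_le x y

variable (A) in
theorem continuous_inner_right {E : Type*} [NormedAddCommGroup E] [NormedSpace ℂ E]
    [CompleteSpace E] [HilbertModule A E] (x : E) :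
    Continuous fun y : E => HilbertModule.inner (A := A) x y :=
  AddMonoidHomClass.continuous_of_bound (innerₛₗ A x) ‖x‖ (norm_inner_le A x)

variable (A) in
theorem continuous_inner_left {E : Type*} [NormedAddCommGroup E] [NormedSpace ℂ E]
    [CompleteSpace E] [HilbertModule A E] (y : E) :
    Continuous fun x : E => HilbertModule.inner (A := A) x y := by
  simp only [← star_inner y]
  exact continuous_star.comp (continuous_inner_right A y)

variable (G A) in
/-- The canonical representation of `C₀(X)` on `E`, with `π(1_e) = U_e`. -/
def specHRep : HilbertRep C₀(SpecE G, ℂ) A E where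
  op := (specRep G A E).toLinearMap
  op_mul b c x := by
    change specRep G A E (b * c) x = specRep G A E b (specRep G A E c x)
    have hm : ∀ b c d : C₀(SpecE G, ℂ), (b + c) * d = b * d + c * d := add_mul
    have hm' : ∀ b c d : C₀(SpecE G, ℂ), b * (c + d) = b * c + b * d := mul_add
    have hz : ∀ d : C₀(SpecE G, ℂ), 0 * d = 0 := zero_mul
    have hz' : ∀ d : C₀(SpecE G, ℂ), d * 0 = 0 := mul_zero
    refine specRep_induction
      (p := fun b => specRep G A E (b * c) x = specRep G A E b (specRep G A E c x)) b
      (isClosed_eq (by fun_prop) (by fun_prop)) ?_ ?_ ?_ ?_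
    · simp [hz]
    · intro f g hf hg
      simp only [hm, map_add, add_apply, hf, hg]
    · intro k f hf
      simp only [smul_mul_assoc, map_smul, smul_apply, hf]
    · intro e
      refine specRep_induction
        (p := fun c => specRep G A E (SpecE.ind e * c) x
          = specRep G A E (SpecE.ind e) (specRep G A E c x)) c
        (isClosed_eq (by fun_prop) (by fun_prop)) ?_ ?_ ?_ ?_
      · simp [hz']
      · intro f g hf hg
        simp only [hm', map_add, add_apply, hf, hg]
      · intro k f hf
        simp only [mul_smul_comm, map_smul, smul_apply, hf]
      · intro f
        rw [← SpecE.ind_mul, specRep_ind, specRep_ind, specRep_ind, Idem.val_mul, U_mul]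
  op_star b x y := by
    change HilbertModule.inner (A := A) (specRep G A E (star b) x) y
      = HilbertModule.inner (A := A) x (specRep G A E b y)
    refine specRep_induction
      (p := fun b => HilbertModule.inner (A := A) (specRep G A E (star b) x) y
        = HilbertModule.inner (A := A) x (specRep G A E b y)) b
      (isClosed_eq ((continuous_inner_left A y).comp ?_) ((continuous_inner_right A x).comp ?_))
      ?_ ?_ ?_ ?_
    · exact ((specRep G A E).continuous.comp continuous_star).clm_apply continuous_const
    · fun_prop
    · have h0 : star (0 : C₀(SpecE G, ℂ)) = 0 := star_zero _
      simp [h0, inner_zero_left, inner_zero_right]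
    · intro f g hf hg
      have h1 : star (f + g) = star f + star g := star_add f g
      simp only [h1, map_add, add_apply, HilbertModule.inner_add_left,
        HilbertModule.inner_add_right, hf, hg]
    · intro k f hf
      have h1 : star (k • f) = star k • star f := star_smul k f
      simp only [h1, map_smul, smul_apply, HilbertModule.inner_smul_left,
        HilbertModule.inner_smul_right, star_star, hf]
    · intro e
      rw [SpecE.star_ind, specRep_ind, specRep_ind, inner_U_idem_left e.idem]

theorem U_specRep (g : G) (f : C₀(SpecE G, ℂ)) (x : E) :
    U (A := A) g (specRep G A E f x) = specRep G A E (GAlgebra.act g f) (U (A := A) g x) := by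
  change UL A E g _ = _
  refine specRep_induction (p := fun f => UL A E g (specRep G A E f x)
    = specRep G A E (GAlgebra.act g f) (U (A := A) g x)) f (isClosed_eq (by fun_prop) ?_) ?_ ?_ ?_ ?_
  · exact ((specRep G A E).continuous.comp (GAlgebra.continuous_act g)).clm_apply continuous_const
  · simp
  · intro f f' h h'
    simp only [map_add, add_apply, h, h']
  · intro c f h
    simp only [map_smul, smul_apply, h]
  · intro e
    rw [specRep_ind, SpecE.act_ind, specRep_ind, UL_apply, ← U_mul]
    change _ = U (A := A) (g * e.val * g⁻¹) _
    rw [← U_mul, ← mul_idem_eq g e.idem]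

end GHilbertModule

variable [EContinuous G]
variable (G A) (E : Type*) [NormedAddCommGroup E] [NormedSpace ℂ E] [CompleteSpace E]
  [HilbertModule A E] [GHilbertModule G A E]

/-- The algebraic tensor product `ℓ̂²(G) ⊗ E` with
`⟨x ⊗ ξ, y ⊗ η⟩ = ⟨ξ, π(⟨x, y⟩) η⟩`. -/
def L2Pre : PreHilbert A (EllHat2 G ⊗[ℂ] E) :=
  interiorPre (EllHat2 G) (GHilbertModule.specHRep G A E)

theorem L2Pre_tmul (x y : EllHat2 G) (ξ η : E) :
    (L2Pre G A E).form (x ⊗ₜ ξ) (y ⊗ₜ η) = HilbertModule.inner (A := A) ξ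
      (GHilbertModule.specRep G A E (HilbertModule.inner (A := C₀(SpecE G, ℂ)) x y) η) := rfl

/-- The diagonal action `g (x ⊗ ξ) = g x ⊗ g ξ`. -/
def L2Action : (L2Pre G A E).Action G where
  T g := TensorProduct.map (GHilbertModule.U (A := C₀(SpecE G, ℂ)) g) (GHilbertModule.U (A := A) g)
  T_mul g h v := by
    induction v with
    | zero => simp
    | add v w hv hw => simp only [map_add, hv, hw]
    | tmul x ξ => simp only [TensorProduct.map_tmul, GHilbertModule.U_mul]
  form_T g v w := by
    induction v with
    | zero => simp
    | add v v' hv hv' => simp only [map_add, LinearMap.add_apply, hv, hv']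
    | tmul x ξ =>
      induction w with
      | zero => simp
      | add w w' hw hw' => simp only [map_add, hw, hw']
      | tmul y η =>
        rw [TensorProduct.map_tmul, TensorProduct.map_tmul, L2Pre_tmul, L2Pre_tmul,
          GHilbertModule.inner_U, ← GHilbertModule.U_specRep, GHilbertModule.inner_U]
  form_T_idem g v w := by
    induction v with
    | zero => simp
    | add v v' hv hv' => simp only [map_add, LinearMap.add_apply, hv, hv']
    | tmul x ξ =>
      induction w with
      | zero => simp
      | add w w' hw hw' => simp only [map_add, hw, hw']
      | tmul y η =>
        rw [TensorProduct.map_tmul, L2Pre_tmul, L2Pre_tmul,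
          GHilbertModule.inner_U_mul_inv, ← GHilbertModule.U_specRep,
          GHilbertModule.inner_U_mul_inv]

/-- `L²(G, E) = ℓ̂²(G) ⊗_{C₀(X)} E` -/
abbrev L2 : Type _ := (L2Pre G A E).Completed

instance : GHilbertModule G A (L2 G A E) := (L2Action G A E).gHilbertModule

end L2

end

/-! Two facts are combined. First, forgetting `G`, the modules `E^∞` and `A^∞` are unitarily
equivalent. Second, `L²(G, X)` depends on `X` only up to unitaries that need not be equivariant.
Since `L²(G, X^∞) ≅ L²(G, X)^∞` equivariantly, this gives `L²(G, E)^∞ ≅ L²(G, E^∞) ≅ L²(G, A^∞) ≅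
L²(G, A)^∞`.

For the first fact, call `Y` swept by `X` if countably many adjointable contractions `X → Y` have
ranges that span a dense subspace. Countable generation says that `A` sweeps `E` by the maps `a ↦
xa`. Fullness and a strictly positive element say that `E` sweeps `A` by the maps `y ↦ ⟨x, y⟩`. If
`X` and `Y` sweep each other, `IsSwept.exists_row_diag` produces in each direction an operator whose
joint range with an injection-like diagonal operator is dense. Combining the two directions gives an
adjointable `T : X^∞ → Y^∞` such that `T` and its adjoint both have dense range. Its polar
decomposition (`IsAdj.exists_unitary`) is the unitary. The square root needed there is taken in the
C⋆-algebra `Adjointable`.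

For the second fact, a unitary `u : X → Y` is sent to `φ_g ⊗ ξ ↦ φ_g ⊗ g u g⁻¹ ξ`, which is
equivariant because translating by `k` turns `g u g⁻¹` into `(kg) u (kg)⁻¹`. The difficulty is that
this must preserve the inner products between different `φ_g` and `φ_h`, which are not orthogonal in
general. On the part of the space cut out by an idempotent `e` with `eg = eh`, the translates of `u`
by `g` and by `h` agree, because `u` commutes with every idempotent automatically (`map_U_idem`). By
`E`-continuity `⟨φ_g, φ_h⟩` is a finite join of such `1_e`, so the two translates agree after
applying `⟨φ_g, φ_h⟩` (`specRep_ellKer_conjOp`). Moreover `g u g⁻¹` is only a partial isometry, with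
initial projection `gg⁻¹`, but `φ_g ⊗ ξ = φ_g ⊗ gg⁻¹ξ`, so nothing is lost.

All the unitaries are built from one principle: total families with equal Gram matrices are related
by a unitary, and by an equivariant one if `G` moves the two families in the same way. -/

/-! ### Hilbert modules: unitaries from total families, adjointable operators -/

namespace HilbertModule

variable {A X Y Z : Type*} [NonUnitalCStarAlgebra A] [PartialOrder A] [StarOrderedRing A]
  [NormedAddCommGroup X] [NormedSpace ℂ X] [CompleteSpace X] [HilbertModule A X]
  [NormedAddCommGroup Y] [NormedSpace ℂ Y] [CompleteSpace Y] [HilbertModule A Y]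
  [NormedAddCommGroup Z] [NormedSpace ℂ Z] [CompleteSpace Z] [HilbertModule A Z]

theorem norm_eq_of_inner_self_eq {x : X} {y : Y} (h : inner (A := A) x x = inner y y) :
    ‖x‖ = ‖y‖ := by
  refine (sq_eq_sq₀ (norm_nonneg _) (norm_nonneg _)).1 ?_
  rw [norm_sq_eq (A := A), norm_sq_eq (A := A), h]

variable (A X) in
/-- The inner product as a continuous sesquilinear map. -/
noncomputable def innerL : X →L⋆[ℂ] X →L[ℂ] A :=
  LinearMap.mkContinuous₂ (innerₛₗ A) 1 fun x y => by
    rw [one_mul]; exact GHilbertModule.norm_inner_le A x y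

@[simp] theorem innerL_apply (x y : X) : innerL A X x y = inner x y := rfl

theorem continuous_inner {T : Type*} [TopologicalSpace T] {f g : T → X} (hf : Continuous f)
    (hg : Continuous g) : Continuous fun t => inner (A := A) (f t) (g t) :=
  ((innerL A X).continuous.comp hf).clm_apply hg

theorem inner_linearCombination {I : Type*} (v : I → X) (c d : I →₀ ℂ) :
    inner (A := A) (Finsupp.linearCombination ℂ v c) (Finsupp.linearCombination ℂ v d)
      = c.sum fun i a => d.sum fun j b => star a • b • inner (v i) (v j) := by
  simp only [Finsupp.linearCombination_apply, Finsupp.sum, ← innerₛₗ_apply, map_sum,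
    LinearMap.sum_apply, map_smul, LinearMap.map_smulₛₗ, LinearMap.smul_apply, smul_smul]
  rw [Finset.sum_comm]
  refine Finset.sum_congr rfl fun j _ => ?_
  rw [Finset.smul_sum]
  refine Finset.sum_congr rfl fun i _ => ?_
  rw [smul_smul, mul_comm]; rfl

theorem denseRange_linearCombination {E I : Type*} [NormedAddCommGroup E] [NormedSpace ℂ E]
    {v : I → E} (hv : Dense (Submodule.span ℂ (Set.range v) : Set E)) :
    DenseRange (Finsupp.linearCombination ℂ v) := by
  rw [← Finsupp.range_linearCombination] at hv
  exact hv

/-- Two total families with the same Gram matrix are related by a unitary. -/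
theorem exists_unitary_of_total {I : Type*} (v : I → X) (w : I → Y)
    (hv : Dense (Submodule.span ℂ (Set.range v) : Set X))
    (hw : Dense (Submodule.span ℂ (Set.range w) : Set Y))
    (h : ∀ i j, inner (A := A) (v i) (v j) = inner (w i) (w j)) :
    ∃ T : X ≃L[ℂ] Y, (∀ i, T (v i) = w i) ∧
      ∀ x y, inner (A := A) (T x) (T y) = inner x y := by
  let lv := Finsupp.linearCombination ℂ v
  let lw := Finsupp.linearCombination ℂ w
  have dv : DenseRange lv := denseRange_linearCombination hv
  have dw : DenseRange lw := denseRange_linearCombination hw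
  -- Equal Gram matrices make formal combinations have equal norms in `X` and `Y`. Hence `lv c ↦ lw
  -- c` is well defined and isometric even if the families are linearly dependent.
  have hin : ∀ c d, inner (A := A) (lv c) (lv d) = inner (lw c) (lw d) := fun c d => by
    simp only [lv, lw, inner_linearCombination, h]
  have hn : ∀ c, ‖lv c‖ = ‖lw c‖ := fun c => norm_eq_of_inner_self_eq (hin c c)
  let T := lw.extendOfNorm lv
  let S := lv.extendOfNorm lw
  have hT : ∀ c, T (lv c) = lw c := fun c =>
    LinearMap.extendOfNorm_eq dv ⟨1, fun c => by rw [one_mul, hn]⟩ c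
  have hS : ∀ c, S (lw c) = lv c := fun c =>
    LinearMap.extendOfNorm_eq dw ⟨1, fun c => by rw [one_mul, hn]⟩ c
  refine ⟨ContinuousLinearEquiv.equivOfInverse T S (fun x => ?_) (fun y => ?_), fun i => ?_,
    fun x y => ?_⟩
  · refine dv.induction_on (p := fun x => S (T x) = x) x (isClosed_eq (by fun_prop) (by fun_prop))
      fun c => ?_
    rw [hT, hS]
  · refine dw.induction_on (p := fun y => T (S y) = y) y (isClosed_eq (by fun_prop) (by fun_prop))
      fun c => ?_
    rw [hS, hT]
  · have := hT (Finsupp.single i 1)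
    simpa [lv, lw] using this
  · change inner (A := A) (T x) (T y) = inner x y
    refine dv.induction_on (p := fun x => inner (A := A) (T x) (T y) = inner x y) x
      (isClosed_eq (continuous_inner (by fun_prop) (by fun_prop))
        (continuous_inner (by fun_prop) (by fun_prop))) fun c => ?_
    refine dv.induction_on (p := fun y => inner (A := A) (T (lv c)) (T y) = inner (lv c) y) y
      (isClosed_eq (continuous_inner (by fun_prop) (by fun_prop))
        (continuous_inner (by fun_prop) (by fun_prop))) fun d => ?_
    rw [hT, hT, hin]

/-- A unitary is linear over `A`. -/
theorem map_rsmul_of_inner_map {T : X → Y} (hs : Function.Surjective T)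
    (h : ∀ x y, inner (A := A) (T x) (T y) = inner x y) (x : X) (a : A) :
    T (rsmul x a) = rsmul (T x) a := by
  apply ext_inner A
  intro z
  -- Surjectivity allows testing against vectors `T z` only, where both sides can be moved back to
  -- `X`.
  obtain ⟨z, rfl⟩ := hs z
  rw [h, inner_rsmul_right, inner_rsmul_right, h]

/-! ### Mutually adjoint operators -/

variable (A) in
/-- `T` and `T'` are adjoint to each other. -/
def IsAdj (T : X →L[ℂ] Y) (T' : Y →L[ℂ] X) : Prop :=
  ∀ x y, inner (A := A) (T x) y = inner x (T' y)

namespace IsAdj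

theorem symm {T : X →L[ℂ] Y} {T' : Y →L[ℂ] X} (h : IsAdj A T T') : IsAdj A T' T := fun y x => by
  rw [← star_inner, ← h, star_inner]

theorem comp {T : X →L[ℂ] Y} {T' : Y →L[ℂ] X} {S : Y →L[ℂ] Z} {S' : Z →L[ℂ] Y}
    (hS : IsAdj A S S') (hT : IsAdj A T T') : IsAdj A (S ∘L T) (T' ∘L S') := fun x z => by
  simp only [ContinuousLinearMap.comp_apply]
  rw [hS, hT]

theorem add {T S : X →L[ℂ] Y} {T' S' : Y →L[ℂ] X} (hT : IsAdj A T T') (hS : IsAdj A S S') :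
    IsAdj A (T + S) (T' + S') := fun x z => by
  simp only [add_apply, inner_add_left, inner_add_right, hT x, hS x]

theorem smul {T : X →L[ℂ] Y} {T' : Y →L[ℂ] X} (hT : IsAdj A T T') (c : ℂ) :
    IsAdj A (c • T) (star c • T') := fun x z => by
  simp only [smul_apply, inner_smul_left, inner_smul_right, hT x]

theorem unique {T : X →L[ℂ] Y} {T' T'' : Y →L[ℂ] X} (h : IsAdj A T T') (h' : IsAdj A T T'') :
    T' = T'' :=
  ContinuousLinearMap.ext fun y => ext_inner A fun x => by rw [← h, ← h']

/-- Cauchy–Schwarz applied to `⟨Tx, Tx⟩ = ⟨x, T'Tx⟩`. This is the inequality half of the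
C⋆-identity. -/
theorem norm_sq_le {T : X →L[ℂ] Y} {T' : Y →L[ℂ] X} (h : IsAdj A T T') :
    ‖T‖ * ‖T‖ ≤ ‖T' ∘L T‖ := by
  have key : ‖T‖ ≤ √‖T' ∘L T‖ := by
    refine ContinuousLinearMap.opNorm_le_bound _ (Real.sqrt_nonneg _) fun x => ?_
    refine (sq_le_sq₀ (norm_nonneg _) (by positivity)).1 ?_
    rw [norm_sq_eq (A := A), h, mul_pow, Real.sq_sqrt (norm_nonneg _)]
    calc _ ≤ ‖x‖ * ‖(T' ∘L T) x‖ := GHilbertModule.norm_inner_le A _ _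
      _ ≤ ‖x‖ * (‖T' ∘L T‖ * ‖x‖) := by gcongr; exact ContinuousLinearMap.le_opNorm _ _
      _ = _ := by ring
  calc ‖T‖ * ‖T‖ ≤ √‖T' ∘L T‖ * √‖T' ∘L T‖ := by gcongr
    _ = _ := Real.mul_self_sqrt (norm_nonneg _)

/-- From `‖T‖² ≤ ‖T'T‖ ≤ ‖T'‖ ‖T‖` one factor `‖T‖` is cancelled, unless it is zero. -/
theorem norm_le {T : X →L[ℂ] Y} {T' : Y →L[ℂ] X} (h : IsAdj A T T') : ‖T‖ ≤ ‖T'‖ := by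
  have h1 := h.norm_sq_le.trans (ContinuousLinearMap.opNorm_comp_le T' T)
  rcases (norm_nonneg T).eq_or_lt with h0 | h0
  · rw [← h0]; exact norm_nonneg _
  · exact le_of_mul_le_mul_right h1 h0

theorem norm_eq {T : X →L[ℂ] Y} {T' : Y →L[ℂ] X} (h : IsAdj A T T') : ‖T‖ = ‖T'‖ :=
  le_antisymm h.norm_le h.symm.norm_le

end IsAdj

/-! ### The C⋆-algebra of adjointable operators -/

open MulOpposite

variable (A X) in
/-- The ring of pairs of mutually adjoint operators on `X`. -/
def adjPairs : Subring ((X →L[ℂ] X) × (X →L[ℂ] X)ᵐᵒᵖ) where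
  -- The adjoint is kept as data and lives in the opposite ring because taking adjoints reverses
  -- products. The product ring then supplies the ring structure and the norm, and the star is the
  -- exchange of the two components.
  carrier := {p | IsAdj A p.1 p.2.unop}
  mul_mem' hp hq := hp.comp hq
  add_mem' hp hq := hp.add hq
  one_mem' := fun _ _ => rfl
  zero_mem' := fun x y => by
    change inner (A := A) (0 : X) y = inner x (0 : X)
    rw [inner_zero_left, inner_zero_right]
  neg_mem' {p} hp := fun x y => by
    have h1 := (hp.smul (-1)) x y
    simpa using h1

/-- For fixed `x` and `y` the adjointness condition is an equality of continuous functions of the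
pair. Completeness of `Adjointable` follows from it. -/
theorem isClosed_adjPairs : IsClosed (adjPairs A X : Set ((X →L[ℂ] X) × (X →L[ℂ] X)ᵐᵒᵖ)) := by
  have : (adjPairs A X : Set ((X →L[ℂ] X) × (X →L[ℂ] X)ᵐᵒᵖ))
      = ⋂ x, ⋂ y, {p | inner (A := A) (p.1 x) y = inner x (p.2.unop y)} := by
    ext p
    simp only [Set.mem_iInter]
    rfl
  rw [this]
  refine isClosed_iInter fun x => isClosed_iInter fun y => isClosed_eq
    (continuous_inner ?_ continuous_const) (continuous_inner continuous_const ?_)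
  · exact continuous_fst.clm_apply continuous_const
  · exact (continuous_unop.comp continuous_snd).clm_apply continuous_const

variable (A X) in
/-- The adjointable operators on the Hilbert module `X`. -/
abbrev Adjointable : Type _ := adjPairs A X

namespace Adjointable

/-- The pair of two mutually adjoint operators. -/
def mk (T T' : X →L[ℂ] X) (h : IsAdj A T T') : Adjointable A X := ⟨(T, op T'), h⟩

/-- The underlying operator. -/
def op (T : Adjointable A X) : X →L[ℂ] X := T.1.1

/-- The adjoint operator. -/
def adj (T : Adjointable A X) : X →L[ℂ] X := T.1.2.unop

theorem isAdj (T : Adjointable A X) : IsAdj A T.op T.adj := T.2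

/-- An adjoint is unique, so the second component carries no further information. -/
theorem ext {S T : Adjointable A X} (h : S.op = T.op) : S = T := by
  have h2 : S.adj = T.adj := S.isAdj.unique (h ▸ T.isAdj)
  exact Subtype.ext (Prod.ext h (unop_injective h2))

/-- A pair has the maximum norm, and mutually adjoint operators have equal norms. -/
theorem norm_eq (T : Adjointable A X) : ‖T‖ = ‖T.op‖ := by
  change max ‖T.op‖ ‖T.adj‖ = ‖T.op‖
  rw [T.isAdj.norm_eq, max_self]

instance : CompleteSpace (Adjointable A X) :=
  isClosed_adjPairs.completeSpace_coe

instance : StarRing (Adjointable A X) where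
  star T := mk T.adj T.op T.isAdj.symm
  star_involutive _ := rfl
  star_mul _ _ := rfl
  star_add _ _ := rfl

instance : CStarRing (Adjointable A X) where
  norm_mul_self_le T := by
    rw [norm_eq, norm_eq]
    exact T.isAdj.norm_sq_le

/-- Scalars act on the adjoint component through their conjugates, so this is not the algebra
structure of the product. -/
instance : Algebra ℂ (Adjointable A X) where
  smul c T := mk (c • T.op) (star c • T.adj) (T.isAdj.smul c)
  algebraMap :=
    { toFun c := mk (c • 1) (star c • 1) (IsAdj.smul (fun _ _ => rfl) c)
      map_one' := ext (one_smul _ _)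
      map_zero' := ext (zero_smul _ _)
      map_add' c d := ext (add_smul _ _ _)
      map_mul' c d := ext (by
        change (c * d) • 1 = (c • 1) * (d • 1)
        simp [smul_smul, mul_comm c]) }
  commutes' c T := ext (by
    change (c • 1) * T.op = T.op * (c • 1)
    simp)
  smul_def' c T := ext (by
    change c • T.op = (c • 1) * T.op
    simp)

instance : NormedAlgebra ℂ (Adjointable A X) where
  norm_smul_le c T := by
    rw [norm_eq, norm_eq]
    exact (norm_smul c T.op).le

instance : StarModule ℂ (Adjointable A X) where
  star_smul c T := ext (by
    change star c • T.adj = star c • T.adj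
    rfl)

noncomputable instance : CStarAlgebra (Adjointable A X) where

noncomputable instance : PartialOrder (Adjointable A X) := CStarAlgebra.spectralOrder _
instance : StarOrderedRing (Adjointable A X) := CStarAlgebra.spectralOrderedRing _

/-- An operator with nonnegative quadratic form is nonnegative. -/
theorem nonneg_of_forall_inner {T : Adjointable A X}
    (h : ∀ x, 0 ≤ inner (A := A) x (T.op x)) (hT : IsSelfAdjoint T) : 0 ≤ T := by
  -- Here `N` plays the role of the negative part of `T`: `NTN = -(RN)⋆(RN)`, and `T` is positive as
  -- soon as `RN = 0`. Evaluating the form at `Nx` gives `-⟨RNx, RNx⟩`, which the hypothesis forces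
  -- to be nonnegative, so `RNx = 0`.
  obtain ⟨N, R, hN, hdec, hpos⟩ := CStarAlgebra.exists_neg_conj hT
  have hz : R * N = 0 := by
    apply ext
    ext x
    have h1 := h (N.op x)
    have h2 : inner (A := A) (N.op x) (T.op (N.op x)) = inner x ((N * T * N).op x) := by
      have h3 : N.adj = N.op := congrArg op hN.star_eq
      rw [N.isAdj, h3]
      rfl
    have h4 : inner (A := A) x ((N * T * N).op x)
        = -inner (A := A) ((R * N).op x) ((R * N).op x) := by
      rw [hdec, (R * N).isAdj, ← neg_eq_iff_eq_neg]
      change - innerₛₗ A x (-((R * N).adj ((R * N).op x))) = _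
      rw [map_neg, neg_neg]
      rfl
    rw [h2, h4] at h1
    exact eq_zero_of_inner_self A (le_antisymm (by simpa using h1) (inner_self_nonneg _))
  obtain ⟨S, rfl⟩ := hpos hz
  exact star_mul_self_nonneg S

end Adjointable

/-! ### Square roots and polar decomposition -/

/-- `T⋆ T` has a self-adjoint square root. -/
theorem IsAdj.exists_sqrt {T : X →L[ℂ] Y} {T' : Y →L[ℂ] X} (h : IsAdj A T T') :
    ∃ N : X →L[ℂ] X, IsAdj A N N ∧ N ∘L N = T' ∘L T := by
  have hs : IsAdj A (T' ∘L T) (T' ∘L T) := h.symm.comp h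
  let M : Adjointable A X := .mk _ _ hs
  -- The quadratic form of `T'T` is `⟨x, T'Tx⟩ = ⟨Tx, Tx⟩`.
  have h0 : 0 ≤ M := Adjointable.nonneg_of_forall_inner (fun x => by
    change 0 ≤ inner (A := A) x (T' (T x))
    rw [← h]
    exact inner_self_nonneg _) rfl
  have hN := CFC.sqrt_mul_sqrt_self M h0
  have hN' : star (CFC.sqrt M) = CFC.sqrt M := (CFC.sqrt_nonneg M).isSelfAdjoint
  refine ⟨(CFC.sqrt M).op, ?_, congrArg Adjointable.op hN⟩
  have := (CFC.sqrt M).isAdj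
  rwa [show (CFC.sqrt M).adj = (CFC.sqrt M).op from congrArg Adjointable.op hN'] at this

/-- If an adjointable operator and its adjoint have dense range, the polar decomposition provides a
unitary. -/
theorem IsAdj.exists_unitary {T : X →L[ℂ] Y} {T' : Y →L[ℂ] X} (h : IsAdj A T T')
    (hT : DenseRange T) (hT' : DenseRange T') :
    ∃ V : X ≃L[ℂ] Y, ∀ x y, inner (A := A) (V x) (V y) = inner x y := by
  obtain ⟨N, hN, hNN⟩ := h.exists_sqrt
  -- The range of `N` contains that of `N² = T'T`, which is dense as a composition of maps with
  -- dense range.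
  have hd : DenseRange N := by
    have h1 : DenseRange (T' ∘L T) := hT'.comp hT T'.continuous
    rw [← hNN] at h1
    refine Dense.mono ?_ h1
    rintro _ ⟨x, rfl⟩
    exact ⟨N x, rfl⟩
  -- The unitary of the polar decomposition is `Nx ↦ Tx`. The families indexed by `x` have equal
  -- Gram matrices because `⟨Nx, Ny⟩ = ⟨x, N²y⟩ = ⟨x, T'Ty⟩ = ⟨Tx, Ty⟩`.
  obtain ⟨V, -, hV⟩ := exists_unitary_of_total (A := A) N T (Dense.mono Submodule.subset_span hd)
    (Dense.mono Submodule.subset_span hT) fun x y => by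
      rw [hN, h, ← ContinuousLinearMap.comp_apply, hNN, ContinuousLinearMap.comp_apply]
  exact ⟨V, hV⟩

end HilbertModule

/-! ### Operators on `X^∞` -/

namespace HilbertModule

variable {A X Y Z : Type*} [NonUnitalCStarAlgebra A] [PartialOrder A] [StarOrderedRing A]
  [NormedAddCommGroup X] [NormedSpace ℂ X] [CompleteSpace X] [HilbertModule A X]
  [NormedAddCommGroup Y] [NormedSpace ℂ Y] [CompleteSpace Y] [HilbertModule A Y]
  [NormedAddCommGroup Z] [NormedSpace ℂ Z] [CompleteSpace Z] [HilbertModule A Z]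

theorem sumPre_single_left (n : ℕ) (x : X) (y : ℕ →₀ X) :
    (sumPre A X).form (Finsupp.single n x) y = inner x (y n) := by
  change (Finsupp.single n x).sum (fun i v => inner v (y i)) = _
  exact Finsupp.sum_single_index (inner_zero_left A _)

variable (A X) in
/-- The inclusion of the `n`-th summand of `X^∞`. -/
noncomputable def inc (n : ℕ) : X →L[ℂ] HilbertSum A X :=
  ((sumPre A X).ι ∘ₗ Finsupp.lsingle n).mkContinuous 1 fun x => by
    rw [one_mul]
    refine (norm_eq_of_inner_self_eq (A := A) ?_).le
    exact ((sumPre A X).inner_ι _ _).trans (by simp [sumPre_single_left])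

theorem inc_apply (n : ℕ) (x : X) : inc A X n x = (sumPre A X).ι (Finsupp.single n x) := rfl

theorem inner_inc (m n : ℕ) (x y : X) :
    inner (A := A) (inc A X m x) (inc A X n y) = if m = n then inner x y else 0 := by
  rw [inc_apply, inc_apply, PreHilbert.inner_ι, sumPre_single_left]
  split_ifs with h
  · rw [h, Finsupp.single_eq_same]
  · rw [Finsupp.single_eq_of_ne h, inner_zero_right]

/-- One term `⟨x n, x n⟩` of a sum of positive elements is dominated by the whole sum. The bound
lets the coordinate map extend to the completion. -/
theorem norm_apply_le_sum (n : ℕ) (x : ℕ →₀ X) : ‖x n‖ ≤ 1 * ‖(sumPre A X).ι x‖ := by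
  rw [one_mul]
  refine (sq_le_sq₀ (norm_nonneg _) (norm_nonneg _)).1 ?_
  rw [norm_sq_eq (A := A), PreHilbert.norm_sq_ι]
  refine CStarAlgebra.norm_le_norm_of_nonneg_of_le (inner_self_nonneg _) ?_
  change _ ≤ ∑ i ∈ x.support, inner (A := A) (x i) (x i)
  by_cases h : n ∈ x.support
  · exact Finset.single_le_sum (f := fun i => inner (A := A) (x i) (x i))
      (fun i _ => inner_self_nonneg _) h
  · rw [Finsupp.notMem_support_iff.1 h, inner_zero_right]
    exact Finset.sum_nonneg fun i _ => inner_self_nonneg _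

variable (A X) in
/-- The projection to the `n`-th summand of `X^∞`. -/
noncomputable def proj (n : ℕ) : HilbertSum A X →L[ℂ] X :=
  (Finsupp.lapply n : (ℕ →₀ X) →ₗ[ℂ] X).extendOfNorm (sumPre A X).ι

theorem proj_ι (n : ℕ) (x : ℕ →₀ X) : proj A X n ((sumPre A X).ι x) = x n :=
  LinearMap.extendOfNorm_eq (sumPre A X).denseRange_ι ⟨1, norm_apply_le_sum n⟩ x

theorem norm_inc_le (n : ℕ) : ‖inc A X n‖ ≤ 1 := LinearMap.mkContinuous_norm_le _ zero_le_one _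

theorem isAdj_inc (n : ℕ) : IsAdj A (inc A X n) (proj A X n) := fun x y => by
  refine (sumPre A X).induction y (isClosed_eq (continuous_inner (by fun_prop) (by fun_prop))
    (continuous_inner (by fun_prop) (by fun_prop))) fun y => ?_
  rw [inc_apply, PreHilbert.inner_ι, sumPre_single_left, proj_ι]

theorem proj_inc (m n : ℕ) (x : X) : proj A X m (inc A X n x) = if m = n then x else 0 := by
  rw [inc_apply, proj_ι]
  split_ifs with h
  · rw [h, Finsupp.single_eq_same]
  · rw [Finsupp.single_eq_of_ne h]

/-- Finitely supported sequences are dense and are sums of vectors in single summands. Closure under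
scalars need not be assumed, since `inc A X n x` already ranges over all multiples. -/
theorem induction_sum {p : HilbertSum A X → Prop} (x : HilbertSum A X) (hp : IsClosed {x | p x})
    (h0 : p 0) (hadd : ∀ x y, p x → p y → p (x + y)) (hinc : ∀ n x, p (inc A X n x)) : p x := by
  refine (sumPre A X).induction x hp fun x => ?_
  induction x using Finsupp.induction_linear with
  | zero => rwa [map_zero]
  | add x y hx hy => rw [map_add]; exact hadd _ _ hx hy
  | single n x => exact hinc n x

theorem eq_top_of_inc_mem {S : Submodule ℂ (HilbertSum A X)} (hS : IsClosed (S : Set (HilbertSum A X)))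
    (h : ∀ n x, inc A X n x ∈ S) : S = ⊤ :=
  Submodule.eq_top_iff'.2 fun x => induction_sum (p := (· ∈ S)) x hS S.zero_mem
    (fun _ _ => S.add_mem) h

/-- Norm convergence of both series allows the adjointness relation to be summed term by term inside
the inner product. -/
theorem IsAdj.hasSum {T : X →L[ℂ] Y} {T' : Y →L[ℂ] X} {f : ℕ → X →L[ℂ] Y} {f' : ℕ → Y →L[ℂ] X}
    (hT : HasSum f T) (hT' : HasSum f' T') (h : ∀ n, IsAdj A (f n) (f' n)) : IsAdj A T T' := by
  intro x y
  have h1 : HasSum (fun n => inner (A := A) y (f n x)) (inner y (T x)) :=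
    hT.mapL ((innerL A Y y) ∘L (ContinuousLinearMap.apply ℂ Y x))
  have h2 : HasSum (fun n => inner (A := A) x (f' n y)) (inner x (T' y)) :=
    hT'.mapL ((innerL A X x) ∘L (ContinuousLinearMap.apply ℂ X y))
  have h3 := h1.star
  simp only [star_inner, h _ x y] at h3
  exact h3.unique h2

/-- The row operator `X^∞ → Z` with small entries. -/
theorem exists_row {W : ℕ → X →L[ℂ] Z} {W' : ℕ → Z →L[ℂ] X} (hW : ∀ n, IsAdj A (W n) (W' n))
    (hs : Summable fun n => ‖W n‖) :
    ∃ (R : HilbertSum A X →L[ℂ] Z) (R' : Z →L[ℂ] HilbertSum A X), IsAdj A R R' ∧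
      ∀ n x, R (inc A X n x) = W n x := by
  -- The row is `∑ W n ∘ proj n` and its adjoint is the column `∑ inc n ∘ W' n`. Both converge in
  -- norm because inclusions and projections are contractions and `‖W' n‖ = ‖W n‖`.
  have h1 : Summable fun n => W n ∘L proj A X n := by
    refine Summable.of_norm_bounded hs fun n => ?_
    calc _ ≤ ‖W n‖ * ‖proj A X n‖ := ContinuousLinearMap.opNorm_comp_le _ _
      _ ≤ ‖W n‖ * 1 := by
        gcongr
        rw [← (isAdj_inc n).norm_eq]
        exact norm_inc_le n
      _ = _ := mul_one _
  have h2 : Summable fun n => inc A X n ∘L W' n := by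
    refine Summable.of_norm_bounded hs fun n => ?_
    calc _ ≤ ‖inc A X n‖ * ‖W' n‖ := ContinuousLinearMap.opNorm_comp_le _ _
      _ ≤ 1 * ‖W' n‖ := by
        gcongr
        exact norm_inc_le n
      _ = _ := by rw [one_mul, (hW n).norm_eq]
  refine ⟨_, _, IsAdj.hasSum h1.hasSum h2.hasSum fun n => (hW n).comp (isAdj_inc n).symm,
    fun n x => ?_⟩
  have h3 := h1.hasSum.mapL (ContinuousLinearMap.apply ℂ Z (inc A X n x))
  refine h3.unique ?_
  convert hasSum_single n ?_ using 1
  · simp [proj_inc]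
  · intro m hm
    simp [proj_inc, hm]

/-! ### Sweeping one module out by another -/

variable (A X Y) in
/-- The ranges of countably many adjointable contractions `X → Y` span a dense subspace of `Y`. -/
def IsSwept : Prop :=
  ∃ (Q : ℕ → X →L[ℂ] Y) (Q' : ℕ → Y →L[ℂ] X), (∀ n, IsAdj A (Q n) (Q' n)) ∧ (∀ n, ‖Q n‖ ≤ 1) ∧
    ∀ S : Submodule ℂ Y, IsClosed (S : Set Y) → (∀ n x, Q n x ∈ S) → S = ⊤

/-- A countable set of adjointable operators can be enumerated and rescaled to contractions without
changing the span of the ranges. -/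
theorem isSwept_of_countable {𝒬 : Set (X →L[ℂ] Y)} (hc : 𝒬.Countable)
    (ha : ∀ T ∈ 𝒬, ∃ T', IsAdj A T T')
    (h : ∀ S : Submodule ℂ Y, IsClosed (S : Set Y) → (∀ T ∈ 𝒬, ∀ x, T x ∈ S) → S = ⊤) :
    IsSwept A X Y := by
  -- Inserting `0` makes the set nonempty, so that it is the range of a sequence.
  obtain ⟨Q, hQ⟩ := (hc.insert 0).exists_eq_range (Set.insert_nonempty _ _)
  have hex : ∀ n, ∃ T', IsAdj A (Q n) T' := fun n => by
    have : Q n ∈ insert 0 𝒬 := hQ ▸ Set.mem_range_self n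
    rcases this with h0 | h0
    · rw [h0]
      exact ⟨0, fun x y => by
        change inner (A := A) (0 : Y) y = inner x (0 : X)
        rw [inner_zero_left, inner_zero_right]⟩
    · exact ha _ h0
  choose Q' hQ' using hex
  -- For `Q n = 0` the factor is `0⁻¹ = 0`, which does no harm.
  refine ⟨fun n => ((‖Q n‖⁻¹ : ℝ) : ℂ) • Q n, fun n => star ((‖Q n‖⁻¹ : ℝ) : ℂ) • Q' n,
    fun n => (hQ' n).smul _, fun n => ?_, fun S hS hmem => h S hS fun T hT x => ?_⟩
  · rw [norm_smul, Complex.norm_real, norm_inv, norm_norm]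
    exact inv_mul_le_one
  · have hT' : T ∈ Set.range Q := hQ ▸ Set.mem_insert_of_mem _ hT
    obtain ⟨n, rfl⟩ := hT'
    by_cases h0 : Q n = 0
    · simp [h0]
    · have h1 := S.smul_mem (‖Q n‖ : ℂ) (hmem n x)
      rw [smul_apply, smul_smul, ← Complex.ofReal_mul,
        mul_inv_cancel₀ (norm_ne_zero_iff.2 h0), Complex.ofReal_one, one_smul] at h1
      exact h1

/-- The operators `X → Y` followed by the inclusions of the summands form a family indexed by `ℕ ×
ℕ`. Thus it suffices to sweep out a single summand. -/
theorem IsSwept.sum (h : IsSwept A X Y) : IsSwept A X (HilbertSum A Y) := by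
  obtain ⟨Q, Q', hQ, -, hd⟩ := h
  refine isSwept_of_countable
    (𝒬 := Set.range fun p : ℕ × ℕ => inc A Y p.1 ∘L Q p.2) (Set.countable_range _) ?_ ?_
  · rintro _ ⟨p, rfl⟩
    exact ⟨_, (isAdj_inc p.1).comp (hQ p.2)⟩
  · intro S hS hmem
    refine eq_top_of_inc_mem hS fun n y => ?_
    have h1 := hd (S.comap (inc A Y n).toLinearMap) (hS.preimage (inc A Y n).continuous)
      fun m x => hmem _ ⟨(n, m), rfl⟩ x
    have h2 : y ∈ S.comap (inc A Y n).toLinearMap := h1 ▸ Submodule.mem_top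
    exact h2

/-- A perturbation of an operator `X^∞ → Z` with dense range that has dense range together
with a diagonal operator. -/
theorem IsSwept.exists_row_diag (h : IsSwept A X Z) :
    ∃ (R : HilbertSum A X →L[ℂ] Z) (R' : Z →L[ℂ] HilbertSum A X)
      (D : HilbertSum A X →L[ℂ] HilbertSum A X), IsAdj A R R' ∧ IsAdj A D D ∧ DenseRange D ∧
      DenseRange (R.prod D) := by
  obtain ⟨Q, Q', hQ, hn, hd⟩ := h
  -- On the `n`-th summand `R` has weight `c n` and `D` has weight `c n * c n`. Both sequences are
  -- summable, and after division by `c n` the component in `D` still tends to zero. The index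
  -- `n.unpair.1` makes every `Q m` occur in infinitely many summands.
  let c : ℕ → ℂ := fun n => ((1 / 2 : ℝ) ^ n : ℝ)
  have hc : ∀ n, ‖c n‖ = (1 / 2 : ℝ) ^ n := fun n => by
    rw [Complex.norm_real, Real.norm_of_nonneg (by positivity)]
  have hc0 : ∀ n, c n ≠ 0 := fun n => norm_pos_iff.1 (by rw [hc]; positivity)
  have hcs : ∀ n, star (c n) = c n := fun n => Complex.conj_ofReal _
  have hsum : Summable fun n : ℕ => (1 / 2 : ℝ) ^ n :=
    summable_geometric_of_lt_one (by norm_num) (by norm_num)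
  obtain ⟨R, R', hR, hRi⟩ := exists_row (A := A) (W := fun n => c n • Q n.unpair.1)
    (W' := fun n => star (c n) • Q' n.unpair.1) (fun n => (hQ _).smul _)
    (Summable.of_nonneg_of_le (fun _ => norm_nonneg _) (fun n => by
      rw [norm_smul, hc]
      exact mul_le_of_le_one_right (by positivity) (hn _)) hsum)
  obtain ⟨D, D', hD, hDi⟩ := exists_row (A := A) (W := fun n => (c n * c n) • inc A X n)
    (W' := fun n => star (c n * c n) • proj A X n) (fun n => (isAdj_inc n).smul _)
    (Summable.of_nonneg_of_le (fun _ => norm_nonneg _) (fun n => by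
      rw [norm_smul, norm_mul, hc]
      calc (1 / 2 : ℝ) ^ n * (1 / 2) ^ n * ‖inc A X n‖ ≤ (1 / 2) ^ n * 1 * 1 := by
            gcongr
            · exact pow_le_one₀ (by norm_num) (by norm_num)
            · exact norm_inc_le n
        _ = _ := by ring) hsum)
  -- On summands this reduces to the orthogonality of distinct summands and the reality of the
  -- weights.
  have hDD : IsAdj A D D := by
    intro x y
    refine induction_sum (p := fun x => inner (A := A) (D x) y = inner x (D y)) x
      (isClosed_eq (continuous_inner (by fun_prop) (by fun_prop))
        (continuous_inner (by fun_prop) (by fun_prop)))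
      (by simp only [map_zero, inner_zero_left])
      (fun x x' hx hx' => by simp only [map_add, inner_add_left, hx, hx']) fun m x => ?_
    refine induction_sum (p := fun y => inner (A := A) (D (inc A X m x)) y
        = inner (inc A X m x) (D y)) y
      (isClosed_eq (continuous_inner (by fun_prop) (by fun_prop))
        (continuous_inner (by fun_prop) (by fun_prop)))
      (by simp only [map_zero, inner_zero_right])
      (fun y y' hy hy' => by simp only [map_add, inner_add_right, hy, hy']) fun n y => ?_
    rw [hDi, hDi, smul_apply, smul_apply, inner_smul_left, inner_smul_right, inner_inc, star_mul',
      hcs]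
    split_ifs with hmn
    · rw [hmn]
    · rw [smul_zero, smul_zero]
  refine ⟨R, R', D, hR, hDD, ?_, ?_⟩
  · have h1 : (LinearMap.range D.toLinearMap).topologicalClosure = ⊤ :=
      eq_top_of_inc_mem (Submodule.isClosed_topologicalClosure _) fun n x => by
        refine Submodule.le_topologicalClosure _ ⟨(c n * c n)⁻¹ • inc A X n x, ?_⟩
        change D _ = _
        rw [map_smul, hDi, smul_apply, smul_smul,
          inv_mul_cancel₀ (mul_ne_zero (hc0 n) (hc0 n)), one_smul]
    exact (Submodule.dense_iff_topologicalClosure_eq_top).2 h1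
  -- The closed range `M` contains `(Q n x, c m • inc m x)` for every `m = Nat.pair n k`. Letting `k
  -- → ∞` puts `(Q n x, 0)` into `M`, hence all of `Z × 0` by sweeping. Subtracting such vectors and
  -- dividing by `c m` puts `0 × X^∞` into `M` as well.
  · let M := (LinearMap.range (R.prod D).toLinearMap).topologicalClosure
    have hMc : IsClosed (M : Set (Z × HilbertSum A X)) := Submodule.isClosed_topologicalClosure _
    have h1 : ∀ n x, (Q n.unpair.1 x, c n • inc A X n x) ∈ M := fun n x => by
      refine Submodule.le_topologicalClosure _ ⟨(c n)⁻¹ • inc A X n x, ?_⟩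
      change (R _, D _) = _
      rw [map_smul, map_smul, hRi, hDi, smul_apply, smul_apply, smul_smul, smul_smul,
        ← mul_assoc, inv_mul_cancel₀ (hc0 n), one_smul, one_mul]
    have h2 : ∀ n x, (Q n x, (0 : HilbertSum A X)) ∈ M := fun n x => by
      have ht : Filter.Tendsto (fun k => (Q n x, c (Nat.pair n k) • inc A X (Nat.pair n k) x))
          Filter.atTop (nhds (Q n x, (0 : HilbertSum A X))) := by
        refine tendsto_const_nhds.prodMk_nhds ?_
        have hk : Filter.Tendsto (fun k : ℕ => (1 / 2 : ℝ) ^ k * ‖x‖) Filter.atTop (nhds 0) := by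
          have := (tendsto_pow_atTop_nhds_zero_of_lt_one (r := (1 / 2 : ℝ)) (by norm_num)
            (by norm_num)).mul_const ‖x‖
          rwa [zero_mul] at this
        refine squeeze_zero_norm (fun k => ?_) hk
        -- Since `k ≤ Nat.pair n k`, the weight is at most `2⁻ᵏ`.
        rw [norm_smul, hc]
        refine mul_le_mul (pow_le_pow_of_le_one (by norm_num) (by norm_num)
          (Nat.right_le_pair n k)) ?_ (norm_nonneg _) (by positivity)
        exact ((inc A X _).le_of_opNorm_le (norm_inc_le _) x).trans (one_mul _).le
      refine hMc.mem_of_tendsto ht (Filter.Eventually.of_forall fun k => ?_)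
      have := h1 (Nat.pair n k) x
      rwa [Nat.unpair_pair] at this
    have h3 : ∀ z, (z, (0 : HilbertSum A X)) ∈ M := by
      have := hd (M.comap (LinearMap.inl ℂ Z (HilbertSum A X)))
        (hMc.preimage (Continuous.prodMk_left 0)) h2
      intro z
      have hz : z ∈ M.comap (LinearMap.inl ℂ Z (HilbertSum A X)) := this ▸ Submodule.mem_top
      exact hz
    have h4 : ∀ x, ((0 : Z), x) ∈ M := by
      have := eq_top_of_inc_mem (S := M.comap (LinearMap.inr ℂ Z (HilbertSum A X)))
        (hMc.preimage (Continuous.prodMk_right 0)) fun n x => by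
          have h5 := M.smul_mem (c n)⁻¹ (M.sub_mem (h1 n x) (h3 (Q n.unpair.1 x)))
          rw [Prod.mk_sub_mk, sub_self, sub_zero, Prod.smul_mk, smul_zero, smul_smul,
            inv_mul_cancel₀ (hc0 n), one_smul] at h5
          exact h5
      intro x
      have hx : x ∈ M.comap (LinearMap.inr ℂ Z (HilbertSum A X)) := this ▸ Submodule.mem_top
      exact hx
    have hM : M = ⊤ := by
      refine Submodule.eq_top_iff'.2 fun p => ?_
      have h5 := M.add_mem (h3 p.1) (h4 p.2)
      rw [Prod.mk_add_mk, add_zero, zero_add] at h5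
      exact h5
    exact (Submodule.dense_iff_topologicalClosure_eq_top).2 hM

/-- If `X` and `Y` sweep out each other then `X^∞` and `Y^∞` are unitarily equivalent. -/
theorem IsSwept.exists_unitary (hXY : IsSwept A X Y) (hYX : IsSwept A Y X) :
    ∃ V : HilbertSum A X ≃L[ℂ] HilbertSum A Y,
      ∀ x y, inner (A := A) (V x) (V y) = inner x y := by
  obtain ⟨R, R', D, hR, hD, hDd, hRD⟩ := hXY.sum.exists_row_diag
  obtain ⟨S, S', C, hS, hC, hCd, hSC⟩ := hYX.sum.exists_row_diag
  -- The operator factors as `(C, S')` after the column `(R, D)`, and its adjoint as `(D, R')` after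
  -- the column `(S, C)`. The columns have dense range by construction. The rows have dense range
  -- because the diagonal operators `C` and `D` already do.
  have h1 : IsAdj A (C ∘L R + S' ∘L D) (R' ∘L C + D ∘L S) := (hC.comp hR).add (hS.symm.comp hD)
  refine h1.exists_unitary ?_ ?_
  · have h2 : DenseRange (C.coprod S') := hCd.mono (by
      rintro _ ⟨x, rfl⟩
      exact ⟨(x, 0), by simp⟩)
    have h3 := h2.comp hRD (C.coprod S').continuous
    exact h3
  · have h2 : DenseRange (D.coprod R') := hDd.mono (by
      rintro _ ⟨x, rfl⟩
      exact ⟨(x, 0), by simp⟩)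
    have h3 := h2.comp hSC (D.coprod R').continuous
    rw [add_comm]
    exact h3

end HilbertModule

/-! ### Countably generated full Hilbert modules -/

namespace HilbertModule

variable {A X : Type*} [NonUnitalCStarAlgebra A] [PartialOrder A] [StarOrderedRing A]
  [NormedAddCommGroup X] [NormedSpace ℂ X] [CompleteSpace X] [HilbertModule A X]

theorem norm_rsmul_le (x : X) (a : A) : ‖rsmul x a‖ ≤ ‖x‖ * ‖a‖ := by
  refine (sq_le_sq₀ (norm_nonneg _) (by positivity)).1 ?_
  rw [norm_sq_eq (A := A), inner_rsmul_right, inner_rsmul_left, mul_pow, norm_sq_eq (A := A) x]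
  calc ‖star a * inner x x * a‖ ≤ ‖star a‖ * ‖inner (A := A) x x‖ * ‖a‖ :=
        (norm_mul_le _ _).trans (by gcongr; exact norm_mul_le _ _)
    _ = _ := by rw [norm_star]; ring

variable (A) in
/-- The operator `a ↦ x a` from `A` to `X`. -/
noncomputable def ket (x : X) : A →L[ℂ] X :=
  LinearMap.mkContinuous
    { toFun a := rsmul x a
      map_add' a b := rsmul_add x a b
      map_smul' c a := rsmul_smul c x a } ‖x‖ (norm_rsmul_le x)

theorem ket_apply (x : X) (a : A) : ket A x a = rsmul x a := rfl

/-- This single adjoint pair provides the sweeping operators in both directions: `a ↦ xa` from `A`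
to `X` and `y ↦ ⟨x, y⟩` back. -/
theorem isAdj_ket (x : X) : IsAdj A (ket A x) (innerL A X x) := fun a y => by
  rw [ket_apply, inner_rsmul_left]
  rfl

theorem IsCountablyGenerated.isSwept (h : IsCountablyGenerated A X) : IsSwept A A X := by
  obtain ⟨S, hS, hd⟩ := h
  refine isSwept_of_countable (hS.image (ket A)) ?_ fun M hM hmem => ?_
  · rintro _ ⟨x, -, rfl⟩
    exact ⟨_, isAdj_ket x⟩
  · have hle : Submodule.span ℂ {y : X | ∃ x ∈ S, ∃ a : A, y = rsmul x a} ≤ M := by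
      refine Submodule.span_le.2 ?_
      rintro _ ⟨x, hx, a, rfl⟩
      exact hmem _ ⟨x, hx, rfl⟩ a
    exact SetLike.coe_injective ((hM.closure_eq.symm.trans (hd.mono hle).closure_eq))

/-- The point is the limit of a sequence in the span, and each term of the sequence involves only
finitely many vectors. -/
theorem exists_countable_mem_closure_span {V : Type*} [NormedAddCommGroup V] [NormedSpace ℂ V]
    {B : Set V} {x : V} (hx : x ∈ closure (Submodule.span ℂ B : Set V)) :
    ∃ C ⊆ B, C.Countable ∧ x ∈ closure (Submodule.span ℂ C : Set V) := by
  obtain ⟨u, hu, hlim⟩ := mem_closure_iff_seq_limit.1 hx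
  choose T hTB hT using fun n => Submodule.mem_span_finite_of_mem_span (hu n)
  refine ⟨⋃ n, T n, Set.iUnion_subset hTB, Set.countable_iUnion fun n => (T n).countable_toSet,
    mem_closure_of_tendsto hlim (Filter.Eventually.of_forall fun n => ?_)⟩
  exact Submodule.span_mono (Set.subset_iUnion (fun n => (T n : Set V)) n) (hT n)

/-- Fullness provides all inner products, but only countably many operators are allowed. The
strictly positive element `k` is a limit of combinations of countably many inner products `⟨x, y⟩`,
and the maps `z ↦ ⟨x, z⟩` for these suffice. A closed subspace containing their ranges contains each
`⟨x, ya⟩ = ⟨x, y⟩a`, hence `ka` for all `a`, hence everything. -/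
theorem IsFull.isSwept (h : IsFull A X) (hA : HasStrictlyPositiveElement A) :
    IsSwept A X A := by
  obtain ⟨k, -, hk⟩ := hA
  obtain ⟨C, hCB, hC, hkC⟩ := exists_countable_mem_closure_span (h k)
  have hex : ∀ c ∈ C, ∃ x y : X, c = inner x y := fun c hc => hCB hc
  choose! f g hfg using hex
  refine isSwept_of_countable (hC.image fun c => innerL A X (f c)) ?_ fun M hM hmem => ?_
  · rintro _ ⟨c, -, rfl⟩
    exact ⟨_, (isAdj_ket (f c)).symm⟩
  · have h1 : ∀ a : A, k * a ∈ M := by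
      intro a
      have hle : Submodule.span ℂ C ≤ M.comap (LinearMap.mulRight ℂ a) := by
        refine Submodule.span_le.2 fun c hc => ?_
        have h2 := hmem _ ⟨c, hc, rfl⟩ (rsmul (g c) a)
        rw [innerL_apply, inner_rsmul_right, ← hfg c hc] at h2
        exact h2
      have hcl : IsClosed (M.comap (LinearMap.mulRight ℂ a) : Set A) :=
        hM.preimage (continuous_mul_const a)
      exact (closure_minimal hle hcl) hkC
    have h2 : Set.range (fun a : A => k * a) ⊆ M := by
      rintro _ ⟨a, rfl⟩
      exact h1 a
    exact SetLike.coe_injective (hM.closure_eq.symm.trans (hk.mono h2).closure_eq)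

/-- If `A` is `σ`-unital and `X` is countably generated and full then `X^∞` and `A^∞` are
unitarily equivalent. -/
theorem IsFull.exists_unitary (h : IsFull A X) (hX : IsCountablyGenerated A X)
    (hA : HasStrictlyPositiveElement A) :
    ∃ V : HilbertSum A X ≃L[ℂ] HilbertSum A A,
      ∀ x y, inner (A := A) (V x) (V y) = inner x y :=
  (h.isSwept hA).exists_unitary hX.isSwept

end HilbertModule

/-! ### Equivariant unitaries -/

namespace GHilbertIso

open HilbertModule

variable {G A X Y Z : Type*} [InverseSemigroup G] [NonUnitalCStarAlgebra A] [PartialOrder A]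
  [StarOrderedRing A] [GAlgebra G A]
  [NormedAddCommGroup X] [NormedSpace ℂ X] [CompleteSpace X] [HilbertModule A X]
  [GHilbertModule G A X]
  [NormedAddCommGroup Y] [NormedSpace ℂ Y] [CompleteSpace Y] [HilbertModule A Y]
  [GHilbertModule G A Y]
  [NormedAddCommGroup Z] [NormedSpace ℂ Z] [CompleteSpace Z] [HilbertModule A Z]
  [GHilbertModule G A Z]

/-- Total families with the same Gram matrix that `G` permutes in the same way are related by an
equivariant unitary. -/
theorem nonempty_of_total {I : Type*} (v : I → X) (w : I → Y) (σ : G → I → I)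
    (hv : Dense (Submodule.span ℂ (Set.range v) : Set X))
    (hw : Dense (Submodule.span ℂ (Set.range w) : Set Y))
    (h : ∀ i j, HilbertModule.inner (A := A) (v i) (v j) = HilbertModule.inner (w i) (w j))
    (hσv : ∀ g i, GHilbertModule.U (A := A) g (v i) = v (σ g i))
    (hσw : ∀ g i, GHilbertModule.U (A := A) g (w i) = w (σ g i)) :
    Nonempty (GHilbertIso G A X Y) := by
  obtain ⟨T, hT, hin⟩ := exists_unitary_of_total (A := A) v w hv hw h
  refine ⟨{ T.toLinearEquiv with
    map_rsmul := map_rsmul_of_inner_map T.surjective hin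
    inner_map := hin
    map_U := fun g => ?_ }⟩
  -- Equivariance is an equality of bounded operators, so it is enough to check it on the total
  -- family `v`.
  change ∀ x, (T.toContinuousLinearMap ∘L GHilbertModule.UL A X g) x
    = (GHilbertModule.UL A Y g ∘L T.toContinuousLinearMap) x
  refine DFunLike.congr_fun (ContinuousLinearMap.ext_on hv ?_)
  rintro _ ⟨i, rfl⟩
  change T (GHilbertModule.U (A := A) g (v i)) = GHilbertModule.U (A := A) g (T (v i))
  rw [hσv, hT, hT, hσw]

theorem nonempty_symm (e : GHilbertIso G A X Y) : Nonempty (GHilbertIso G A Y X) := by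
  have hs : ∀ y, e.toFun (e.toLinearEquiv.symm y) = y := e.toLinearEquiv.apply_symm_apply
  have hi : Function.Injective e.toFun := e.toLinearEquiv.injective
  exact ⟨{ e.toLinearEquiv.symm with
    map_rsmul := fun y a => hi (by
      rw [e.map_rsmul]
      exact (hs _).trans (congrArg (fun z => rsmul z a) (hs y).symm))
    inner_map := fun x y => (e.inner_map _ _).symm.trans
      (congrArg₂ (fun z w => HilbertModule.inner (A := A) z w) (hs x) (hs y))
    map_U := fun g y => hi (by
      rw [e.map_U]
      exact (hs _).trans (congrArg (fun z => GHilbertModule.U (A := A) g z) (hs y).symm)) }⟩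

theorem nonempty_trans (e : GHilbertIso G A X Y) (f : GHilbertIso G A Y Z) :
    Nonempty (GHilbertIso G A X Z) :=
  ⟨{ e.toLinearEquiv.trans f.toLinearEquiv with
    map_rsmul := fun x a => (congrArg f.toFun (e.map_rsmul x a)).trans (f.map_rsmul _ a)
    inner_map := fun x y => (f.inner_map _ _).trans (e.inner_map x y)
    map_U := fun g x => (congrArg f.toFun (e.map_U g x)).trans (f.map_U g _) }⟩

end GHilbertIso

open InverseSemigroup HilbertModule GHilbertModule
open scoped ZeroAtInfty TensorProduct

/-! ### Vectors of `L²(G, X)` -/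

section SpecRep

variable {G A X : Type*} [InverseSemigroup G] [NonUnitalCStarAlgebra A]
  [PartialOrder A] [StarOrderedRing A] [GAlgebra G A]
  [NormedAddCommGroup X] [NormedSpace ℂ X] [CompleteSpace X] [HilbertModule A X]
  [GHilbertModule G A X]

/-- A vector that is annihilated by all `U_e` with `e g = e h`, `e ≤ gg⁻¹hh⁻¹` is annihilated by
`⟨φ_g, φ_h⟩`. -/
theorem specRep_ellKer_eq_zero [EContinuous G] (g h : G) {z : X}
    (hz : ∀ e ∈ kerSet g h, U (A := A) e.val z = 0) : specRep G A X (ellKer g h) z = 0 := by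
  classical
  -- Finite joins of the `1_e` annihilate `z`, by induction along `j ∨ 1_e = j + 1_e - 1_e j`.
  have hfin : ∀ F : Finset (Idem G), (∀ e ∈ F, e ∈ kerSet g h) →
      ∃ j : C₀(SpecE G, ℂ), specRep G A X j z = 0 ∧
        ∀ χ : SpecE G, j χ = if ∃ e ∈ F, χ.toFun e = true then 1 else 0 := by
    intro F
    induction F using Finset.induction_on with
    | empty => exact fun _ => ⟨0, by simp, fun χ => by simp⟩
    | insert e F _ ih =>
      intro hF
      obtain ⟨j, hj, hjv⟩ := ih fun f hf => hF f (Finset.mem_insert_of_mem hf)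
      refine ⟨j + (SpecE.ind e - SpecE.ind e * j), ?_, fun χ => ?_⟩
      · have hm := (specHRep G A X).op_mul (SpecE.ind e) j z
        change specRep G A X (SpecE.ind e * j) z = specRep G A X _ (specRep G A X j z) at hm
        rw [map_add, map_sub, add_apply, sub_apply, hm, hj, specRep_ind,
          hz e (hF e (Finset.mem_insert_self _ _)), map_zero, sub_zero, add_zero]
      · have hval : (j + (SpecE.ind e - SpecE.ind e * j)) χ
            = j χ + ((if χ.toFun e = true then 1 else 0)
              - (if χ.toFun e = true then 1 else 0) * j χ) := rfl
        rw [hval, hjv]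
        by_cases h1 : χ.toFun e = true <;> by_cases h2 : ∃ f ∈ F, χ.toFun f = true <;>
          simp_all
  -- The join `ellKer g h` takes only the values `0` and `1` and is continuous and small outside a
  -- compact set. Its support is therefore compact and is covered by finitely many of the carriers,
  -- so it equals a finite join. This is the point where membership of the supremum in `C₀(X)`
  -- matters.
  obtain ⟨K, hK, hKs⟩ := Filter.mem_cocompact.1
    ((ellKer g h).zero_at_infty'.eventually (Metric.ball_mem_nhds 0 one_pos))
  have hc : IsCompact (K ∩ {χ | ellKer g h χ = 1}) :=
    hK.inter_right (isClosed_eq (ellKer g h).continuous continuous_const)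
  obtain ⟨F, hFs, hF⟩ := hc.elim_finite_subcover_image (b := kerSet g h)
    (c := fun e => {χ : SpecE G | χ.toFun e = true})
    (fun e _ => (SpecE.isClopen_carrier e).isOpen) fun χ hχ => by
      by_contra hn
      have h1 : ellKer g h χ = 0 := ellKer_neg fun ⟨e, he, heχ⟩ =>
        hn (Set.mem_biUnion he heχ)
      exact one_ne_zero (hχ.2.symm.trans h1)
  obtain ⟨j, hj, hjv⟩ := hfin hF.1.toFinset fun e he => hFs (by simpa using he)
  suffices hsuff : ellKer g h = j by rw [hsuff, hj]
  ext χ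
  rw [hjv]
  by_cases H : ∃ e ∈ kerSet g h, χ.toFun e = true
  · have h1 := ellKer_pos H
    have h2 : χ ∈ K := by
      by_contra hn
      have := hKs hn
      change (ellKer g h χ) ∈ Metric.ball (0 : ℂ) 1 at this
      rw [h1] at this
      simp at this
    obtain ⟨e, he, heχ⟩ := Set.mem_iUnion₂.1 (hF.2 ⟨h2, h1⟩)
    rw [h1, if_pos ⟨e, by simpa using he, heχ⟩]
  · rw [ellKer_neg H, if_neg]
    rintro ⟨e, he, heχ⟩
    exact H ⟨e, hFs (by simpa using he), heχ⟩

theorem specRep_mul (f f' : C₀(SpecE G, ℂ)) (x : X) :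
    specRep G A X (f * f') x = specRep G A X f (specRep G A X f' x) :=
  (specHRep G A X).op_mul f f' x

-- Indeed `⟨φ_g, φ_h⟩` lies under `1_{gg⁻¹}`, so the range of its operator is fixed by `gg⁻¹`.
variable (A) in
theorem U_ran_specRep_ellKer [EContinuous G] (g h : G) (x : X) :
    U (A := A) (g * g⁻¹) (specRep G A X (ellKer g h) x) = specRep G A X (ellKer g h) x := by
  have h1 := specRep_mul (A := A) (SpecE.ind (Idem.ran g)) (ellKer g h) x
  rw [EllHat2.ran_ellKer', specRep_ind] at h1
  exact h1.symm

/-- Both sides are linear and continuous in `f`, and for `f = 1_e` the action of `e` on `X^∞` is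
componentwise. -/
theorem specRep_inc (f : C₀(SpecE G, ℂ)) (n : ℕ) (x : X) :
    specRep G A (HilbertSum A X) f (inc A X n x) = inc A X n (specRep G A X f x) := by
  refine specRep_induction (p := fun f => specRep G A (HilbertSum A X) f (inc A X n x)
    = inc A X n (specRep G A X f x)) f (isClosed_eq (by fun_prop) (by fun_prop)) ?_ ?_ ?_ ?_
  · simp
  · intro f f' h h'
    simp only [map_add, add_apply, h, h']
  · intro c f h
    simp only [map_smul, smul_apply, h]
  · intro e
    rw [specRep_ind, specRep_ind, inc_apply]
    refine ((sumAction A X G).extend_T e.val _).trans ?_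
    rw [inc_apply]
    congr 1
    exact Finsupp.mapRange_single (hf := map_zero _)

theorem U_inc (g : G) (n : ℕ) (x : X) :
    U (A := A) g (inc A X n x) = inc A X n (U (A := A) g x) := by
  rw [inc_apply, inc_apply]
  refine ((sumAction A X G).extend_T g _).trans ?_
  congr 1
  exact Finsupp.mapRange_single (hf := map_zero _)

/-! ### Translates of a unitary -/

variable {Y : Type*} [NormedAddCommGroup Y] [NormedSpace ℂ Y] [CompleteSpace Y]
  [HilbertModule A Y] [GHilbertModule G A Y]

/-- A unitary commutes with the idempotents of `G`. -/
theorem map_U_idem {u : X ≃L[ℂ] Y}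
    (hu : ∀ x y, HilbertModule.inner (A := A) (u x) (u y) = HilbertModule.inner x y)
    {e : G} (he : e * e = e) (x : X) : u (U (A := A) e x) = U (A := A) e (u x) := by
  apply ext_inner A
  intro z
  obtain ⟨z, rfl⟩ := u.surjective z
  -- The relation `⟨z, U_e x⟩ = α_e(⟨z, x⟩)` determines `U_e` by the inner product alone, so every
  -- unitary respects it.
  rw [hu, inner_U_idem he, inner_U_idem he, hu]

variable (G A) in
/-- The translate `g u g⁻¹` of an operator. -/
noncomputable def conjOp (u : X →L[ℂ] Y) (g : G) : X →L[ℂ] Y :=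
  UL A Y g ∘L u ∘L UL A X g⁻¹

theorem conjOp_apply (u : X →L[ℂ] Y) (g : G) (x : X) :
    conjOp G A u g x = U (A := A) g (u (U (A := A) g⁻¹ x)) := rfl

/-- The idempotent is moved through in three steps: `g⁻¹e = (g⁻¹eg)g⁻¹`, then `u` commutes with the
idempotent `g⁻¹eg`, and finally `g(g⁻¹eg) = eg`. -/
theorem conjOp_U_idem {u : X ≃L[ℂ] Y}
    (hu : ∀ x y, HilbertModule.inner (A := A) (u x) (u y) = HilbertModule.inner x y)
    (g : G) (e : Idem G) (x : X) :
    conjOp G A (u : X →L[ℂ] Y) g (U (A := A) e.val x)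
      = U (A := A) e.val (conjOp G A (u : X →L[ℂ] Y) g x) := by
  have h1 : g⁻¹ * e.val = g⁻¹ * e.val * g * g⁻¹ := by
    have := mul_idem_eq g⁻¹ e.idem
    rwa [inv_inv'] at this
  have h2 : (g⁻¹ * e.val * g) * (g⁻¹ * e.val * g) = g⁻¹ * e.val * g := by
    have := conj_idem g⁻¹ e.idem
    rwa [inv_inv'] at this
  have h3 : g * (g⁻¹ * e.val * g) = e.val * g := by
    calc g * (g⁻¹ * e.val * g) = (g * g⁻¹ * e.val) * g := by simp only [mul_assoc]
      _ = e.val * (g * g⁻¹ * g) := by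
        rw [idem_comm (mul_inv_idem g) e.idem]; simp only [mul_assoc]
      _ = e.val * g := by rw [mul_inv_mul]
  rw [conjOp_apply, conjOp_apply, ← U_mul g⁻¹, h1, U_mul _ g⁻¹, ContinuousLinearEquiv.coe_coe,
    map_U_idem hu h2, ← U_mul, h3, U_mul]

/-- In `(kg)u(kg)⁻¹k = kg u g⁻¹(k⁻¹k)` the factor `k⁻¹k` is not the identity but an idempotent. It
passes through the translate of `u` and is absorbed by `k`. -/
theorem conjOp_U {u : X ≃L[ℂ] Y}
    (hu : ∀ x y, HilbertModule.inner (A := A) (u x) (u y) = HilbertModule.inner x y)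
    (k g : G) (x : X) :
    conjOp G A (u : X →L[ℂ] Y) (k * g) (U (A := A) k x)
      = U (A := A) k (conjOp G A (u : X →L[ℂ] Y) g x) := by
  have h1 : U (A := A) (k * g)⁻¹ (U (A := A) k x)
      = U (A := A) g⁻¹ (U (A := A) (k⁻¹ * k) x) := by
    rw [← U_mul, ← U_mul, mul_inv_rev', mul_assoc]
  have h2 := conjOp_U_idem hu g ⟨k⁻¹ * k, inv_mul_idem k⟩ x
  rw [conjOp_apply, h1, U_mul, ← conjOp_apply, h2, ← U_mul, ← mul_assoc, mul_inv_mul]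

/-- Commutation with the idempotents extends to `C₀(X)`, because the `1_e` span a dense subspace. -/
theorem conjOp_specRep {u : X ≃L[ℂ] Y}
    (hu : ∀ x y, HilbertModule.inner (A := A) (u x) (u y) = HilbertModule.inner x y)
    (g : G) (f : C₀(SpecE G, ℂ)) (x : X) :
    conjOp G A (u : X →L[ℂ] Y) g (specRep G A X f x)
      = specRep G A Y f (conjOp G A (u : X →L[ℂ] Y) g x) := by
  refine specRep_induction (p := fun f => conjOp G A (u : X →L[ℂ] Y) g (specRep G A X f x)
    = specRep G A Y f (conjOp G A (u : X →L[ℂ] Y) g x)) f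
    (isClosed_eq (by fun_prop) (by fun_prop)) ?_ ?_ ?_ ?_
  · simp
  · intro f f' h h'
    simp only [map_add, add_apply, h, h']
  · intro c f h
    simp only [map_smul, smul_apply, h]
  · intro e
    rw [specRep_ind, specRep_ind, conjOp_U_idem hu]

/-- The translate is in general not a unitary, only a partial isometry with initial projection
`U_{gg⁻¹}`. -/
theorem inner_conjOp {u : X ≃L[ℂ] Y}
    (hu : ∀ x y, HilbertModule.inner (A := A) (u x) (u y) = HilbertModule.inner x y)
    (g : G) (x y : X) :
    HilbertModule.inner (A := A) (conjOp G A (u : X →L[ℂ] Y) g x)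
      (conjOp G A (u : X →L[ℂ] Y) g y) = HilbertModule.inner x (U (A := A) (g * g⁻¹) y) := by
  rw [conjOp_apply, conjOp_apply, inner_U, ContinuousLinearEquiv.coe_coe, hu, inner_U,
    ← GAlgebra.act_mul, inner_U_mul_inv]

/-- For an idempotent `e` with `eg = eh`, equivariance of translates gives `e(huh⁻¹)x =
((eh)u(eh)⁻¹)ex = ((eg)u(eg)⁻¹)ex = e(gug⁻¹)x`. The difference of the two translates is thus
annihilated by all such `e`, hence by `⟨φ_g, φ_h⟩`. -/
theorem specRep_ellKer_conjOp [EContinuous G] {u : X ≃L[ℂ] Y}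
    (hu : ∀ x y, HilbertModule.inner (A := A) (u x) (u y) = HilbertModule.inner x y)
    (g h : G) (x : X) :
    specRep G A Y (ellKer g h) (conjOp G A (u : X →L[ℂ] Y) h x)
      = specRep G A Y (ellKer g h) (conjOp G A (u : X →L[ℂ] Y) g x) := by
  rw [← sub_eq_zero, ← map_sub]
  refine specRep_ellKer_eq_zero g h fun e he => ?_
  rw [map_sub, ← conjOp_U hu, ← conjOp_U hu, (mem_kerSet.1 he).1, sub_self]

end SpecRep

/-! ### Elementary tensors and equivariant unitaries of `L²(G, X)` -/

section L2

variable {G A X Y : Type*} [InverseSemigroup G] [EContinuous G] [NonUnitalCStarAlgebra A]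
  [PartialOrder A] [StarOrderedRing A] [GAlgebra G A]
  [NormedAddCommGroup X] [NormedSpace ℂ X] [CompleteSpace X] [HilbertModule A X]
  [GHilbertModule G A X]
  [NormedAddCommGroup Y] [NormedSpace ℂ Y] [CompleteSpace Y] [HilbertModule A Y]
  [GHilbertModule G A Y]

namespace L2

theorem norm_ι_tmul_sq_le (x : EllHat2 G) (ξ : X) :
    ‖(L2Pre G A X).ι (x ⊗ₜ ξ)‖ ^ 2 ≤ ‖specRep G A X‖ * (‖x‖ * ‖ξ‖) ^ 2 := by
  rw [PreHilbert.norm_sq_ι, L2Pre_tmul]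
  calc _ ≤ ‖ξ‖ * ‖specRep G A X (HilbertModule.inner (A := C₀(SpecE G, ℂ)) x x) ξ‖ :=
        norm_inner_le A _ _
    _ ≤ ‖ξ‖ * (‖specRep G A X‖ * ‖HilbertModule.inner (A := C₀(SpecE G, ℂ)) x x‖ * ‖ξ‖) := by
        gcongr
        exact (specRep G A X).le_opNorm₂ _ _
    _ = _ := by
        rw [← norm_sq_eq (A := C₀(SpecE G, ℂ)) x]
        ring

variable (G A X) in
/-- The canonical bilinear map to the interior tensor product. -/
noncomputable def tmulL : EllHat2 G →L[ℂ] X →L[ℂ] L2 G A X :=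
  LinearMap.mkContinuous₂ ((TensorProduct.mk ℂ (EllHat2 G) X).compr₂ (L2Pre G A X).ι)
    √‖specRep G A X‖ fun x ξ => by
      refine (sq_le_sq₀ (norm_nonneg _) (by positivity)).1 ?_
      refine (norm_ι_tmul_sq_le x ξ).trans_eq ?_
      rw [mul_assoc, mul_pow (√‖specRep G A X‖)]
      exact congrArg (· * _) (Real.sq_sqrt (norm_nonneg (specRep G A X))).symm

variable (G A X) in
/-- The vector `φ_g ⊗ ξ`. -/
noncomputable def vec (g : G) : X →L[ℂ] L2 G A X := tmulL G A X (EllHat2.phi G g)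

theorem inner_vec (g h : G) (ξ η : X) :
    HilbertModule.inner (A := A) (vec G A X g ξ) (vec G A X h η)
      = HilbertModule.inner ξ (specRep G A X (ellKer g h) η) := by
  refine ((L2Pre G A X).inner_ι _ _).trans ((L2Pre_tmul G A X _ _ ξ η).trans ?_)
  rw [EllHat2.inner_phi]

theorem U_vec (k g : G) (ξ : X) :
    U (A := A) k (vec G A X g ξ) = vec G A X (k * g) (U (A := A) k ξ) := by
  refine ((L2Action G A X).extend_T k _).trans ?_
  refine congrArg (L2Pre G A X).ι ?_
  change _ ⊗ₜ[ℂ] _ = _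
  rw [EllHat2.U_phi]
  rfl

/-- The elementary tensors depend continuously on their first factor, so the dense span of the `φ_g`
may replace all of `EllHat2 G`. -/
theorem eq_top_of_vec_mem {S : Submodule ℂ (L2 G A X)} (hS : IsClosed (S : Set (L2 G A X)))
    (h : ∀ g ξ, vec G A X g ξ ∈ S) : S = ⊤ := by
  refine Submodule.eq_top_iff'.2 fun x => ?_
  refine (L2Pre G A X).induction (p := (· ∈ S)) x hS fun v => ?_
  induction v with
  | zero => rw [map_zero]; exact S.zero_mem
  | add v w hv hw => rw [map_add]; exact S.add_mem hv hw
  | tmul y ξ =>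
    have h1 : IsClosed {y | tmulL G A X y ξ ∈ S} := hS.preimage (by fun_prop)
    have h2 : Submodule.span ℂ (Set.range (EllHat2.phi G))
        ≤ S.comap ((tmulL G A X).flip ξ).toLinearMap := by
      refine Submodule.span_le.2 ?_
      rintro _ ⟨g, rfl⟩
      exact h g ξ
    have h3 := closure_minimal h2 h1
    rw [EllHat2.dense_span_phi.closure_eq] at h3
    exact h3 (Set.mem_univ y)

/-- This reflects `φ_g 1_{gg⁻¹} = φ_g`. It repairs the failure of the translates of a unitary to be
surjective. -/
theorem vec_U_ran (g : G) (ξ : X) : vec G A X g (U (A := A) (g * g⁻¹) ξ) = vec G A X g ξ := by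
  have h0 : specRep G A X (ellKer g g) (U (A := A) (g * g⁻¹) ξ)
      = specRep G A X (ellKer g g) ξ := by
    have h1 := specRep_mul (A := A) (ellKer g g) (SpecE.ind (Idem.ran g)) ξ
    rw [mul_comm, EllHat2.ran_ellKer', specRep_ind] at h1
    exact h1.symm
  rw [← sub_eq_zero, ← map_sub]
  apply eq_zero_of_inner_self A
  rw [inner_vec, map_sub, h0, sub_self, inner_zero_right]

end L2

open L2

theorem dense_span_of_forall {V : Type*} [NormedAddCommGroup V] [NormedSpace ℂ V] {s : Set V}
    (h : ∀ S : Submodule ℂ V, IsClosed (S : Set V) → s ⊆ S → S = ⊤) :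
    Dense (Submodule.span ℂ s : Set V) :=
  Submodule.dense_iff_topologicalClosure_eq_top.2 (h _ (Submodule.isClosed_topologicalClosure _)
    (Submodule.subset_span.trans (Submodule.le_topologicalClosure _)))

variable (G A X) in
/-- `L²(G, X^∞) ≅ L²(G, X)^∞` -/
theorem L2.nonempty_iso_sum :
    Nonempty (GHilbertIso G A (L2 G A (HilbertSum A X)) (HilbertSum A (L2 G A X))) := by
  refine GHilbertIso.nonempty_of_total
    -- The tensors `φ_g ⊗ ξ` with `ξ` in the `n`-th summand correspond to `φ_g ⊗ ξ` placed in the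
    -- `n`-th summand. The action moves `g` and `ξ` but keeps `n`.
    (fun i : ℕ × G × X => vec G A (HilbertSum A X) i.2.1 (inc A X i.1 i.2.2))
    (fun i : ℕ × G × X => inc A (L2 G A X) i.1 (vec G A X i.2.1 i.2.2))
    (fun k i => (i.1, k * i.2.1, U (A := A) k i.2.2)) ?_ ?_ ?_ ?_ ?_
  · refine dense_span_of_forall fun S hS hmem => eq_top_of_vec_mem hS fun g x => ?_
    have h1 := eq_top_of_inc_mem (S := S.comap (vec G A (HilbertSum A X) g).toLinearMap)
      (hS.preimage (vec G A (HilbertSum A X) g).continuous) fun n ξ => hmem ⟨(n, g, ξ), rfl⟩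
    have h2 : x ∈ S.comap (vec G A (HilbertSum A X) g).toLinearMap := h1 ▸ Submodule.mem_top
    exact h2
  · refine dense_span_of_forall fun S hS hmem => eq_top_of_inc_mem hS fun n x => ?_
    have h1 := eq_top_of_vec_mem (S := S.comap (inc A (L2 G A X) n).toLinearMap)
      (hS.preimage (inc A (L2 G A X) n).continuous) fun g ξ => hmem ⟨(n, g, ξ), rfl⟩
    have h2 : x ∈ S.comap (inc A (L2 G A X) n).toLinearMap := h1 ▸ Submodule.mem_top
    exact h2
  · rintro ⟨m, g, ξ⟩ ⟨n, h, η⟩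
    refine (inner_vec g h _ _).trans ?_
    refine Eq.trans ?_ (inner_inc m n (vec G A X g ξ) (vec G A X h η)).symm
    rw [inner_vec, specRep_inc (A := A) (X := X) (ellKer g h) n η]
    exact inner_inc m n ξ _
  · rintro k ⟨n, g, ξ⟩
    exact (U_vec k g _).trans (congrArg _ (U_inc k n ξ))
  · rintro k ⟨n, g, ξ⟩
    exact (U_inc k n _).trans (congrArg _ (U_vec k g ξ))

/-- A unitary that need not be equivariant induces an equivariant one,
`φ_g ⊗ ξ ↦ φ_g ⊗ g u g⁻¹ ξ`. -/
theorem L2.nonempty_iso {u : X ≃L[ℂ] Y}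
    (hu : ∀ x y, HilbertModule.inner (A := A) (u x) (u y) = HilbertModule.inner x y) :
    Nonempty (GHilbertIso G A (L2 G A X) (L2 G A Y)) := by
  refine GHilbertIso.nonempty_of_total (fun i : G × X => vec G A X i.1 i.2)
    (fun i : G × X => vec G A Y i.1 (conjOp G A (u : X →L[ℂ] Y) i.1 i.2))
    (fun k i => (k * i.1, U (A := A) k i.2)) ?_ ?_ ?_ ?_ ?_
  · exact dense_span_of_forall fun S hS hmem => eq_top_of_vec_mem hS fun g ξ =>
      hmem ⟨(g, ξ), rfl⟩
  · refine dense_span_of_forall fun S hS hmem => eq_top_of_vec_mem hS fun g η => ?_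
    -- The translate of `u` by `g` need not reach `η`, but it reaches `gg⁻¹η`, with preimage `g u⁻¹
    -- g⁻¹ η`. By `vec_U_ran` the two give the same vector after tensoring with `φ_g`.
    have h1 : conjOp G A (u : X →L[ℂ] Y) g (U (A := A) g (u.symm (U (A := A) g⁻¹ η)))
        = U (A := A) (g * g⁻¹) η := by
      rw [conjOp_apply, ← U_mul g⁻¹, ContinuousLinearEquiv.coe_coe,
        map_U_idem hu (inv_mul_idem g), u.apply_symm_apply, ← U_mul, ← U_mul, mul_assoc,
        inv_mul_inv]
    have h2 := hmem ⟨(g, U (A := A) g (u.symm (U (A := A) g⁻¹ η))), rfl⟩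
    dsimp only at h2
    rwa [h1, vec_U_ran] at h2
  · rintro ⟨g, ξ⟩ ⟨h, η⟩
    -- With `K = ⟨φ_g, φ_h⟩` and `u_g = gug⁻¹`, the chain is `⟨u_g ξ, K u_h η⟩ = ⟨u_g ξ, K u_g η⟩ =
    -- ⟨u_g ξ, u_g Kη⟩ = ⟨ξ, gg⁻¹Kη⟩ = ⟨ξ, Kη⟩`.
    rw [inner_vec, inner_vec, specRep_ellKer_conjOp hu, ← conjOp_specRep hu, inner_conjOp hu,
      U_ran_specRep_ellKer]
  · rintro k ⟨g, ξ⟩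
    exact U_vec k g ξ
  · rintro k ⟨g, ξ⟩
    rw [U_vec, conjOp_U hu]

end L2

/-! ### The stabilisation theorem -/

theorem mainTheorem7 {G : Type*} [InverseSemigroup G] [EContinuous G]
    {A : Type*} [NonUnitalCStarAlgebra A] [PartialOrder A] [StarOrderedRing A] [GAlgebra G A]
    {E : Type*} [NormedAddCommGroup E] [NormedSpace ℂ E] [CompleteSpace E]
    [HilbertModule A E] [GHilbertModule G A E]
    (hA : HasStrictlyPositiveElement A)
    (hE : HilbertModule.IsCountablyGenerated A E)
    (hfull : HilbertModule.IsFull A E) :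
    Nonempty (GHilbertIso G A (HilbertSum A (L2 G A E)) (HilbertSum A (L2 G A A))) := by
  obtain ⟨V, hV⟩ := hfull.exists_unitary hE hA
  obtain ⟨i⟩ := L2.nonempty_iso_sum G A E
  obtain ⟨j⟩ := L2.nonempty_iso_sum G A A
  -- The unitary `V : E^∞ → A^∞` ignores the action of `G`. Passing to `L²(G, ·)` makes it
  -- equivariant.
  obtain ⟨k⟩ := L2.nonempty_iso (G := G) hV
  obtain ⟨i'⟩ := i.nonempty_symm
  obtain ⟨l⟩ := i'.nonempty_trans k
  exact l.nonempty_trans j
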